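/- **Liveness of Carnot 1.** Consider $n\ge 4f+1$ processors ($n\ge 2$), of which at most $f$ become corrupted and then behave arbitrarily; the others are called correct. Cryptographic primitives (signatures, threshold signatures, hash function) are perfect. Time is divided into timeslots $t\in\mathbb N$. A message sent by a correct processor to another correct processor at $t$ arrives at some $t'>t$ with $t'\le\max\{\mathrm{GST},t\}+\Delta$, where $\Delta\ge 1$ is known and $\mathrm{GST}$ is unknown; correct processors start by $\mathrm{GST}$, and messages to oneself are received at once. Let $\delta\le\Delta$ be any bound such that each of these messages sent at $t$ arrives by $\max\{\mathrm{GST},t\}+\delta$. *Protocol.* Views $v=1,2,\dots$ are grouped into superviews of $x\ge 2$ consecutive views; superview $w$ is $[(w-1)x+1,wx]$, its first view is called initial, and all its views $v$ have the leader $\mathtt{lead}(v)=p_{j+1}$, $0\le j<n$, $j\equiv w \bmod n$. A block is $b=(v,\tau(C,k),h)$, signed by $\mathtt{lead}(v)$, with payload $C$ (a sequence of transactions), $n-f-1\le k\le n-1$, $h$ the hash of its parent block, and tag $\tau(C,k)=(\beta,k,r)$, where $\beta$ is the length of $C$ and $r$ is the Merkle root of the $n$ fragments of $C$ under an $(n,k)$-erasure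 code; the genesis block has view $0$, empty payload and no parent. A certified fragment of $b$ at $j$ is a fragment $c$ of the right length with a Merkle validation path from $r$ to $c$ at position $j$. *Decoding* from $k$ certified fragments reconstructs a payload, and fails unless its tag is the tag of $b$. A stage-1 notarisation is a set of at least $n-\frac32f$ stage-1 votes for $b$ by distinct processors; an M-certificate, resp. a stage-2 certificate, for $b$ is formed from $f+1$, resp. $n-f$, stage-2 votes for $b$ by distinct processors; an N-certificate for $v$ is formed from $2f+1$ nullify$(v)$ messages by distinct processors. These certificates are formed automatically from the messages received. A processor's set $\mathtt{blocks}$ contains the genesis block, and every block with an M-certificate whose parent is in $\mathtt{blocks}$; $\mathtt{blocks}^*$ contains every block with a stage-1 notarisation whose parent is in $\mathtt{blocks}$ and which decodes from $k$ certified fragments $(b,j,c_j,\pi_j)$, each received from $p_j$. Each processor has a current view $\mathtt v$ (initially $1$), a block $\mathtt b$ (initially genesis) and a timer (reset to $0$ upon entering a view). In every timeslot each correct processor $p_i$ carries out the following, in this order and repeatedly until nothing changes (so it acts immediately upon entering a view). 1. Send all new certificates to all. 2. If it leads $\mathtt v$, then: if $\mathtt v$ is initial and $p_i$ has not yet proposed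 for the superview, it proposes a block for view $\mathtt v$ with parent $\mathtt b$; otherwise it may propose a block for the view following that of its last proposal in the superview, with that proposal as parent, while views of the superview remain. The payload contains all transactions received and not known to be in payloads of the parent or its ancestors. Here $k=g(\mathtt S,v)\in[n-f-1,n-1]$ for the received messages $\mathtt S$ and the view $v$ of the block, with $k=n-f-1$ for initial views; the certified fragment of the block at $j$ is sent to $p_j$ for each $j$. 3. If it has received its own certified fragment $(b,i,c_i,\pi_i)$ of a view-$\mathtt v$ block $b$ whose parent $b'$ is in $\mathtt{blocks}$, has view less than $\mathtt v$, and is such that $p_i$ has N-certificates for all views strictly between that of $b'$ and $\mathtt v$, and it has not stage-1 voted in $\mathtt v$, it sends a stage-1 vote for $b$ and, unless it leads $\mathtt v$, this fragment to all. 4. If a view-$\mathtt v$ block is in $\mathtt{blocks}^*$ and it has neither stage-2 voted in nor nullified $\mathtt v$, it sends a stage-2 vote for the block to all. 5. If a view-$\mathtt v$ block is in $\mathtt{blocks}$, it sends a stage-2 vote for it to all under the same proviso, sets $\mathtt b$ to this block and enters view $\mathtt v+1$. 6. If it has not nullified $\mathtt v$, has not stage-2 voted in $\mathtt v$, and its timer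 equals $2\Delta$ ($3\Delta$ if $\mathtt v$ is initial), or equals $\Delta$ ($2\Delta$ if $\mathtt v$ is initial) and it has not stage-1 voted in $\mathtt v$ either, it sends nullify$(v)$ to all for every $v\ge\mathtt v$ in the superview, and these views are nullified. 7. If it has an N-certificate for $\mathtt v$, it enters view $\mathtt v+1$. *The log.* For a set $M$ of messages, consider the sequences of blocks $b_1,\dots,b_m$, each $b_i$ ($i<m$) the parent of $b_{i+1}$, such that for each $i$ the set $M$ contains a stage-2 certificate for some $b_j$ with $j\ge i$, and contains $k$ certified fragments of $b_i$ from which it decodes, where $k$ is the parameter in the tag of $b_i$. If there is a unique longest such sequence, $\mathcal F(M)$ is the concatenation of the payloads of $b_1,\dots,b_m$; otherwise it is empty. Let $M_c(t)$ be the set of messages received by at least one correct processor at a timeslot $\le t$. **Statement.** In every execution: (i) if a correct processor receives a transaction $\mathrm{tr}$, then $\mathrm{tr}\in\mathcal F(M_c(t))$ for some $t$; (ii) every correct processor enters every view $v\ge1$; (iii) if a correct processor enters view $v\geq 1$ at $t$, then all correct processors enter view $v$ by $\max\{t,\mathrm{GST}\}+\delta$; (iv) if $v\ge 1$ is initial,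 $\mathtt{lead}(v)$ is correct, and the first correct processor to enter $v$ does so at $t\ge\mathrm{GST}$, then there is a view-$v$ block $b$, proposed by $\mathtt{lead}(v)$ by $t+4\delta$, for which all correct processors have a stage-2 certificate by $t+4\delta$; for some $s$ the payloads of $b$ and of all its non-genesis ancestors can be decoded from certified fragments in $M_c(s)$; all correct processors enter view $v+1$ by $t+4\delta$; and no correct processor ever sends nullify$(v)$. -/

import Mathlib

namespace Carnot

universe u w

/-! Tags, blocks, hash inputs, messages -/

/-- A tag `(β, k, r)`: payload length, reconstruction parameter, Merkle root. -/
structure Tag (D : Type u) where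
  len : ℕ
  k : ℕ
  root : D

/-- A block `(v, tag, h)`. `par` is the hash of the parent block; it is `none` (the empty sequence)
for the genesis block. -/
structure Block (D : Type u) where
  view : ℕ
  tag : Tag D
  par : Option D

/-- What the hash function is applied to: bit strings (leaves of Merkle trees), pairs of hash
values (inner nodes of Merkle trees), and blocks. -/
inductive HashInput (D : Type u) where
  | str (s : List Bool)
  | pair (l r : D)
  | block (b : Block D)

/-- Well-formed messages. The signatures, signature shares and threshold signatures which they carry
are valid ones, hence determined by the remaining entries and not displayed. In every message that
mentions a block `b` with `b.view ≥ 1`, this block carries the signature of `lead b.view`.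
What an adversary can produce is regulated by `Execution.Producible`. -/
inductive Msg (n : ℕ) (D : Type u) (Tx : Type w) where
  /-- a transaction -/
  | tx (tr : Tx)
  /-- `(b, j, c, π)` -/
  | frag (b : Block D) (j : Fin n) (c : List Bool) (path : List D)
  /-- stage-1 vote by `i`, signed by `i` -/
  | vote1 (b : Block D) (i : Fin n)
  /-- stage-2 vote by `i`, with the shares of `i` for the `(f+1)`-of-`n` and the `(n-f)`-of-`n`
  threshold signature schemes -/
  | vote2 (b : Block D) (i : Fin n)
  /-- stage-2 M-certificate, with an `(f+1)`-of-`n` threshold signature -/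
  | mcert (b : Block D)
  /-- stage-2 certificate, with an `(n-f)`-of-`n` threshold signature -/
  | cert (b : Block D)
  /-- nullify message by `i`, with the share of `i` for the `(2f+1)`-of-`n` threshold scheme -/
  | nullify (v : ℕ) (i : Fin n)
  /-- N-certificate, with a `(2f+1)`-of-`n` threshold signature -/
  | ncert (v : ℕ)

/-- A received message together with its sender; `none` is the environment. -/
abbrev Rcvd (n : ℕ) (D : Type u) (Tx : Type w) := Option (Fin n) × Msg n D Tx

/-- `(n,k)`-erasure codes for all `k ∈ [1,n]`: any `k` of the `n` fragments of `C`, together with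
the length of `C`, determine `C`; the common size of the fragments depends on `n`, `k` and the
length only. -/
structure ErasureCode (n : ℕ) where
  encode : ℕ → List Bool → Fin n → List Bool
  fragLen : ℕ → ℕ → ℕ
  /-- `decode k β I c` reconstructs from the fragments `c i`, `i ∈ I`; it may fail. -/
  decode : ℕ → ℕ → (I : Finset (Fin n)) → (I → List Bool) → Option (List Bool)
  length_encode : ∀ k C i, 1 ≤ k → k ≤ n → (encode k C i).length = fragLen k C.length
  decode_encode : ∀ k C (I : Finset (Fin n)), 1 ≤ k → k ≤ n → I.card = k →
    decode k C.length I (fun i => encode k C i) = some C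

/-- The parameters of the protocol. -/
structure Setting (D : Type u) (Tx : Type w) where
  /-- number of processors -/
  n : ℕ
  /-- bound on the number of corrupted processors -/
  f : ℕ
  /-- number of views per superview -/
  x : ℕ
  /-- known bound on message delay -/
  Δ : ℕ
  n_pos : 0 < n
  code : ErasureCode n
  /-- perfect (collision-free) hash function -/
  H : HashInput D ↪ D
  /-- how a sequence of transactions is written as a bit string -/
  ser : List Tx ↪ List Bool
  /-- choice of the reconstruction parameter, from the received messages and the view -/
  g : Set (Rcvd n D Tx) → ℕ → ℕ
  g_mem : ∀ S v, n - f - 1 ≤ g S v ∧ g S v ≤ n - 1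
  g_initial : ∀ S v, v ≡ 1 [MOD x] → g S v = n - f - 1

namespace Setting

variable {D : Type u} {Tx : Type w} (P : Setting D Tx)

/-- The type of processors. -/
abbrev Proc : Type := Fin P.n

/-- Sets of received messages. -/
abbrev Rcvds : Type (max u w) := Set (Rcvd P.n D Tx)

/-- Sets of messages. -/
abbrev Msgs : Type (max u w) := Set (Msg P.n D Tx)

/-! Merkle trees, encoding, decoding -/

/-- One level up in a Merkle tree. -/
def levelUp (v : ℕ → D) : ℕ → D := fun i => P.H (.pair (v (2 * i)) (v (2 * i + 1)))

/-- The leaves: hashes of the values, padded by hashes of the empty string. -/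
def leaves (c : P.Proc → List Bool) : ℕ → D :=
  fun i => if h : i < P.n then P.H (.str (c ⟨i, h⟩)) else P.H (.str [])

/-- Depth of a binary tree with room for `n` leaves. -/
def depth : ℕ := Nat.clog 2 P.n

/-- Root of the Merkle tree of `c 0, …, c (n-1)`. -/
def merkleRoot (c : P.Proc → List Bool) : D := (P.levelUp^[P.depth] (P.leaves c)) 0

/-- Siblings on the way up from position `i`. -/
def siblings : ℕ → (ℕ → D) → ℕ → List D
  | 0, _, _ => []
  | d + 1, v, i => v (if i % 2 = 0 then i + 1 else i - 1) :: siblings d (P.levelUp v) (i / 2)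

/-- Recompute the root from the node `y` at position `i` and the list of siblings. -/
def climb : ℕ → D → List D → D
  | _, y, [] => y
  | i, y, s :: path =>
    climb (i / 2) (if i % 2 = 0 then P.H (.pair y s) else P.H (.pair s y)) path

/-- `path` is a validation path from `r` to `c` at position `i`. -/
def ValidPath (r : D) (i : P.Proc) (c : List Bool) (path : List D) : Prop :=
  path.length = P.depth ∧ P.climb i (P.H (.str c)) path = r

/-- The tag `τ(C, k)`. -/
def tau (C : List Bool) (k : ℕ) : Tag D := ⟨C.length, k, P.merkleRoot (P.code.encode k C)⟩

/-- The `i`-th certified fragment of `Encode(C, k)`. -/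
def fragment (C : List Bool) (k : ℕ) (i : P.Proc) : List Bool × List D :=
  (P.code.encode k C i, P.siblings P.depth (P.leaves (P.code.encode k C)) i)

/-- `(c, path)` is a certified fragment of the tag `z` at `i`. -/
def Certified (z : Tag D) (i : P.Proc) (c : List Bool) (path : List D) : Prop :=
  c.length = P.code.fragLen z.k z.len ∧ P.ValidPath z.root i c path

open Classical in
/-- Decode: reconstruct, re-encode, and compare the tags. -/
noncomputable def Decode (z : Tag D) (I : Finset P.Proc) (c : I → List Bool) :
    Option (List Bool) :=
  match P.code.decode z.k z.len I c with
  | none => none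
  | some C => if P.tau C z.k = z then some C else none

/-- Decode yields `C` from `k` certified fragments of `b` among those for which `has` holds. -/
def DecodesFrom (has : P.Proc → List Bool → List D → Prop) (b : Block D) (C : List Bool) : Prop :=
  ∃ (I : Finset P.Proc) (c : P.Proc → List Bool) (path : P.Proc → List D),
    I.card = b.tag.k ∧
    (∀ j ∈ I, has j (c j) (path j) ∧ P.Certified b.tag j (c j) (path j)) ∧
    P.Decode b.tag I (fun j => c j) = some C

/-- The payload of `b` can be recovered from the messages in `M`, and is `C`. -/
def Recovers (M : P.Msgs) (b : Block D) (C : List Bool) : Prop :=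
  P.DecodesFrom (fun j c path => Msg.frag b j c path ∈ M) b C

/-- The sequence of transactions written by a bit string (empty if it is not of this form). -/
noncomputable def parse (C : List Bool) : List Tx := (Function.partialInv P.ser C).getD []

/-! Views, leaders, blocks -/

/-- The superview to which a view `v ≥ 1` belongs. -/
def superview (v : ℕ) : ℕ := (v - 1) / P.x + 1

/-- Initial views. -/
def Initial (v : ℕ) : Prop := v ≡ 1 [MOD P.x]

/-- The leader of view `v`; `p_{j+1}` is the element `j` of `Fin n`. -/
def lead (v : ℕ) : P.Proc := ⟨P.superview v % P.n, Nat.mod_lt _ P.n_pos⟩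

/-- The genesis block; its payload is the empty sequence. -/
def genesis : Block D := ⟨0, P.tau (P.ser []) P.n, none⟩

/-- Format of the blocks other than the genesis block. -/
def Proper (b : Block D) : Prop :=
  1 ≤ b.view ∧ P.n - P.f - 1 ≤ b.tag.k ∧ b.tag.k ≤ P.n - 1 ∧ b.par.isSome

/-- `a` is the parent of `b`. -/
def Parent (a b : Block D) : Prop := b.par = some (P.H (.block a))

/-- `a` is an ancestor of `b` (every block is an ancestor of itself). -/
def Ancestor (a b : Block D) : Prop := Relation.ReflTransGen P.Parent a b

/-! The function `F` of extractable SMR -/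

/-- The conditions on the sequence `b_1, …, b_m` in the definition of `F`. -/
def Extractable (M : P.Msgs) (l : List (Block D)) : Prop :=
  (∀ b ∈ l, b = P.genesis ∨ P.Proper b) ∧
  l.IsChain P.Parent ∧
  ∀ i : Fin l.length,
    (∃ j : Fin l.length, i ≤ j ∧ Msg.cert (l.get j) ∈ M) ∧ ∃ C, P.Recovers M (l.get i) C

/-- A sequence as above of greatest possible length. -/
def Longest (M : P.Msgs) (l : List (Block D)) : Prop :=
  P.Extractable M l ∧ ∀ l₂, P.Extractable M l₂ → l₂.length ≤ l.length

open Classical in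
/-- The transactions in the payload of `b`, as recovered from `M`. -/
noncomputable def payload (M : P.Msgs) (b : Block D) : List Tx :=
  if h : ∃ C, P.Recovers M b C then P.parse h.choose else []

open Classical in
/-- The function `F`. -/
noncomputable def F (M : P.Msgs) : List Tx :=
  if h : ∃! l, P.Longest M l then h.choose.flatMap (P.payload M) else []

/-! What a processor derives from its set `S` of received messages -/

/-- `m` has been received, from whatever source. -/
def Has (S : P.Rcvds) (m : Msg P.n D Tx) : Prop := ∃ src, (src, m) ∈ S

/-- `certificates` contains a stage-2 M-certificate for `b`. -/
def HasM (S : P.Rcvds) (b : Block D) : Prop :=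
  P.Has S (.mcert b) ∨ P.f + 1 ≤ {i : P.Proc | P.Has S (.vote2 b i)}.ncard

/-- `certificates` contains a stage-2 certificate for `b`. -/
def HasC (S : P.Rcvds) (b : Block D) : Prop :=
  P.Has S (.cert b) ∨ P.n - P.f ≤ {i : P.Proc | P.Has S (.vote2 b i)}.ncard

/-- `certificates` contains an N-certificate for `v`. -/
def HasN (S : P.Rcvds) (v : ℕ) : Prop :=
  P.Has S (.ncert v) ∨ 2 * P.f + 1 ≤ {i : P.Proc | P.Has S (.nullify v i)}.ncard

/-- The local variable `certificates`. -/
def certificates (S : P.Rcvds) : P.Msgs :=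
  {m | (∃ b, m = .mcert b ∧ P.HasM S b) ∨ (∃ b, m = .cert b ∧ P.HasC S b) ∨
    ∃ v, m = .ncert v ∧ P.HasN S v}

/-- A stage-1 notarisation for `b`, i.e. at least `n - 3f/2` stage-1 votes, has been received. -/
def Notarised (S : P.Rcvds) (b : Block D) : Prop :=
  2 * P.n ≤ 2 * {i : P.Proc | P.Has S (.vote1 b i)}.ncard + 3 * P.f

/-- The local variable `blocks`. -/
inductive InBlocks (S : P.Rcvds) : Block D → Prop where
  | genesis : InBlocks S P.genesis
  | step (a b : Block D) : InBlocks S a → P.Parent a b → P.Proper b → P.HasM S b → InBlocks S b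

/-- The local variable `blocks*`. -/
def InBlocksStar (S : P.Rcvds) (b : Block D) : Prop :=
  b = P.genesis ∨
  (P.Proper b ∧ P.Notarised S b ∧
    (∃ C, P.DecodesFrom (fun j c path => (some j, Msg.frag b j c path) ∈ S) b C) ∧
    ∃ a, P.InBlocks S a ∧ P.Parent a b)

/-- `(b, p, c, path)` has been received by `p` and is votable for view `v`. -/
def Votable (p : P.Proc) (S : P.Rcvds) (v : ℕ) (b : Block D) (c : List Bool) (path : List D) :
    Prop :=
  P.Has S (.frag b p c path) ∧ P.Proper b ∧ b.view = v ∧ P.Certified b.tag p c path ∧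
  ∃ a, P.InBlocks S a ∧ P.Parent a b ∧ a.view < v ∧ ∀ u, a.view < u → u < v → P.HasN S u

/-! Local states and the instructions of a processor -/

/-- The local state of a processor. -/
structure State where
  /-- all messages received so far -/
  S : P.Rcvds
  /-- the messages sent in the present timeslot, with their recipients -/
  out : Set (P.Proc × Msg P.n D Tx)
  /-- value of `certificates` at the end of the previous timeslot -/
  oldCerts : P.Msgs
  view : ℕ
  /-- the local variable `b` -/
  tip : Block D
  timer : ℕ
  voted1 : Set ℕ
  voted2 : Set ℕ
  nullified : Set ℕ
  /-- the blocks proposed so far, with their payloads -/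
  proposed : Set (Block D × List Bool)

/-- The state in which a processor begins. -/
def init : P.State where
  S := ∅
  out := ∅
  oldCerts := ∅
  view := 1
  tip := P.genesis
  timer := 0
  voted1 := ∅
  voted2 := ∅
  nullified := ∅
  proposed := ∅

variable {P}

/-- Messages arrive. -/
def State.receive (s : P.State) (R : P.Rcvds) : P.State := { s with S := s.S ∪ R }

/-- The next timeslot begins, with the arrival of the messages in `R`. -/
def State.next (s : P.State) (R : P.Rcvds) : P.State :=
  { s with
    S := s.S ∪ R
    out := ∅
    oldCerts := P.certificates s.S
    timer := s.timer + 1 }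

/-- `p` sends messages to the indicated recipients. What it sends to itself is received at once. -/
def State.send (p : P.Proc) (A : Set (P.Proc × Msg P.n D Tx)) (s : P.State) : P.State :=
  { s with
    S := s.S ∪ {y | ∃ m, y = (some p, m) ∧ (p, m) ∈ A}
    out := s.out ∪ A }

/-- `p` sends the messages in `B` to all processors. -/
def State.disseminate (p : P.Proc) (B : P.Msgs) (s : P.State) : P.State :=
  s.send p {y | y.2 ∈ B}

/-- Enter the next view. -/
def State.nextView (s : P.State) : P.State := { s with view := s.view + 1, timer := 0 }

/-- The present view is initial and no block has been proposed for its superview. -/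
def FreshInitial (s : P.State) : Prop :=
  P.Initial s.view ∧ ∀ y ∈ s.proposed, P.superview y.1.view ≠ P.superview s.view

/-- The transaction `tr` is known to be included in the payload of an ancestor of `b`: the payload
has been recovered, or it is one that the processor has formed itself. -/
def Known (s : P.State) (b : Block D) (tr : Tx) : Prop :=
  ∃ a C, P.Ancestor a b ∧ (P.Recovers {m | P.Has s.S m} a C ∨ (a, C) ∈ s.proposed) ∧
    tr ∈ P.parse C

/-- `p` proposes a block for view `v` with parent `bp`. -/
def Propose (p : P.Proc) (v : ℕ) (bp : Block D) (s s₂ : P.State) : Prop :=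
  ∃ l : List Tx,
    (∀ tr, P.Has s.S (.tx tr) → ¬ Known s bp tr → tr ∈ l) ∧
    (∀ tr ∈ l, P.Has s.S (.tx tr)) ∧
    ∃ C k b, C = P.ser l ∧ k = P.g s.S v ∧ b = ⟨v, P.tau C k, some (P.H (.block bp))⟩ ∧
      s₂ = State.send p
        {y | y.2 = .frag b y.1 (P.fragment C k y.1).1 (P.fragment C k y.1).2}
        { s with proposed := insert (b, C) s.proposed }

/-- Disseminate new certificates. -/
def CertStep (p : P.Proc) (s s₂ : P.State) : Prop :=
  s₂ = s.disseminate p (P.certificates s.S \ s.oldCerts)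

/-- Propose a block. A leader which has not yet proposed for the superview of the present, initial
view has to do so. Otherwise it is free to extend (or not) the last block it has proposed for this
superview, as long as there are views left in the superview. -/
def ProposeStep (p : P.Proc) (s s₂ : P.State) : Prop :=
  (p = P.lead s.view ∧ FreshInitial s ∧ Propose p s.view s.tip s s₂) ∨
  (p = P.lead s.view ∧ ¬ FreshInitial s ∧
    ∃ y ∈ s.proposed, P.superview y.1.view = P.superview s.view ∧
      (∀ z ∈ s.proposed, P.superview z.1.view = P.superview s.view → z.1.view ≤ y.1.view) ∧
      P.superview (y.1.view + 1) = P.superview s.view ∧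
      Propose p (y.1.view + 1) y.1 s s₂) ∨
  (¬ (p = P.lead s.view ∧ FreshInitial s) ∧ s₂ = s)

/-- Stage-1 vote, and dissemination of the certified fragment. -/
def Vote1Step (p : P.Proc) (s s₂ : P.State) : Prop :=
  (s.view ∉ s.voted1 ∧ ∃ b c path, P.Votable p s.S s.view b c path ∧
    s₂ = State.disseminate p
      {m | m = .vote1 b p ∨ (p ≠ P.lead s.view ∧ m = .frag b p c path)}
      { s with voted1 := insert s.view s.voted1 }) ∨
  (¬ (s.view ∉ s.voted1 ∧ ∃ b c path, P.Votable p s.S s.view b c path) ∧ s₂ = s)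

/-- Stage-2 vote for `b`, unless such a vote or a nullify message has been sent for this view. -/
def CastVote2 (p : P.Proc) (b : Block D) (s s₂ : P.State) : Prop :=
  (s.view ∉ s.nullified ∧ s.view ∉ s.voted2 ∧
    s₂ = State.disseminate p {.vote2 b p} { s with voted2 := insert s.view s.voted2 }) ∨
  (¬ (s.view ∉ s.nullified ∧ s.view ∉ s.voted2) ∧ s₂ = s)

/-- Stage-2 vote for a block in `blocks*`. -/
def Vote2Step (p : P.Proc) (s s₂ : P.State) : Prop :=
  (∃ b, P.InBlocksStar s.S b ∧ b.view = s.view ∧ CastVote2 p b s s₂) ∨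
  ((¬ ∃ b, P.InBlocksStar s.S b ∧ b.view = s.view) ∧ s₂ = s)

/-- Leave the view because of a block in `blocks`, possibly after a stage-2 vote. -/
def BlockStep (p : P.Proc) (s s₂ : P.State) : Prop :=
  (∃ b s₁, P.InBlocks s.S b ∧ b.view = s.view ∧ CastVote2 p b s s₁ ∧
    s₂ = State.nextView { s₁ with tip := b }) ∨
  ((¬ ∃ b, P.InBlocks s.S b ∧ b.view = s.view) ∧ s₂ = s)

/-- The predicate `TimeoutReady`. -/
def TimeoutReady (s : P.State) : Prop :=
  (¬ P.Initial s.view ∧ s.timer = P.Δ ∧ s.view ∉ s.voted1 ∧ s.view ∉ s.voted2) ∨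
  (¬ P.Initial s.view ∧ s.timer = 2 * P.Δ ∧ s.view ∉ s.voted2) ∨
  (P.Initial s.view ∧ s.timer = 2 * P.Δ ∧ s.view ∉ s.voted1 ∧ s.view ∉ s.voted2) ∨
  (P.Initial s.view ∧ s.timer = 3 * P.Δ ∧ s.view ∉ s.voted2)

/-- Nullify the present view and the later views of its superview upon time-out. -/
def TimeoutStep (p : P.Proc) (s s₂ : P.State) : Prop :=
  (s.view ∉ s.nullified ∧ TimeoutReady s ∧
    s₂ = State.disseminate p
      {m | ∃ v, s.view ≤ v ∧ P.superview v = P.superview s.view ∧ m = .nullify v p}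
      { s with nullified :=
        s.nullified ∪ {v | s.view ≤ v ∧ P.superview v = P.superview s.view} }) ∨
  (¬ (s.view ∉ s.nullified ∧ TimeoutReady s) ∧ s₂ = s)

/-- Leave the view because of an N-certificate. -/
def NullStep (s s₂ : P.State) : Prop :=
  (P.HasN s.S s.view ∧ s₂ = s.nextView) ∨ (¬ P.HasN s.S s.view ∧ s₂ = s)

/-- One execution of the list of instructions, from top to bottom. -/
def Pass (p : P.Proc) (s s₇ : P.State) : Prop :=
  ∃ s₁ s₂ s₃ s₄ s₅ s₆, CertStep p s s₁ ∧ ProposeStep p s₁ s₂ ∧ Vote1Step p s₂ s₃ ∧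
    Vote2Step p s₃ s₄ ∧ BlockStep p s₄ s₅ ∧ TimeoutStep p s₅ s₆ ∧ NullStep s₆ s₇

/-- What a processor does in a timeslot: it executes the list of instructions until nothing changes
any more, so that it acts upon the entry into a view immediately, i.e. in the same timeslot. -/
def Slot (p : P.Proc) (s s₂ : P.State) : Prop :=
  Relation.ReflTransGen (Pass p) s s₂ ∧ Pass p s₂ s₂

end Setting

/-! Executions in partial synchrony -/

/-- The data of an execution. Only the components which belong to correct processors matter. -/
structure Run {D : Type u} {Tx : Type w} (P : Setting D Tx) where
  /-- the processors which never become corrupted -/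
  correct : Finset P.Proc
  /-- global stabilisation time -/
  GST : ℕ
  /-- the timeslot in which a processor begins -/
  start : P.Proc → ℕ
  /-- what a processor receives in a timeslot from the others and from the environment -/
  recv : P.Proc → ℕ → P.Rcvds
  /-- the state of a processor at the end of a timeslot -/
  state : P.Proc → ℕ → P.State

namespace Run

variable {D : Type u} {Tx : Type w} {P : Setting D Tx} (E : Run P)

/-- Every message between correct processors sent at `t` arrives after `t` and no later than
`max GST t + d`. -/
def DelayBound (d : ℕ) : Prop :=
  ∀ p ∈ E.correct, ∀ q ∈ E.correct, p ≠ q → ∀ t m, (q, m) ∈ (E.state p t).out →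
    ∃ t₂, t < t₂ ∧ t₂ ≤ max E.GST t + d ∧ (some p, m) ∈ E.recv q t₂

/-- `p` has sent the message `m` (to some processor) before `t`. -/
def SentBefore (p : P.Proc) (m : Msg P.n D Tx) (t : ℕ) : Prop :=
  ∃ t₀ < t, ∃ q, (q, m) ∈ (E.state p t₀).out

/-- A signature on `b` by the leader of its view may be available to the adversary before `t`. -/
def BlockSigned (b : Block D) (t : ℕ) : Prop :=
  1 ≤ b.view → P.lead b.view ∈ E.correct →
    ∃ t₀ < t, ∃ C, (b, C) ∈ (E.state (P.lead b.view) t₀).proposed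

/-- The signature or share of `i` in the message `m` may be available to the adversary
before `t`. -/
def Available (i : P.Proc) (m : Msg P.n D Tx) (t : ℕ) : Prop :=
  i ∈ E.correct → E.SentBefore i m t

/-- Messages which corrupted processors can produce before `t`, signatures and threshold signatures
being unforgeable. -/
def Producible (t : ℕ) : Msg P.n D Tx → Prop
  | .tx _ => True
  | .frag b _ _ _ => E.BlockSigned b t
  | .vote1 b i => E.BlockSigned b t ∧ E.Available i (.vote1 b i) t
  | .vote2 b i => E.BlockSigned b t ∧ E.Available i (.vote2 b i) t
  | .mcert b => E.BlockSigned b t ∧ P.f + 1 ≤ {i | E.Available i (.vote2 b i) t}.ncard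
  | .cert b => E.BlockSigned b t ∧ P.n - P.f ≤ {i | E.Available i (.vote2 b i) t}.ncard
  | .nullify v i => E.Available i (.nullify v i) t
  | .ncert v => 2 * P.f + 1 ≤ {i | E.Available i (.nullify v i) t}.ncard

/-- `E` is an execution of the protocol in partial synchrony with at most `f` corrupted
processors, whose behaviour is arbitrary. -/
structure IsExecution : Prop where
  /-- at most `f` processors become corrupted -/
  corrupted : (E.correctᶜ).card ≤ P.f
  /-- correct processors begin by `GST` -/
  start_le : ∀ p ∈ E.correct, E.start p ≤ E.GST
  /-- what arrives before a processor begins counts as received when it begins -/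
  recv_start : ∀ p ∈ E.correct, ∀ t < E.start p, E.recv p t = ∅
  recv_finite : ∀ p ∈ E.correct, ∀ t, (E.recv p t).Finite
  /-- the environment sends transactions -/
  environment : ∀ p ∈ E.correct, ∀ t m, (none, m) ∈ E.recv p t → ∃ tr, m = .tx tr
  /-- authenticated channels: messages from correct processors have been sent by them -/
  authentic : ∀ p ∈ E.correct, ∀ q ∈ E.correct, ∀ t m, (some q, m) ∈ E.recv p t →
    ∃ t₀ < t, (p, m) ∈ (E.state q t₀).out
  /-- perfect signatures and threshold signatures -/
  unforgeable : ∀ p ∈ E.correct, ∀ q ∉ E.correct, ∀ t m, (some q, m) ∈ E.recv p t →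
    E.Producible t m
  /-- partial synchrony -/
  delay : E.DelayBound P.Δ
  /-- correct processors follow the instructions -/
  state_before : ∀ p ∈ E.correct, ∀ t < E.start p, E.state p t = P.init
  state_start : ∀ p ∈ E.correct,
    Setting.Slot p (P.init.receive (E.recv p (E.start p))) (E.state p (E.start p))
  state_succ : ∀ p ∈ E.correct, ∀ t, E.start p ≤ t →
    Setting.Slot p ((E.state p t).next (E.recv p (t + 1))) (E.state p (t + 1))

/-- `M_c(t)`: the messages received by at least one correct processor at a timeslot `≤ t`. -/
def Mc (t : ℕ) : P.Msgs := {m | ∃ p ∈ E.correct, P.Has (E.state p t).S m}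

/-- Liveness: every transaction received by a correct processor is in `F(M_c(t))` for some `t`. -/
def Liveness : Prop :=
  ∀ p ∈ E.correct, ∀ t₀ src tr, (src, Msg.tx tr) ∈ E.recv p t₀ → ∃ t, tr ∈ P.F (E.Mc t)

/-- `p` has entered view `v` at or before the timeslot `t`. -/
def EnteredBy (p : P.Proc) (v t : ℕ) : Prop := E.start p ≤ t ∧ v ≤ (E.state p t).view

/-- `p` enters view `v` at the timeslot `t`. -/
def EntersAt (p : P.Proc) (v t : ℕ) : Prop :=
  E.EnteredBy p v t ∧ ∀ t₀ < t, ¬ E.EnteredBy p v t₀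

/-- The first correct processor to enter view `v` does so at `t`. -/
def FirstEntry (v t : ℕ) : Prop :=
  (∃ p ∈ E.correct, E.EntersAt p v t) ∧ ∀ q ∈ E.correct, ∀ t₀ < t, ¬ E.EnteredBy q v t₀

end Run

end Carnot

/-! Safety. Two sets of n - 3f/2 stage-1 voters share more than f processors because n > 4f, hence a
correct one, and a correct processor casts one stage-1 vote per view; so notarised blocks of equal
view coincide (`eq_of_notarised`). Every certificate made of stage-2 votes goes back to a correct
processor which had the block in blocks*: the block is endorsed (`endorsedMsg`), and its payload
decodes from received fragments (`Endorsed.recovers`). Among n - f stage-2 votes and 2f + 1 nullify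
messages for one view, some correct processor would have sent both, which never happens. Since a
child may skip only views with N-certificates, a block with a stage-2 certificate cannot be skipped:
it is an ancestor of every endorsed block of the same or a later view (`ancestor_of_certified`).

Synchrony and progress. A view is left because of a block in `blocks` or an N-certificate. Both rest
on certificates, which are forwarded to all, so after GST the other correct processors follow within
δ (`synced`). If all correct processors were stuck in a view, each would eventually have stage-2
voted or nullified. Either 2f + 1 of them have nullified, or f + 1 have voted, necessarily for the
same block; both outcomes end the view (`exists_entered_succ`).

Correct leaders. Let t be the first entry, after GST, into an initial view with a correct leader.
The leader proposes by t + δ, all correct processors have stage-1 voted by t + 2δ, stage-2 voted by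
t + 3δ, and hold a stage-2 certificate by t + 4δ, unless some of them get ahead through a
certificate. The time-outs 2Δ and 3Δ are just long enough. The argument needs that nobody has
nullified the view yet, and yields that nobody nullifies it now; induction on time closes this
circle (`not_timesOut`, `notNullified`).

The log. Certified blocks form a chain under ancestry, so the block of greatest view among them
determines the unique longest extractable sequence (`exists_longest`). A processor that has received
a transaction leads infinitely many superviews; in a late enough one its block is finalised, and the
transaction lies in the payload of that block or of an ancestor (`known_of_proposed`). -/

namespace Carnot

universe u w

namespace Setting

variable {D : Type u} {Tx : Type w} (P : Setting D Tx)

/-! Merkle trees and decoding -/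

theorem climb_siblings (d : ℕ) (v : ℕ → D) (i : ℕ) (hi : i < 2 ^ d) :
    P.climb i (v i) (P.siblings d v i) = (P.levelUp^[d] v) 0 := by
  induction d generalizing v i with
  | zero =>
    obtain rfl : i = 0 := by simpa using hi
    rfl
  | succ d ih =>
    rw [Function.iterate_succ_apply, ← ih (P.levelUp v) (i / 2) (by rw [pow_succ] at hi; omega)]
    simp only [siblings, climb]
    congr 1
    simp only [levelUp]
    split_ifs with h
    · rw [show 2 * (i / 2) = i by omega]
    · rw [show 2 * (i / 2) = i - 1 by omega, show i - 1 + 1 = i by omega]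

/-- Merkle trees are binding: an injective hash can be peeled off level by level from the root, so a
validation path of full length ends in the true node. -/
theorem eq_of_climb_eq (path : List D) (v : ℕ → D) (i : ℕ) (y : D) (hi : i < 2 ^ path.length)
    (h : P.climb i y path = (P.levelUp^[path.length] v) 0) : y = v i := by
  induction path generalizing v i y with
  | nil =>
    obtain rfl : i = 0 := by simpa using hi
    exact h
  | cons s path ih =>
    rw [List.length_cons, Function.iterate_succ_apply] at h
    have := ih (P.levelUp v) (i / 2) _
      (by rw [List.length_cons, pow_succ] at hi; omega) h
    simp only [levelUp] at this
    split_ifs at this with h2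
    · have := P.H.injective this
      simp only [HashInput.pair.injEq] at this
      rw [this.1, show 2 * (i / 2) = i by omega]
    · have := P.H.injective this
      simp only [HashInput.pair.injEq] at this
      rw [this.2, show 2 * (i / 2) + 1 = i by omega]

theorem lt_two_pow_depth (i : P.Proc) : (i : ℕ) < 2 ^ P.depth :=
  i.2.trans_le (Nat.le_pow_clog one_lt_two _)

theorem length_siblings (d : ℕ) (v : ℕ → D) (i : ℕ) : (P.siblings d v i).length = d := by
  induction d generalizing v i with
  | zero => rfl
  | succ d ih => simp [siblings, ih]

theorem leaves_apply (c : P.Proc → List Bool) (i : P.Proc) :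
    P.leaves c i = P.H (.str (c i)) := by
  simp [leaves]

theorem validPath_siblings (c : P.Proc → List Bool) (i : P.Proc) :
    P.ValidPath (P.merkleRoot c) i (c i) (P.siblings P.depth (P.leaves c) i) := by
  refine ⟨P.length_siblings _ _ _, ?_⟩
  rw [← leaves_apply]
  exact P.climb_siblings _ _ _ (P.lt_two_pow_depth i)

theorem ValidPath.eq {c : P.Proc → List Bool} {i : P.Proc} {c₁ : List Bool} {path : List D}
    (h : P.ValidPath (P.merkleRoot c) i c₁ path) : c₁ = c i := by
  obtain ⟨h1, h2⟩ := h
  have := P.eq_of_climb_eq path (P.leaves c) i _ (by rw [h1]; exact P.lt_two_pow_depth i)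
    (by rw [h1]; exact h2)
  rw [leaves_apply] at this
  simpa using P.H.injective this

theorem merkleRoot_injective : Function.Injective P.merkleRoot := by
  intro c c' h
  funext i
  have := P.validPath_siblings c i
  rw [h] at this
  exact this.eq

theorem certified_fragment (C : List Bool) {k : ℕ} (hk : 1 ≤ k) (hkn : k ≤ P.n) (i : P.Proc) :
    P.Certified (P.tau C k) i (P.fragment C k i).1 (P.fragment C k i).2 :=
  ⟨P.code.length_encode k C i hk hkn, P.validPath_siblings _ i⟩

theorem Certified.eq {C : List Bool} {k : ℕ} {i : P.Proc} {c : List Bool} {path : List D}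
    (h : P.Certified (P.tau C k) i c path) : c = P.code.encode k C i := h.2.eq

/-- The root fixes all fragments, and any `k` of these together with the length fix the payload. -/
theorem tau_injective {k : ℕ} (hk : 1 ≤ k) (hkn : k ≤ P.n) :
    Function.Injective fun C => P.tau C k := by
  intro C C' h
  simp only [tau, Tag.mk.injEq, true_and] at h
  have he := P.merkleRoot_injective h.2
  obtain ⟨I, hI⟩ := Finset.exists_subset_card_eq (s := (Finset.univ : Finset P.Proc)) (n := k)
    (by simpa using hkn)
  have h1 := P.code.decode_encode k C I hk hkn hI.2
  have h2 := P.code.decode_encode k C' I hk hkn hI.2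
  rw [he, h.1, h2] at h1
  exact (Option.some.inj h1).symm

theorem DecodesFrom.tau_eq {has : P.Proc → List Bool → List D → Prop} {b : Block D}
    {C : List Bool} (h : P.DecodesFrom has b C) : P.tau C b.tag.k = b.tag := by
  obtain ⟨I, c, path, -, -, h⟩ := h
  unfold Decode at h
  split at h
  · cases h
  · split_ifs at h with h2
    cases h
    exact h2

theorem DecodesFrom.mono {has has' : P.Proc → List Bool → List D → Prop} {b : Block D}
    {C : List Bool} (hh : ∀ j c path, has j c path → has' j c path)
    (h : P.DecodesFrom has b C) : P.DecodesFrom has' b C := by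
  obtain ⟨I, c, path, h1, h2, h3⟩ := h
  exact ⟨I, c, path, h1, fun j hj => ⟨hh _ _ _ (h2 j hj).1, (h2 j hj).2⟩, h3⟩

/-- Once the tag is known to be that of a real payload, certified fragments are the genuine ones
whoever sent them, so any `k` of them reconstruct this payload and the comparison of tags succeeds.
-/
theorem decodesFrom_of_certified {has : P.Proc → List Bool → List D → Prop} {b : Block D}
    {C : List Bool} {k : ℕ} (hb : b.tag = P.tau C k) (hk : 1 ≤ k) (hkn : k ≤ P.n)
    (I : Finset P.Proc) (hI : k ≤ I.card)
    (h : ∀ j ∈ I, ∃ c path, has j c path ∧ P.Certified b.tag j c path) :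
    P.DecodesFrom has b C := by
  obtain ⟨J, hJI, hJ⟩ := Finset.exists_subset_card_eq hI
  have h' : ∀ j, ∃ c path, j ∈ J → has j c path ∧ P.Certified b.tag j c path := by
    intro j
    by_cases hj : j ∈ J
    · obtain ⟨c, path, h⟩ := h j (hJI hj)
      exact ⟨c, path, fun _ => h⟩
    · exact ⟨[], [], fun h => absurd h hj⟩
  choose c path hc using h'
  refine ⟨J, c, path, by rw [hJ, hb]; rfl, fun j hj => hc j hj, ?_⟩
  have hce : (fun j : J => c j) = fun j : J => P.code.encode k C j := by
    funext j
    have := (hc j j.2).2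
    rw [hb] at this
    exact this.eq
  have hd := P.code.decode_encode k C J hk hkn hJ
  rw [hce, hb]
  simp only [Decode]
  have hd' : P.code.decode (P.tau C k).k (P.tau C k).len J
      (fun j : J => P.code.encode k C j) = some C := hd
  rw [hd']
  simp only [tau, if_true]

theorem parse_ser (l : List Tx) : P.parse (P.ser l) = l := by
  rw [parse, Function.partialInv_left P.ser.injective]
  rfl

/-! Blocks -/

variable {P}

theorem Parent.eq {a a' b : Block D} (h : P.Parent a b) (h' : P.Parent a' b) : a = a' := by
  have := h.symm.trans h'
  simpa using P.H.injective (Option.some.inj this)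

theorem not_parent_genesis (a : Block D) : ¬ P.Parent a P.genesis := by
  intro h
  cases h

end Setting

namespace Setting

variable {D : Type u} {Tx : Type w} {P : Setting D Tx}

/-! Monotonicity of what a processor derives from the received messages -/

theorem Has.mono {S S' : P.Rcvds} (h : S ⊆ S') {m : Msg P.n D Tx} (hm : P.Has S m) :
    P.Has S' m := by
  obtain ⟨src, hs⟩ := hm
  exact ⟨src, h hs⟩

theorem ncard_has_mono {S S' : P.Rcvds} (h : S ⊆ S') (φ : P.Proc → Msg P.n D Tx) :
    {i | P.Has S (φ i)}.ncard ≤ {i | P.Has S' (φ i)}.ncard :=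
  Set.ncard_le_ncard (fun _ hi => Has.mono h hi) (Set.toFinite _)

theorem HasM.mono {S S' : P.Rcvds} (h : S ⊆ S') {b : Block D} (hb : P.HasM S b) : P.HasM S' b :=
  hb.imp (Has.mono h) fun h1 => h1.trans (ncard_has_mono h _)

theorem HasN.mono {S S' : P.Rcvds} (h : S ⊆ S') {v : ℕ} (hb : P.HasN S v) : P.HasN S' v :=
  hb.imp (Has.mono h) fun h1 => h1.trans (ncard_has_mono h _)

theorem Notarised.mono {S S' : P.Rcvds} (h : S ⊆ S') {b : Block D} (hb : P.Notarised S b) :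
    P.Notarised S' b := by
  have := ncard_has_mono h (fun i => .vote1 b i)
  unfold Notarised at *
  omega

theorem InBlocks.of_hasM {S S' : P.Rcvds} (h : ∀ b, P.HasM S b → P.HasM S' b) {b : Block D}
    (hb : P.InBlocks S b) : P.InBlocks S' b := by
  induction hb with
  | genesis => exact .genesis
  | step a b _ h1 h2 h3 ih => exact .step a b ih h1 h2 (h _ h3)

theorem InBlocks.mono {S S' : P.Rcvds} (h : S ⊆ S') {b : Block D} (hb : P.InBlocks S b) :
    P.InBlocks S' b :=
  hb.of_hasM fun _ => HasM.mono h

theorem InBlocksStar.mono {S S' : P.Rcvds} (h : S ⊆ S') {b : Block D}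
    (hb : P.InBlocksStar S b) : P.InBlocksStar S' b := by
  rcases hb with hb | ⟨h1, h2, ⟨C, h3⟩, a, h4, h5⟩
  · exact .inl hb
  · exact .inr ⟨h1, h2.mono h, ⟨C, h3.mono P fun _ _ _ hm => h hm⟩, a, h4.mono h, h5⟩

theorem Recovers.mono {M M' : P.Msgs} (h : M ⊆ M') {b : Block D} {C : List Bool}
    (hb : P.Recovers M b C) : P.Recovers M' b C :=
  DecodesFrom.mono P (fun _ _ _ hm => h hm) hb

theorem InBlocks.cases_of_view {S : P.Rcvds} {b : Block D} (hb : P.InBlocks S b)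
    (hv : 1 ≤ b.view) :
    P.Proper b ∧ P.HasM S b ∧ ∃ a, P.InBlocks S a ∧ P.Parent a b := by
  cases hb with
  | genesis => exact absurd hv (by simp [Setting.genesis])
  | step a b h1 h2 h3 h4 => exact ⟨h3, h4, a, h1, h2⟩

theorem InBlocksStar.cases_of_view {S : P.Rcvds} {b : Block D} (hb : P.InBlocksStar S b)
    (hv : 1 ≤ b.view) : P.Proper b ∧ P.Notarised S b ∧
    (∃ C, P.DecodesFrom (fun j c path => (some j, Msg.frag b j c path) ∈ S) b C) ∧
    ∃ a, P.InBlocks S a ∧ P.Parent a b := by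
  rcases hb with rfl | hb
  · exact absurd hv (by simp [Setting.genesis])
  · exact hb

/-! Atomic actions -/

/-- The actions of which the instructions consist. -/
inductive Act (p : P.Proc) : P.State → P.State → Prop
  | cert (s) : Act p s (s.disseminate p (P.certificates s.S \ s.oldCerts))
  | proposeInitial (s s₂) (hp : p = P.lead s.view) (hf : FreshInitial s)
      (h : Propose p s.view s.tip s s₂) : Act p s s₂
  | proposeNext (s s₂) (y : Block D × List Bool) (hp : p = P.lead s.view) (hy : y ∈ s.proposed)
      (h1 : P.superview y.1.view = P.superview s.view)
      (h2 : P.superview (y.1.view + 1) = P.superview s.view)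
      (h : Propose p (y.1.view + 1) y.1 s s₂) : Act p s s₂
  | vote1 (s) (b c path) (hv : s.view ∉ s.voted1) (h : P.Votable p s.S s.view b c path) :
      Act p s (State.disseminate p
        {m | m = .vote1 b p ∨ (p ≠ P.lead s.view ∧ m = .frag b p c path)}
        { s with voted1 := insert s.view s.voted1 })
  | vote2 (s) (b) (hb : P.InBlocksStar s.S b ∨ P.InBlocks s.S b) (hv : b.view = s.view)
      (h1 : s.view ∉ s.nullified) (h2 : s.view ∉ s.voted2) :
      Act p s (State.disseminate p {.vote2 b p} { s with voted2 := insert s.view s.voted2 })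
  | block (s) (b) (hb : P.InBlocks s.S b) (hv : b.view = s.view)
      (h : s.view ∈ s.voted2 ∨ s.view ∈ s.nullified) :
      Act p s (State.nextView { s with tip := b })
  -- The premises `h3`, `h4`, `h5` are not tested by the instruction itself. They record that the
  -- voting instructions, which come earlier in the list, have had their chance in the same view.
  | timeout (s) (h1 : s.view ∉ s.nullified) (h2 : TimeoutReady s)
      (h3 : s.view ∈ s.voted1 ∨ ¬ ∃ b c path, P.Votable p s.S s.view b c path)
      (h4 : ¬ ∃ b, P.InBlocksStar s.S b ∧ b.view = s.view)
      (h5 : ¬ ∃ b, P.InBlocks s.S b ∧ b.view = s.view) :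
      Act p s (State.disseminate p
        {m | ∃ v, s.view ≤ v ∧ P.superview v = P.superview s.view ∧ m = .nullify v p}
        { s with nullified :=
          s.nullified ∪ {v | s.view ≤ v ∧ P.superview v = P.superview s.view} })
  | null (s) (h : P.HasN s.S s.view) : Act p s s.nextView

/-- Sequences of atomic actions. -/
abbrev Acts (p : P.Proc) : P.State → P.State → Prop := Relation.ReflTransGen (Act p)

theorem CertStep.acts {p : P.Proc} {s s' : P.State} (h : CertStep p s s') : Acts p s s' := by
  rw [h]
  exact .single (.cert s)

theorem ProposeStep.acts {p : P.Proc} {s s' : P.State} (h : ProposeStep p s s') :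
    Acts p s s' := by
  rcases h with ⟨h1, h2, h3⟩ | ⟨h1, -, y, h3, h4, -, h5, h6⟩ | ⟨-, rfl⟩
  · exact .single (.proposeInitial s s' h1 h2 h3)
  · exact .single (.proposeNext s s' y h1 h3 h4 h5 h6)
  · exact .refl

theorem Vote1Step.acts {p : P.Proc} {s s' : P.State} (h : Vote1Step p s s') : Acts p s s' := by
  rcases h with ⟨h1, b, c, path, h2, rfl⟩ | ⟨-, rfl⟩
  · exact .single (.vote1 s b c path h1 h2)
  · exact .refl

theorem CastVote2.acts {p : P.Proc} {b : Block D} {s s' : P.State} (h : CastVote2 p b s s')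
    (hb : P.InBlocksStar s.S b ∨ P.InBlocks s.S b) (hv : b.view = s.view) : Acts p s s' := by
  rcases h with ⟨h1, h2, rfl⟩ | ⟨-, rfl⟩
  · exact .single (.vote2 s b hb hv h1 h2)
  · exact .refl

theorem CastVote2.spec {p : P.Proc} {b : Block D} {s s' : P.State} (h : CastVote2 p b s s') :
    s.S ⊆ s'.S ∧ s'.view = s.view ∧ s'.nullified = s.nullified ∧
      (s'.view ∈ s'.voted2 ∨ s'.view ∈ s'.nullified) := by
  rcases h with ⟨h1, h2, rfl⟩ | ⟨h, rfl⟩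
  · exact ⟨Set.subset_union_left, rfl, rfl, .inl (Set.mem_insert _ _)⟩
  · exact ⟨subset_rfl, rfl, rfl, by tauto⟩

theorem Vote2Step.acts {p : P.Proc} {s s' : P.State} (h : Vote2Step p s s') : Acts p s s' := by
  rcases h with ⟨b, h1, h2, h3⟩ | ⟨-, rfl⟩
  · exact h3.acts (.inl h1) h2
  · exact .refl

theorem BlockStep.acts {p : P.Proc} {s s' : P.State} (h : BlockStep p s s') : Acts p s s' := by
  rcases h with ⟨b, s₁, h1, h2, h3, rfl⟩ | ⟨-, rfl⟩
  · obtain ⟨h4, h5, -, h6⟩ := h3.spec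
    exact (h3.acts (.inr h1) h2).tail (.block s₁ b (h1.mono h4) (h2.trans h5.symm) h6)
  · exact .refl

theorem NullStep.acts {p : P.Proc} {s s' : P.State} (h : NullStep s s') : Acts p s s' := by
  rcases h with ⟨h, rfl⟩ | ⟨-, rfl⟩
  · exact .single (.null s h)
  · exact .refl

theorem TimeoutReady.not_voted2 {s : P.State} (h : TimeoutReady s) : s.view ∉ s.voted2 := by
  rcases h with h | h | h | h
  exacts [h.2.2.2, h.2.2, h.2.2.2, h.2.2]

theorem TimeoutReady.timer_pos {s : P.State} (hΔ : 1 ≤ P.Δ) (h : TimeoutReady s) :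
    0 < s.timer := by
  rcases h with h | h | h | h <;> have := h.2.1 <;> omega

/-- The only step that does not decompose at once is the time-out: its extra premises in `Act` have
to be extracted from the outcome of the preceding steps of the pass. -/
theorem Pass.exists_acts {p : P.Proc} {s s₇ : P.State} (hΔ : 1 ≤ P.Δ) (h : Pass p s s₇) :
    ∃ s₁ s₂ s₃ s₄ s₅ s₆, (CertStep p s s₁ ∧ ProposeStep p s₁ s₂ ∧ Vote1Step p s₂ s₃ ∧
      Vote2Step p s₃ s₄ ∧ BlockStep p s₄ s₅ ∧ TimeoutStep p s₅ s₆ ∧ NullStep s₆ s₇) ∧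
      Acts p s s₁ ∧ Acts p s₁ s₂ ∧ Acts p s₂ s₃ ∧ Acts p s₃ s₄ ∧ Acts p s₄ s₅ ∧ Acts p s₅ s₆ ∧
      Acts p s₆ s₇ := by
  obtain ⟨s₁, s₂, s₃, s₄, s₅, s₆, h1, h2, h3, h4, h5, h6, h7⟩ := h
  refine ⟨s₁, s₂, s₃, s₄, s₅, s₆, ⟨h1, h2, h3, h4, h5, h6, h7⟩, h1.acts, h2.acts, h3.acts,
    h4.acts, h5.acts, ?_, h7.acts⟩
  rcases h6 with ⟨hn, ht, rfl⟩ | ⟨-, rfl⟩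
  swap
  · exact .refl
  have hpos := ht.timer_pos hΔ
  have hv2 := ht.not_voted2
  -- Had a block led to a new view, the timer would now be 0, whereas a time-out needs it positive.
  rcases h5 with ⟨b, s', -, -, -, rfl⟩ | ⟨hb, rfl⟩
  · exact absurd hpos (lt_irrefl 0)
  -- A view-`s₃.view` block in blocks* would have left this view voted or nullified, against the
  -- guard of the time-out.
  have h4' : ¬ ∃ b, P.InBlocksStar s₃.S b ∧ b.view = s₃.view := by
    rcases h4 with ⟨b, hb1, hb2, hc⟩ | ⟨h, -⟩
    · rcases hc.spec.2.2.2 with h | h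
      · exact absurd h hv2
      · exact absurd h hn
    · exact h
  have h34 : s₅ = s₃ := by
    rcases h4 with ⟨b, hb1, hb2, -⟩ | ⟨-, h⟩
    · exact absurd ⟨b, hb1, hb2⟩ h4'
    · exact h
  subst h34
  refine .single (.timeout s₅ hn ht ?_ h4' hb)
  rcases h3 with ⟨h1, b, c, path, h2, rfl⟩ | ⟨h, rfl⟩
  · exact .inl (Set.mem_insert _ _)
  · by_cases hv : s₅.view ∈ s₅.voted1
    · exact .inl hv
    · exact .inr fun hh => h ⟨hv, hh⟩

theorem Pass.acts {p : P.Proc} {s s' : P.State} (hΔ : 1 ≤ P.Δ) (h : Pass p s s') :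
    Acts p s s' := by
  obtain ⟨s₁, s₂, s₃, s₄, s₅, s₆, -, h1, h2, h3, h4, h5, h6, h7⟩ := h.exists_acts hΔ
  exact h1.trans (h2.trans (h3.trans (h4.trans (h5.trans (h6.trans h7)))))

theorem Slot.acts {p : P.Proc} {s s' : P.State} (hΔ : 1 ≤ P.Δ) (h : Slot p s s') :
    Acts p s s' := by
  obtain ⟨h, -⟩ := h
  induction h with
  | refl => exact .refl
  | tail _ h ih => exact ih.trans (h.acts hΔ)

/-! Progress of local states within a timeslot -/

/-- What never decreases while a processor acts. -/
structure State.Le (s s' : P.State) : Prop where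
  S : s.S ⊆ s'.S
  out : s.out ⊆ s'.out
  oldCerts : s'.oldCerts = s.oldCerts
  view : s.view ≤ s'.view
  voted1 : s.voted1 ⊆ s'.voted1
  voted2 : s.voted2 ⊆ s'.voted2
  nullified : s.nullified ⊆ s'.nullified
  proposed : s.proposed ⊆ s'.proposed
  tip : s'.view = s.view → s'.tip = s.tip
  timer : s'.view = s.view → s'.timer = s.timer
  timer_zero : s.view < s'.view → s'.timer = 0

theorem State.Le.refl (s : P.State) : s.Le s :=
  ⟨subset_rfl, subset_rfl, rfl, le_rfl, subset_rfl, subset_rfl, subset_rfl, subset_rfl,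
    fun _ => rfl, fun _ => rfl, fun h => absurd h (lt_irrefl _)⟩

theorem State.Le.trans {s s' s'' : P.State} (h : s.Le s') (h' : s'.Le s'') : s.Le s'' where
  S := h.S.trans h'.S
  out := h.out.trans h'.out
  oldCerts := h'.oldCerts.trans h.oldCerts
  view := h.view.trans h'.view
  voted1 := h.voted1.trans h'.voted1
  voted2 := h.voted2.trans h'.voted2
  nullified := h.nullified.trans h'.nullified
  proposed := h.proposed.trans h'.proposed
  tip e := by
    have h1 := h.view
    have h2 := h'.view
    rw [h'.tip (by omega), h.tip (by omega)]
  timer e := by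
    have h1 := h.view
    have h2 := h'.view
    rw [h'.timer (by omega), h.timer (by omega)]
  timer_zero e := by
    have h1 := h.view
    rcases h'.view.eq_or_lt with h2 | h2
    · rw [h'.timer h2.symm, h.timer_zero (by omega)]
    · exact h'.timer_zero h2

/-- This makes fixed points rigid: a pass that returns to its initial state has not changed anything
on the way. -/
theorem State.Le.antisymm {s s' : P.State} (h : s.Le s') (h' : s'.Le s) : s' = s := by
  have hv : s'.view = s.view := le_antisymm h'.view h.view
  have h1 := h'.S.antisymm h.S
  have h2 := h'.out.antisymm h.out
  have h3 := h.oldCerts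
  have h4 := h'.voted1.antisymm h.voted1
  have h5 := h'.voted2.antisymm h.voted2
  have h6 := h'.nullified.antisymm h.nullified
  have h7 := h'.proposed.antisymm h.proposed
  have h8 := h.tip hv
  have h9 := h.timer hv
  cases s
  cases s'
  simp only at *
  subst_vars
  rfl

theorem Propose.le {p : P.Proc} {v : ℕ} {bp : Block D} {s s' : P.State}
    (h : Propose p v bp s s') : s.Le s' := by
  obtain ⟨l, -, -, C, k, b, -, -, -, rfl⟩ := h
  exact ⟨Set.subset_union_left, Set.subset_union_left, rfl, le_rfl, subset_rfl, subset_rfl,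
    subset_rfl, Set.subset_insert _ _, fun _ => rfl, fun _ => rfl, fun h => absurd h (lt_irrefl _)⟩

theorem Act.le {p : P.Proc} {s s' : P.State} (h : Act p s s') : s.Le s' := by
  cases h with
  | cert =>
    exact ⟨Set.subset_union_left, Set.subset_union_left, rfl, le_rfl, subset_rfl, subset_rfl,
      subset_rfl, subset_rfl, fun _ => rfl, fun _ => rfl, fun h => absurd h (lt_irrefl _)⟩
  | proposeInitial _ hp hf h => exact h.le
  | proposeNext _ y hp hy h1 h2 h => exact h.le
  | vote1 =>
    exact ⟨Set.subset_union_left, Set.subset_union_left, rfl, le_rfl, Set.subset_insert _ _,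
      subset_rfl, subset_rfl, subset_rfl, fun _ => rfl, fun _ => rfl,
      fun h => absurd h (lt_irrefl _)⟩
  | vote2 =>
    exact ⟨Set.subset_union_left, Set.subset_union_left, rfl, le_rfl, subset_rfl,
      Set.subset_insert _ _, subset_rfl, subset_rfl, fun _ => rfl, fun _ => rfl,
      fun h => absurd h (lt_irrefl _)⟩
  | timeout =>
    exact ⟨Set.subset_union_left, Set.subset_union_left, rfl, le_rfl, subset_rfl,
      subset_rfl, Set.subset_union_left, subset_rfl, fun _ => rfl, fun _ => rfl,
      fun h => absurd h (lt_irrefl _)⟩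
  | block =>
    exact ⟨subset_rfl, subset_rfl, rfl, Nat.le_succ _, subset_rfl, subset_rfl, subset_rfl,
      subset_rfl, fun h => absurd h (Nat.succ_ne_self _), fun h => absurd h (Nat.succ_ne_self _),
      fun _ => rfl⟩
  | null =>
    exact ⟨subset_rfl, subset_rfl, rfl, Nat.le_succ _, subset_rfl, subset_rfl, subset_rfl,
      subset_rfl, fun h => absurd h (Nat.succ_ne_self _), fun h => absurd h (Nat.succ_ne_self _),
      fun _ => rfl⟩

theorem Acts.le {p : P.Proc} {s s' : P.State} (h : Acts p s s') : s.Le s' := by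
  induction h with
  | refl => exact .refl _
  | tail _ h ih => exact ih.trans h.le

theorem Act.mem_S {p : P.Proc} {s s' : P.State} (h : Act p s s') {y : Rcvd P.n D Tx}
    (hy : y ∈ s'.S) : y ∈ s.S ∨ ∃ m, y = (some p, m) ∧ (p, m) ∈ s'.out := by
  have key : ∀ (A : Set (P.Proc × Msg P.n D Tx)) (s₁ : P.State), s' = s₁.send p A →
      s₁.S = s.S → y ∈ s.S ∨ ∃ m, y = (some p, m) ∧ (p, m) ∈ s'.out := by
    rintro A s₁ rfl hs
    rcases hy with hy | ⟨m, hm, hA⟩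
    · exact .inl (hs ▸ hy)
    · exact .inr ⟨m, hm, .inr hA⟩
  have keyp : ∀ v bp, Propose p v bp s s' →
      y ∈ s.S ∨ ∃ m, y = (some p, m) ∧ (p, m) ∈ s'.out := by
    rintro v bp ⟨l, -, -, C, k, b, -, -, -, h⟩
    exact key _ _ h rfl
  cases h with
  | cert => exact key _ _ rfl rfl
  | proposeInitial _ hp hf h => exact keyp _ _ h
  | proposeNext _ y hp hy h1 h2 h => exact keyp _ _ h
  | vote1 => exact key _ _ rfl rfl
  | vote2 => exact key _ _ rfl rfl
  | timeout => exact key _ _ rfl rfl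
  | block => exact .inl hy
  | null => exact .inl hy

/-! Consequences of having nothing left to do -/

/-- What holds at the end of each timeslot. -/
structure Quiet (p : P.Proc) (s : P.State) : Prop where
  cert : ∀ m ∈ P.certificates s.S \ s.oldCerts, ∀ q, (q, m) ∈ s.out
  propose : p = P.lead s.view → ¬ FreshInitial s
  vote1 : (∃ b c path, P.Votable p s.S s.view b c path) → s.view ∈ s.voted1
  vote2 : (∃ b, P.InBlocksStar s.S b ∧ b.view = s.view) →
    s.view ∈ s.nullified ∨ s.view ∈ s.voted2
  block : ¬ ∃ b, P.InBlocks s.S b ∧ b.view = s.view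
  timeout : TimeoutReady s → s.view ∈ s.nullified
  null : ¬ P.HasN s.S s.view

theorem Slot.quiet {p : P.Proc} {s₀ s : P.State} (hΔ : 1 ≤ P.Δ) (h : Slot p s₀ s) :
    Quiet p s := by
  obtain ⟨s₁, s₂, s₃, s₄, s₅, s₆, ⟨h1, h2, h3, h4, h5, h6, h7⟩, a1, a2, a3, a4, a5, a6, a7⟩ :=
    h.2.exists_acts hΔ
  have l1 := a1.le
  have l2 := l1.trans a2.le
  have l3 := l2.trans a3.le
  have l4 := l3.trans a4.le
  have l5 := l4.trans a5.le
  have l6 := l5.trans a6.le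
  -- The seven states of the final pass increase from `s` back to `s`, so they are all equal, and
  -- each instruction was carried out in `s` without effect.
  obtain rfl : s₆ = s := l6.antisymm a7.le
  obtain rfl : s₅ = s₆ := l5.antisymm a6.le
  obtain rfl : s₄ = s₅ := l4.antisymm (Acts.le (a5.trans a6))
  obtain rfl : s₃ = s₄ := l3.antisymm (Acts.le (a4.trans (a5.trans a6)))
  obtain rfl : s₂ = s₃ := l2.antisymm (Acts.le (a3.trans (a4.trans (a5.trans a6))))
  obtain rfl : s₁ = s₂ := l1.antisymm (Acts.le (a2.trans (a3.trans (a4.trans (a5.trans a6)))))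
  clear l1 l2 l3 l4 l5 l6 a1 a2 a3 a4 a5 a6 a7
  constructor
  · intro m hm q
    rw [h1]
    exact .inr hm
  · intro hp hf
    rcases h2 with ⟨-, -, l, -, -, C, k, b, -, -, rfl, h⟩ | ⟨-, h, -⟩ | ⟨h, -⟩
    · refine hf.2 (⟨s₁.view, P.tau C k, some (P.H (.block s₁.tip))⟩, C) ?_ rfl
      rw [congrArg State.proposed h]
      exact Set.mem_insert _ _
    · exact h hf
    · exact h ⟨hp, hf⟩
  · intro hb
    rcases h3 with ⟨-, b, c, path, -, h⟩ | ⟨h, -⟩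
    · rw [congrArg State.voted1 h]
      exact Set.mem_insert _ _
    · by_contra hv
      exact h ⟨hv, hb⟩
  · intro hb
    rcases h4 with ⟨b, -, -, h⟩ | ⟨h, -⟩
    · exact h.spec.2.2.2.symm
    · exact absurd hb h
  · rcases h5 with ⟨b, s', -, -, h, h'⟩ | ⟨h, -⟩
    · have h1 := h.spec.2.1
      have h2 := congrArg State.view h'
      simp only [State.nextView] at h2
      omega
    · exact h
  · intro ht
    by_contra hn
    rcases h6 with ⟨-, -, h⟩ | ⟨h, -⟩
    · refine hn ?_
      rw [congrArg State.nullified h]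
      exact .inr ⟨le_rfl, rfl⟩
    · exact h ⟨hn, ht⟩
  · rcases h7 with ⟨-, h⟩ | ⟨h, -⟩
    · have h2 := congrArg State.view h
      simp only [State.nextView] at h2
      omega
    · exact h

end Setting

namespace Run

variable {D : Type u} {Tx : Type w} {P : Setting D Tx} {E : Run P}

open Setting

/-! States within timeslots -/

variable (E) in
/-- The state in which `p` begins the timeslot `t`. -/
def slotInit (p : P.Proc) (t : ℕ) : P.State :=
  if t ≤ E.start p then P.init.receive (E.recv p t) else (E.state p (t - 1)).next (E.recv p t)

variable (E) in
/-- `p` passes through the state `s` in the timeslot `t`. -/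
structure Mid (p : P.Proc) (t : ℕ) (s : P.State) : Prop where
  start_le : E.start p ≤ t
  before : Acts p (E.slotInit p t) s
  after : Acts p s (E.state p t)

theorem slotInit_start (p : P.Proc) :
    E.slotInit p (E.start p) = P.init.receive (E.recv p (E.start p)) := if_pos le_rfl

theorem slotInit_succ {p : P.Proc} {t : ℕ} (ht : E.start p ≤ t) :
    E.slotInit p (t + 1) = (E.state p t).next (E.recv p (t + 1)) := by
  rw [slotInit, if_neg (by omega)]
  rfl

theorem IsExecution.slot (hE : E.IsExecution) {p : P.Proc} (hp : p ∈ E.correct) {t : ℕ}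
    (ht : E.start p ≤ t) : Slot p (E.slotInit p t) (E.state p t) := by
  obtain rfl | ht := ht.eq_or_lt
  · rw [slotInit_start]
    exact hE.state_start p hp
  · obtain ⟨t, rfl⟩ : ∃ t', t = t' + 1 := ⟨t - 1, by omega⟩
    rw [slotInit_succ (by omega)]
    exact hE.state_succ p hp t (by omega)

theorem IsExecution.quiet (hE : E.IsExecution) (hΔ : 1 ≤ P.Δ) {p : P.Proc}
    (hp : p ∈ E.correct) {t : ℕ} (ht : E.start p ≤ t) : Quiet p (E.state p t) :=
  (hE.slot hp ht).quiet hΔ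

theorem IsExecution.mid_state (hE : E.IsExecution) (hΔ : 1 ≤ P.Δ) {p : P.Proc}
    (hp : p ∈ E.correct) {t : ℕ} (ht : E.start p ≤ t) : E.Mid p t (E.state p t) :=
  ⟨ht, (hE.slot hp ht).acts hΔ, .refl⟩

theorem IsExecution.mid_slotInit (hE : E.IsExecution) (hΔ : 1 ≤ P.Δ) {p : P.Proc}
    (hp : p ∈ E.correct) {t : ℕ} (ht : E.start p ≤ t) : E.Mid p t (E.slotInit p t) :=
  ⟨ht, .refl, (hE.slot hp ht).acts hΔ⟩

/-- Induction within a timeslot. -/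
theorem Mid.slot_induction {p : P.Proc} {t : ℕ} {I : P.State → Prop}
    (h0 : I (E.slotInit p t))
    (hact : ∀ s s', E.Mid p t s → Act p s s' → E.Mid p t s' → I s → I s') {s : P.State}
    (hs : E.Mid p t s) : I s := by
  obtain ⟨h1, h2, h3⟩ := hs
  induction h2 with
  | refl => exact h0
  | tail h h' ih =>
    have h4 := Relation.ReflTransGen.head h' h3
    exact hact _ _ ⟨h1, h, h4⟩ h' ⟨h1, h.tail h', h3⟩ (ih h4)

/-- Induction over all states of a correct processor. -/
theorem IsExecution.mid_induction (hE : E.IsExecution) (hΔ : 1 ≤ P.Δ) {p : P.Proc}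
    (hp : p ∈ E.correct) {I : ℕ → P.State → Prop}
    (h0 : I (E.start p) (P.init.receive (E.recv p (E.start p))))
    (hnext : ∀ t, E.start p ≤ t → I t (E.state p t) →
      I (t + 1) ((E.state p t).next (E.recv p (t + 1))))
    (hact : ∀ t s s', E.Mid p t s → Act p s s' → E.Mid p t s' → I t s → I t s') {t : ℕ}
    {s : P.State} (hs : E.Mid p t s) : I t s := by
  have key : ∀ t, E.start p ≤ t → I t (E.slotInit p t) := by
    intro t ht
    induction t, ht using Nat.le_induction with
    | base =>
      rw [slotInit_start]
      exact h0
    | succ t ht ih =>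
      rw [slotInit_succ ht]
      exact hnext t ht ((hE.mid_state hΔ hp ht).slot_induction ih (hact t))
  exact hs.slot_induction (key t hs.start_le) (hact t)

theorem Mid.le_state {p : P.Proc} {t : ℕ} {s : P.State} (h : E.Mid p t s) :
    s.Le (E.state p t) := Acts.le h.after

theorem Mid.slotInit_le {p : P.Proc} {t : ℕ} {s : P.State} (h : E.Mid p t s) :
    (E.slotInit p t).Le s := Acts.le h.before

theorem Mid.recv_subset {p : P.Proc} {t : ℕ} {s : P.State} (h : E.Mid p t s) :
    E.recv p t ⊆ s.S := by
  refine Set.Subset.trans ?_ h.slotInit_le.S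
  unfold slotInit
  split_ifs
  · exact Set.subset_union_right
  · exact Set.subset_union_right

/-! Monotonicity in time -/

theorem IsExecution.step_mono (hE : E.IsExecution) {p : P.Proc}
    (hp : p ∈ E.correct) (t : ℕ) :
    (E.state p t).S ⊆ (E.slotInit p (t + 1)).S ∧
    (E.state p t).view ≤ (E.slotInit p (t + 1)).view ∧
    (E.state p t).voted1 ⊆ (E.slotInit p (t + 1)).voted1 ∧
    (E.state p t).voted2 ⊆ (E.slotInit p (t + 1)).voted2 ∧
    (E.state p t).nullified ⊆ (E.slotInit p (t + 1)).nullified ∧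
    (E.state p t).proposed ⊆ (E.slotInit p (t + 1)).proposed := by
  by_cases ht : E.start p ≤ t
  · rw [slotInit_succ ht]
    exact ⟨Set.subset_union_left, le_rfl, subset_rfl, subset_rfl, subset_rfl, subset_rfl⟩
  · rw [hE.state_before p hp t (by omega), slotInit, if_pos (by omega)]
    exact ⟨Set.empty_subset _, le_rfl, subset_rfl, subset_rfl, subset_rfl, subset_rfl⟩

/-- The components of the states of a correct processor which never decrease. -/
structure StateMono (s s' : P.State) : Prop where
  S : s.S ⊆ s'.S
  view : s.view ≤ s'.view
  voted1 : s.voted1 ⊆ s'.voted1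
  voted2 : s.voted2 ⊆ s'.voted2
  nullified : s.nullified ⊆ s'.nullified
  proposed : s.proposed ⊆ s'.proposed

theorem StateMono.of_le {s s' : P.State} (h : s.Le s') : StateMono s s' :=
  ⟨h.S, h.view, h.voted1, h.voted2, h.nullified, h.proposed⟩

theorem StateMono.trans {s s' s'' : P.State} (h : StateMono s s') (h' : StateMono s' s'') :
    StateMono s s'' :=
  ⟨h.S.trans h'.S, h.view.trans h'.view, h.voted1.trans h'.voted1, h.voted2.trans h'.voted2,
    h.nullified.trans h'.nullified, h.proposed.trans h'.proposed⟩

theorem IsExecution.mono (hE : E.IsExecution) (hΔ : 1 ≤ P.Δ) {p : P.Proc}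
    (hp : p ∈ E.correct) {t t' : ℕ} (h : t ≤ t') : StateMono (E.state p t) (E.state p t') := by
  induction t', h using Nat.le_induction with
  | base => exact .of_le (.refl _)
  | succ t' _ ih =>
    refine ih.trans ?_
    by_cases ht : E.start p ≤ t' + 1
    · obtain ⟨h1, h2, h3, h4, h5, h6⟩ := hE.step_mono hp t'
      exact StateMono.trans ⟨h1, h2, h3, h4, h5, h6⟩
        (.of_le (hE.mid_slotInit hΔ hp ht).le_state)
    · rw [hE.state_before p hp t' (by omega), hE.state_before p hp (t' + 1) (by omega)]
      exact .of_le (.refl _)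

theorem IsExecution.mono_mid (hE : E.IsExecution) (hΔ : 1 ≤ P.Δ) {p : P.Proc}
    (hp : p ∈ E.correct) {t t' : ℕ} {s : P.State} (hs : E.Mid p t' s) (h : t < t') :
    StateMono (E.state p t) s := by
  obtain ⟨t', rfl⟩ : ∃ t₁, t' = t₁ + 1 := ⟨t' - 1, by omega⟩
  refine (hE.mono hΔ hp (Nat.lt_succ_iff.1 h)).trans ?_
  obtain ⟨h1, h2, h3, h4, h5, h6⟩ := hE.step_mono hp t'
  exact StateMono.trans ⟨h1, h2, h3, h4, h5, h6⟩ (.of_le hs.slotInit_le)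

theorem IsExecution.recv_subset (hE : E.IsExecution) (hΔ : 1 ≤ P.Δ) {p : P.Proc}
    (hp : p ∈ E.correct) {t t' : ℕ} (h : t ≤ t') : E.recv p t ⊆ (E.state p t').S := by
  by_cases ht : E.start p ≤ t
  · exact (hE.mid_state hΔ hp ht).recv_subset.trans (hE.mono hΔ hp h).S
  · rw [hE.recv_start p hp t (by omega)]
    exact Set.empty_subset _

theorem IsExecution.recv_subset_mid (hE : E.IsExecution) (hΔ : 1 ≤ P.Δ) {p : P.Proc}
    (hp : p ∈ E.correct) {t t' : ℕ} {s : P.State} (hs : E.Mid p t' s) (h : t ≤ t') :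
    E.recv p t ⊆ s.S := by
  obtain rfl | h := h.eq_or_lt
  · exact hs.recv_subset
  · exact (hE.recv_subset hΔ hp le_rfl).trans (hE.mono_mid hΔ hp hs h).S

theorem IsExecution.start_le_of_recv (hE : E.IsExecution) {p : P.Proc}
    (hp : p ∈ E.correct) {t : ℕ} {y : Rcvd P.n D Tx} (h : y ∈ E.recv p t) : E.start p ≤ t := by
  by_contra ht
  rw [hE.recv_start p hp t (by omega)] at h
  exact h

theorem IsExecution.start_le_of_out (hE : E.IsExecution) {p : P.Proc}
    (hp : p ∈ E.correct) {t : ℕ} {y} (h : y ∈ (E.state p t).out) : E.start p ≤ t := by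
  by_contra ht
  rw [hE.state_before p hp t (by omega)] at h
  exact h

/-- Induction over the messages which correct processors send and receive. -/
theorem IsExecution.msg_induction (hE : E.IsExecution) (hΔ : 1 ≤ P.Δ)
    {G : ℕ → Msg P.n D Tx → Prop} (mono : ∀ t t' m, t ≤ t' → G t m → G t' m)
    (env : ∀ t tr, G t (.tx tr))
    (corr : ∀ t m, (∀ q ∈ E.correct, ∀ t' < t, ∀ y ∈ (E.state q t').out, G t y.2) →
      E.Producible t m → G t m)
    (send : ∀ p ∈ E.correct, ∀ t s s', E.Mid p t s → Act p s s' → E.Mid p t s' →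
      (∀ m, P.Has s.S m → G t m) → ∀ y ∈ s'.out, y ∈ s.out ∨ G t y.2)
    {p : P.Proc} (hp : p ∈ E.correct) {t : ℕ} {s : P.State} (hs : E.Mid p t s) :
    (∀ m, P.Has s.S m → G t m) ∧ ∀ y ∈ s.out, G t y.2 := by
  -- Messages from others that arrive at `t` depend only on what correct processors sent strictly
  -- before `t`; within the timeslot, induction over the actions suffices.
  induction t using Nat.strong_induction_on generalizing p s with
  | _ t iht =>
  have hout : ∀ q ∈ E.correct, ∀ t' < t, ∀ y ∈ (E.state q t').out, G t y.2 :=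
    fun q hq t' ht' y hy => mono _ _ _ ht'.le
      ((iht t' ht' hq (hE.mid_state hΔ hq (hE.start_le_of_out hq hy))).2 y hy)
  have hrecv : ∀ y ∈ E.recv p t, G t y.2 := by
    rintro ⟨_ | q, m⟩ hy
    · obtain ⟨tr, rfl⟩ := hE.environment p hp t m hy
      exact env _ _
    · by_cases hq : q ∈ E.correct
      · obtain ⟨t₀, h1, h2⟩ := hE.authentic p hp q hq t m hy
        exact hout q hq t₀ h1 _ h2
      · exact corr t m hout (hE.unforgeable p hp q hq t m hy)
  refine hs.slot_induction (I := fun s => (∀ m, P.Has s.S m → G t m) ∧ ∀ y ∈ s.out, G t y.2)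
    ?_ ?_
  · unfold slotInit
    split_ifs with ht
    · constructor
      · rintro m ⟨src, hm | hm⟩
        · cases hm
        · exact hrecv _ hm
      · intro y hy
        cases hy
    · constructor
      · rintro m ⟨src, hm | hm⟩
        · exact mono _ _ _ (Nat.sub_le _ _) ((iht (t - 1) (by omega) hp
            (hE.mid_state hΔ hp (by omega))).1 m ⟨src, hm⟩)
        · exact hrecv _ hm
      · intro y hy
        cases hy
  · rintro s s' hs ha hs' ⟨ih1, ih2⟩
    have h2 : ∀ y ∈ s'.out, G t y.2 := by
      intro y hy
      rcases send p hp t s s' hs ha hs' ih1 y hy with h | h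
      · exact ih2 y h
      · exact h
    refine ⟨?_, h2⟩
    rintro m ⟨src, hm⟩
    rcases ha.mem_S hm with hm | ⟨m', h3, h4⟩
    · exact ih1 m ⟨src, hm⟩
    · cases h3
      exact h2 _ h4

end Run

namespace Setting

variable {D : Type u} {Tx : Type w} {P : Setting D Tx}

/-! What an action changes -/

theorem lead_congr {v v' : ℕ} (h : P.superview v = P.superview v') : P.lead v = P.lead v' := by
  simp only [lead, h]

/-- The messages sent by an action, with their recipients. -/
inductive Emits (p : P.Proc) (s s' : P.State) : P.Proc × Msg P.n D Tx → Prop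
  | cert (q m) (h : m ∈ P.certificates s.S) : Emits p s s' (q, m)
  | propose (q b C c path) (hb : (b, C) ∈ s'.proposed) (hl : P.lead b.view = p) :
      Emits p s s' (q, .frag b q c path)
  -- `hu` says that one action adds votes for a single block only; uniqueness of votes per view
  -- depends on it, here and for `vote2`.
  | vote1 (q b c path) (hv : s.view ∉ s.voted1) (h : P.Votable p s.S s.view b c path)
      (h' : s'.voted1 = insert s.view s.voted1)
      (hu : ∀ q' b', (q', .vote1 b' p) ∈ s'.out → (q', .vote1 b' p) ∈ s.out ∨ b' = b) :
      Emits p s s' (q, .vote1 b p)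
  | frag (q b c path) (h : P.Votable p s.S s.view b c path) : Emits p s s' (q, .frag b p c path)
  | vote2 (q b) (hb : P.InBlocksStar s.S b ∨ P.InBlocks s.S b) (hv : b.view = s.view)
      (h : s.view ∉ s.voted2) (h' : s'.voted2 = insert s.view s.voted2)
      (hu : ∀ q' b', (q', .vote2 b' p) ∈ s'.out → (q', .vote2 b' p) ∈ s.out ∨ b' = b) :
      Emits p s s' (q, .vote2 b p)
  | nullify (q v) (h : v ∈ s'.nullified) : Emits p s s' (q, .nullify v p)

theorem Act.emits {p : P.Proc} {s s' : P.State} (h : Act p s s') :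
    ∀ y ∈ s'.out, y ∈ s.out ∨ Emits p s s' y := by
  have keyp : ∀ v bp, Propose p v bp s s' → P.lead v = p →
      ∀ y ∈ s'.out, y ∈ s.out ∨ Emits p s s' y := by
    rintro v bp ⟨l, -, -, C, k, b, -, -, rfl, rfl⟩ hl ⟨q, m⟩ (hy | hy)
    · exact .inl hy
    · simp only [Set.mem_ofPred_eq] at hy
      subst hy
      exact .inr (.propose q _ C _ _ (Set.mem_insert _ _) hl)
  cases h with
  | cert =>
    rintro ⟨q, m⟩ (hy | hy)
    · exact .inl hy
    · exact .inr (.cert q m hy.1)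
  | proposeInitial _ hp hf h => exact keyp _ _ h hp.symm
  | proposeNext _ y hp hy h1 h2 h => exact keyp _ _ h ((lead_congr h2).trans hp.symm)
  | vote1 b c path hv h =>
    rintro ⟨q, m⟩ (hy | hy)
    · exact .inl hy
    · rcases hy with hy | ⟨-, hy⟩
      · simp only at hy
        subst hy
        refine .inr (.vote1 q b c path hv h rfl ?_)
        rintro q' b' (hy | hy | ⟨-, hy⟩)
        · exact .inl hy
        · cases hy
          exact .inr rfl
        · cases hy
      · simp only at hy
        subst hy
        exact .inr (.frag q b c path h)
  | vote2 b hb hv h1 h2 =>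
    rintro ⟨q, m⟩ (hy | hy)
    · exact .inl hy
    · obtain rfl : m = _ := hy
      refine .inr (.vote2 q b hb hv h2 rfl ?_)
      rintro q' b' (hy | hy)
      · exact .inl hy
      · cases hy
        exact .inr rfl
  | timeout h1 h2 h3 h4 h5 =>
    rintro ⟨q, m⟩ (hy | hy)
    · exact .inl hy
    · obtain ⟨v, h6, h7, rfl⟩ := hy
      exact .inr (.nullify q v (.inr ⟨h6, h7⟩))
  | block => exact fun y hy => .inl hy
  | null => exact fun y hy => .inl hy

theorem Propose.eqs {p : P.Proc} {v : ℕ} {bp : Block D} {s s' : P.State}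
    (h : Propose p v bp s s') :
    s'.voted1 = s.voted1 ∧ s'.voted2 = s.voted2 ∧ s'.nullified = s.nullified ∧
      s'.view = s.view ∧ s'.tip = s.tip := by
  obtain ⟨l, -, -, C, k, b, -, -, -, rfl⟩ := h
  exact ⟨rfl, rfl, rfl, rfl, rfl⟩

theorem Act.voted1_cases {p : P.Proc} {s s' : P.State} (h : Act p s s') {v : ℕ}
    (hv : v ∈ s'.voted1) : v ∈ s.voted1 ∨ (v = s.view ∧ ∃ b c path,
      P.Votable p s.S s.view b c path ∧ (∀ q, (q, .vote1 b p) ∈ s'.out) ∧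
      (p ≠ P.lead s.view → ∀ q, (q, .frag b p c path) ∈ s'.out)) := by
  cases h with
  | proposeInitial _ hp hf h => exact .inl (h.eqs.1 ▸ hv)
  | proposeNext _ y hp hy h1 h2 h => exact .inl (h.eqs.1 ▸ hv)
  | vote1 b c path hv' h =>
    rcases hv with rfl | hv
    · exact .inr ⟨rfl, b, c, path, h, fun q => .inr (.inl rfl), fun hp q => .inr (.inr ⟨hp, rfl⟩)⟩
    · exact .inl hv
  | _ => exact .inl hv

theorem Act.voted2_cases {p : P.Proc} {s s' : P.State} (h : Act p s s') {v : ℕ}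
    (hv : v ∈ s'.voted2) : v ∈ s.voted2 ∨ (v = s.view ∧ s.view ∉ s.nullified ∧
      s'.nullified = s.nullified ∧ ∃ b, (P.InBlocksStar s.S b ∨ P.InBlocks s.S b) ∧
      b.view = s.view ∧ ∀ q, (q, .vote2 b p) ∈ s'.out) := by
  cases h with
  | proposeInitial _ hp hf h => exact .inl (h.eqs.2.1 ▸ hv)
  | proposeNext _ y hp hy h1 h2 h => exact .inl (h.eqs.2.1 ▸ hv)
  | vote2 b hb hv' h1 h2 =>
    rcases hv with rfl | hv
    · exact .inr ⟨rfl, h1, rfl, b, hb, hv', fun q => .inr rfl⟩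
    · exact .inl hv
  | _ => exact .inl hv

/-- The circumstances in which a processor times out. -/
structure TimesOut (p : P.Proc) (s : P.State) : Prop where
  ready : TimeoutReady s
  not_votable : s.view ∈ s.voted1 ∨ ¬ ∃ b c path, P.Votable p s.S s.view b c path
  not_star : ¬ ∃ b, P.InBlocksStar s.S b ∧ b.view = s.view
  not_blocks : ¬ ∃ b, P.InBlocks s.S b ∧ b.view = s.view

theorem Act.nullified_cases {p : P.Proc} {s s' : P.State} (h : Act p s s') {v : ℕ}
    (hv : v ∈ s'.nullified) : v ∈ s.nullified ∨ (s.view ≤ v ∧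
      P.superview v = P.superview s.view ∧ TimesOut p s ∧ s'.voted2 = s.voted2 ∧
      ∀ q, (q, .nullify v p) ∈ s'.out) := by
  cases h with
  | proposeInitial _ hp hf h => exact .inl (h.eqs.2.2.1 ▸ hv)
  | proposeNext _ y hp hy h1 h2 h => exact .inl (h.eqs.2.2.1 ▸ hv)
  | timeout h1 h2 h3 h4 h5 =>
    rcases hv with hv | hv
    · exact .inl hv
    · exact .inr ⟨hv.1, hv.2, ⟨h2, h3, h4, h5⟩, rfl,
        fun q => .inr ⟨v, hv.1, hv.2, rfl⟩⟩
  | _ => exact .inl hv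

theorem Act.view_cases {p : P.Proc} {s s' : P.State} (h : Act p s s') :
    (s'.view = s.view ∧ s'.tip = s.tip) ∨ (s'.view = s.view + 1 ∧
      ((P.InBlocks s.S s'.tip ∧ s'.tip.view = s.view ∧
        (s.view ∈ s.voted2 ∨ s.view ∈ s.nullified)) ∨
      (P.HasN s.S s.view ∧ s'.tip = s.tip))) := by
  cases h with
  | proposeInitial _ hp hf h => exact .inl h.eqs.2.2.2
  | proposeNext _ y hp hy h1 h2 h => exact .inl h.eqs.2.2.2
  | block b hb hv h => exact .inr ⟨rfl, .inl ⟨hb, hv, h⟩⟩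
  | null h => exact .inr ⟨rfl, .inr ⟨h, rfl⟩⟩
  | _ => exact .inl ⟨rfl, rfl⟩

/-- The circumstances in which the leader `p` of the present view proposes the block `y.1`, with
payload `y.2` and parent `bp`. -/
structure Proposes (p : P.Proc) (s s' : P.State) (bp : Block D) (y : Block D × List Bool) :
    Prop where
  lead : p = P.lead s.view
  kind : (FreshInitial s ∧ y.1.view = s.view ∧ bp = s.tip) ∨
    ∃ z ∈ s.proposed, P.superview z.1.view = P.superview s.view ∧
      P.superview (z.1.view + 1) = P.superview s.view ∧ y.1.view = z.1.view + 1 ∧ bp = z.1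
  block : y.1 = ⟨y.1.view, P.tau y.2 (P.g s.S y.1.view), some (P.H (.block bp))⟩
  payload : ∃ l, y.2 = P.ser l ∧ ∀ tr, P.Has s.S (.tx tr) → ¬ Known s bp tr → tr ∈ l
  proposed : s'.proposed = insert y s.proposed
  sends : ∀ q, (q, .frag y.1 q (P.fragment y.2 (P.g s.S y.1.view) q).1
    (P.fragment y.2 (P.g s.S y.1.view) q).2) ∈ s'.out

theorem Act.proposed_cases {p : P.Proc} {s s' : P.State} (h : Act p s s') :
    s'.proposed = s.proposed ∨ ∃ bp y, Proposes p s s' bp y := by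
  cases h with
  | proposeInitial _ hp hf h =>
    obtain ⟨l, h1, -, C, k, b, rfl, rfl, rfl, rfl⟩ := h
    exact .inr ⟨s.tip, (_, P.ser l), hp, .inl ⟨hf, rfl, rfl⟩, rfl, ⟨l, rfl, h1⟩, rfl,
      fun q => .inr rfl⟩
  | proposeNext _ y hp hy h2 h3 h =>
    obtain ⟨l, h1, -, C, k, b, rfl, rfl, rfl, rfl⟩ := h
    exact .inr ⟨y.1, (_, P.ser l), hp, .inr ⟨y, hy, h2, h3, rfl, rfl⟩, rfl, ⟨l, rfl, h1⟩,
      rfl, fun q => .inr rfl⟩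
  | _ => exact .inl rfl

end Setting

namespace Run

variable {D : Type u} {Tx : Type w} {P : Setting D Tx} {E : Run P}

open Setting

/-! Messages are producible -/

theorem SentBefore.mono {p : P.Proc} {m : Msg P.n D Tx} {t t' : ℕ} (h : E.SentBefore p m t)
    (ht : t ≤ t') : E.SentBefore p m t' := by
  obtain ⟨t₀, h1, h2⟩ := h
  exact ⟨t₀, by omega, h2⟩

theorem BlockSigned.mono {b : Block D} {t t' : ℕ} (h : E.BlockSigned b t) (ht : t ≤ t') :
    E.BlockSigned b t' := by
  intro h1 h2
  obtain ⟨t₀, h3, h4⟩ := h h1 h2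
  exact ⟨t₀, by omega, h4⟩

theorem Available.mono {i : P.Proc} {m : Msg P.n D Tx} {t t' : ℕ} (h : E.Available i m t)
    (ht : t ≤ t') : E.Available i m t' := fun hi => (h hi).mono ht

theorem ncard_available_mono (φ : P.Proc → Msg P.n D Tx) {t t' : ℕ} (ht : t ≤ t') :
    {i | E.Available i (φ i) t}.ncard ≤ {i | E.Available i (φ i) t'}.ncard :=
  Set.ncard_le_ncard (fun _ hi => Available.mono hi ht) (Set.toFinite _)

theorem Producible.mono {t t' : ℕ} (ht : t ≤ t') {m : Msg P.n D Tx} (h : E.Producible t m) :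
    E.Producible t' m := by
  cases m with
  | tx => trivial
  | frag b => exact BlockSigned.mono h ht
  | vote1 b i => exact ⟨h.1.mono ht, h.2.mono ht⟩
  | vote2 b i => exact ⟨h.1.mono ht, h.2.mono ht⟩
  | mcert b => exact ⟨h.1.mono ht, h.2.trans (ncard_available_mono _ ht)⟩
  | cert b => exact ⟨h.1.mono ht, h.2.trans (ncard_available_mono _ ht)⟩
  | nullify v i => exact Available.mono h ht
  | ncert v => exact le_trans h (ncard_available_mono (fun i => .nullify v i) ht)

theorem exists_of_lt_ncard {A : Set P.Proc} {k : ℕ} (h : k < A.ncard) : ∃ i, i ∈ A :=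
  (Set.ncard_pos (Set.toFinite _)).1 (by omega)

/-- Forwarding and forming certificates gives nothing that the adversary could not produce: the
limits set by unforgeability hold for all received messages. The bound is `t + 1` since `SentBefore`
is strict and messages to oneself arrive in the timeslot of sending. -/
theorem IsExecution.producible (hE : E.IsExecution) (hΔ : 1 ≤ P.Δ) (hnf : 4 * P.f + 1 ≤ P.n)
    {p : P.Proc} (hp : p ∈ E.correct) {t : ℕ} {s : P.State} (hs : E.Mid p t s)
    {m : Msg P.n D Tx} (hm : P.Has s.S m) : E.Producible (t + 1) m := by
  refine (hE.msg_induction hΔ (G := fun t m => E.Producible (t + 1) m)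
    (fun t t' m ht h => h.mono (by omega)) (fun _ _ => trivial)
    (fun t m _ h => h.mono (by omega)) ?_ hp hs).1 m hm
  clear hs hm hp
  intro p hp t s s' hs ha hs' ih y hy
  have hout : E.SentBefore p y.2 (t + 1) := ⟨t, by omega, y.1, hs'.le_state.out hy⟩
  have hM : ∀ b, P.HasM s.S b → E.Producible (t + 1) (.mcert b) := by
    rintro b (h | h)
    · exact ih _ h
    · obtain ⟨i, hi⟩ := exists_of_lt_ncard h
      exact ⟨(ih _ hi).1, h.trans (Set.ncard_le_ncard (fun i hi => (ih _ hi).2) (Set.toFinite _))⟩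
  rcases ha.emits y hy with h | h
  · exact .inl h
  refine .inr ?_
  cases h with
  | cert q m h =>
    rcases h with ⟨b, rfl, h⟩ | ⟨b, rfl, h⟩ | ⟨v, rfl, h⟩
    · exact hM b h
    · rcases h with h | h
      · exact ih _ h
      · obtain ⟨i, hi⟩ := exists_of_lt_ncard (k := 0) (lt_of_lt_of_le (by omega) h)
        exact ⟨(ih _ hi).1,
          h.trans (Set.ncard_le_ncard (fun i hi => (ih _ hi).2) (Set.toFinite _))⟩
    · rcases h with h | h
      · exact ih _ h
      · exact le_trans h (Set.ncard_le_ncard (fun i hi => ih _ hi) (Set.toFinite _))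
  | propose q b C c path hb hl =>
    intro _ _
    rw [hl]
    exact ⟨t, by omega, C, hs'.le_state.proposed hb⟩
  | vote1 q b c path hv h => exact ⟨ih _ h.1, fun _ => hout⟩
  | frag q b c path h => exact ih _ h.1
  | vote2 q b hb hv h =>
    refine ⟨?_, fun _ => hout⟩
    intro h1
    rcases hb with hb | hb
    · have := (hb.cases_of_view h1).2.1
      unfold Notarised at this
      obtain ⟨i, hi⟩ := exists_of_lt_ncard (A := {i | P.Has s.S (.vote1 b i)}) (k := 0) (by omega)
      exact (ih _ hi).1 h1
    · exact (hM b (hb.cases_of_view h1).2.1).1 h1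
  | nullify q v h => exact fun _ => hout

theorem IsExecution.exists_correct (hE : E.IsExecution) {A : Set P.Proc} (h : P.f < A.ncard) :
    ∃ i ∈ A, i ∈ E.correct := by
  by_contra! hA
  have : A.ncard ≤ (E.correctᶜ).card := by
    rw [← Set.ncard_coe_finset]
    exact Set.ncard_le_ncard (fun i hi => by simpa using hA i hi) (Set.toFinite _)
  have := hE.corrupted
  omega

theorem IsExecution.one_le_view (hE : E.IsExecution) (hΔ : 1 ≤ P.Δ) {p : P.Proc}
    (hp : p ∈ E.correct) {t : ℕ} {s : P.State} (hs : E.Mid p t s) : 1 ≤ s.view :=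
  hE.mid_induction hΔ hp (I := fun _ s => 1 ≤ s.view) le_rfl (fun _ _ h => h)
    (fun _ _ _ _ ha _ h => h.trans ha.le.view) hs

/-! ### Endorsed blocks: the origin of stage-2 votes and certificates -/

variable (E) in
/-- Some correct processor has put `b` into `blocks*` by `t`. -/
def Endorsed (t : ℕ) (b : Block D) : Prop :=
  1 ≤ b.view ∧ ∃ q ∈ E.correct, P.InBlocksStar (E.state q t).S b

theorem Endorsed.mono (hE : E.IsExecution) (hΔ : 1 ≤ P.Δ) {t t' : ℕ} {b : Block D}
    (h : E.Endorsed t b) (ht : t ≤ t') : E.Endorsed t' b := by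
  obtain ⟨h1, q, hq, h2⟩ := h
  exact ⟨h1, q, hq, h2.mono (hE.mono hΔ hq ht).S⟩

variable (E) in
/-- The block in a stage-2 vote of a correct processor or in a certificate formed from stage-2 votes
is endorsed. -/
def EndorsedMsg (t : ℕ) : Msg P.n D Tx → Prop
  | .vote2 b i => i ∈ E.correct → E.Endorsed t b
  | .mcert b => E.Endorsed t b
  | .cert b => E.Endorsed t b
  | _ => True

/-- A correct stage-2 vote is cast because of blocks*, which is endorsement, or because of `blocks`,
which presupposes an M-certificate and hence an earlier correct vote. Tracing back, the first
correct vote for a block is of the former kind. -/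
theorem IsExecution.endorsedMsg (hE : E.IsExecution) (hΔ : 1 ≤ P.Δ) (hnf : 4 * P.f + 1 ≤ P.n)
    {p : P.Proc} (hp : p ∈ E.correct) {t : ℕ} {s : P.State} (hs : E.Mid p t s)
    {m : Msg P.n D Tx} (hm : P.Has s.S m) : E.EndorsedMsg t m := by
  refine (hE.msg_induction hΔ (G := E.EndorsedMsg) ?_ (fun _ _ => trivial) ?_ ?_ hp hs).1 m hm
  · intro t t' m ht h
    cases m with
    | vote2 b i => exact fun hi => (h hi).mono hE hΔ ht
    | mcert b => exact Endorsed.mono hE hΔ h ht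
    | cert b => exact Endorsed.mono hE hΔ h ht
    | _ => trivial
  · intro t m hout h
    have key : ∀ b i, i ∈ E.correct → E.Available i (.vote2 b i) t → E.Endorsed t b := by
      intro b i hi h
      obtain ⟨t', h1, q, h2⟩ := h hi
      exact hout i hi t' h1 _ h2 hi
    cases m with
    | vote2 b i => exact fun hi => key b i hi h.2
    | mcert b =>
      obtain ⟨i, h1, h2⟩ := hE.exists_correct h.2
      exact key b i h2 h1
    | cert b =>
      obtain ⟨i, h1, h2⟩ := hE.exists_correct (lt_of_lt_of_le (by omega) h.2)
      exact key b i h2 h1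
    | _ => trivial
  · intro p hp t s s' hs ha hs' ih y hy
    have hM : ∀ b, P.HasM s.S b → E.Endorsed t b := by
      rintro b (h | h)
      · exact ih _ h
      · obtain ⟨i, hi, hi'⟩ := hE.exists_correct h
        exact ih _ hi hi'
    rcases ha.emits y hy with h | h
    · exact .inl h
    refine .inr ?_
    cases h with
    | cert q m h =>
      rcases h with ⟨b, rfl, h⟩ | ⟨b, rfl, h⟩ | ⟨v, rfl, h⟩
      · exact hM b h
      · rcases h with h | h
        · exact ih _ h
        · obtain ⟨i, hi, hi'⟩ := hE.exists_correct (lt_of_lt_of_le (by omega) h)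
          exact ih _ hi hi'
      · trivial
    | vote2 q b hb hv h =>
      intro _
      have hv1 : 1 ≤ b.view := hv ▸ hE.one_le_view hΔ hp hs
      rcases hb with hb | hb
      · exact ⟨hv1, p, hp, hb.mono hs.le_state.S⟩
      · exact hM b (hb.cases_of_view hv1).2.1
    | _ => trivial

theorem IsExecution.endorsed_of_hasM (hE : E.IsExecution) (hΔ : 1 ≤ P.Δ)
    (hnf : 4 * P.f + 1 ≤ P.n) {p : P.Proc} (hp : p ∈ E.correct) {t : ℕ} {s : P.State}
    (hs : E.Mid p t s) {b : Block D} (h : P.HasM s.S b) : E.Endorsed t b := by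
  rcases h with h | h
  · exact hE.endorsedMsg hΔ hnf hp hs h
  · obtain ⟨i, hi, hi'⟩ := hE.exists_correct h
    exact hE.endorsedMsg hΔ hnf hp hs hi hi'

/-! The messages sent by a processor and its local variables -/

variable (E) in
/-- The messages sent by `p` until it is in the state `s` of the timeslot `t`, with their
recipients. -/
def sent (p : P.Proc) (t : ℕ) (s : P.State) : Set (P.Proc × Msg P.n D Tx) :=
  {y | y ∈ s.out ∨ ∃ t' < t, y ∈ (E.state p t').out}

theorem sent_mono {p : P.Proc} {t : ℕ} {s s' : P.State} (h : s.out ⊆ s'.out) :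
    E.sent p t s ⊆ E.sent p t s' := fun _ hy => hy.imp_left fun h1 => h h1

theorem out_subset_sent {p : P.Proc} {t : ℕ} {s : P.State} : s.out ⊆ E.sent p t s :=
  fun _ hy => .inl hy

theorem emits_of_mem_sent {p : P.Proc} {t : ℕ} {s s' : P.State} (ha : Act p s s')
    {y} (hy : y ∈ E.sent p t s') : y ∈ E.sent p t s ∨ Emits p s s' y := by
  rcases hy with hy | hy
  · exact (ha.emits y hy).imp_left fun h => .inl h
  · exact .inl (.inr hy)

/-- Induction over all states of a correct processor, with the messages sent. -/
theorem IsExecution.sent_induction (hE : E.IsExecution) (hΔ : 1 ≤ P.Δ) {p : P.Proc}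
    (hp : p ∈ E.correct) {J : Set (P.Proc × Msg P.n D Tx) → P.State → Prop}
    (h0 : ∀ R, J ∅ (P.init.receive R))
    (hnext : ∀ A s R, J A s → J A (s.next R))
    (hact : ∀ t s s', E.Mid p t s → Act p s s' → E.Mid p t s' → J (E.sent p t s) s →
      J (E.sent p t s') s') {t : ℕ} {s : P.State} (hs : E.Mid p t s) : J (E.sent p t s) s := by
  refine hE.mid_induction hΔ hp (I := fun t s => J (E.sent p t s) s) ?_ ?_ hact hs
  · convert h0 _
    ext y
    simp only [sent, Set.mem_ofPred_eq, Set.mem_empty_iff_false, iff_false, not_or]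
    refine ⟨fun h => h, ?_⟩
    rintro ⟨t', h1, h2⟩
    have := hE.start_le_of_out hp h2
    omega
  · intro t ht h
    convert hnext _ _ (E.recv p (t + 1)) h using 1
    ext y
    simp only [sent, Set.mem_ofPred_eq]
    constructor
    · rintro (h | ⟨t', h1, h2⟩)
      · cases h
      · obtain h1 | rfl := Nat.lt_succ_iff_lt_or_eq.1 h1
        · exact .inr ⟨t', h1, h2⟩
        · exact .inl h2
    · rintro (h | ⟨t', h1, h2⟩)
      · exact .inr ⟨t, by omega, h⟩
      · exact .inr ⟨t', by omega, h2⟩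

theorem mem_sent_state {p : P.Proc} {t : ℕ} {y} :
    y ∈ E.sent p t (E.state p t) ↔ ∃ t' ≤ t, y ∈ (E.state p t').out := by
  constructor
  · rintro (h | ⟨t', h1, h2⟩)
    · exact ⟨t, le_rfl, h⟩
    · exact ⟨t', h1.le, h2⟩
  · rintro ⟨t', h1, h2⟩
    obtain rfl | h1 := h1.eq_or_lt
    · exact .inl h2
    · exact .inr ⟨t', h1, h2⟩

end Run

namespace Setting

variable {D : Type u} {Tx : Type w} {P : Setting D Tx}

/-- The parent of `b` is in `blocks`, its view is less than that of `b`, and there are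
N-certificates for all views strictly between. -/
def ParentOk (S : P.Rcvds) (b : Block D) : Prop :=
  ∃ a, P.InBlocks S a ∧ P.Parent a b ∧ a.view < b.view ∧
    ∀ u, a.view < u → u < b.view → P.HasN S u

theorem ParentOk.mono {S S' : P.Rcvds} (h : S ⊆ S') {b : Block D} (hb : ParentOk S b) :
    ParentOk S' b := by
  obtain ⟨a, h1, h2, h3, h4⟩ := hb
  exact ⟨a, h1.mono h, h2, h3, fun u hu hu' => (h4 u hu hu').mono h⟩

theorem Votable.parentOk {p : P.Proc} {S : P.Rcvds} {v : ℕ} {b : Block D} {c : List Bool}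
    {path : List D} (h : P.Votable p S v b c path) : ParentOk S b := by
  obtain ⟨-, -, rfl, -, h⟩ := h
  exact h

/-- Stage-1 votes: the messages `A` sent so far, and the local state. -/
structure Vote1Inv (p : P.Proc) (A : Set (P.Proc × Msg P.n D Tx)) (s : P.State) : Prop where
  sent : ∀ q b i, (q, .vote1 b i) ∈ A → i = p ∧ b.view ∈ s.voted1 ∧ ParentOk s.S b
  unique : ∀ q q' b b', (q, .vote1 b p) ∈ A → (q', .vote1 b' p) ∈ A → b.view = b'.view → b = b'
  voted : ∀ v ∈ s.voted1, ∃ b c path, b.view = v ∧ P.Certified b.tag p c path ∧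
    (∀ q, (q, .vote1 b p) ∈ A) ∧ (p ≠ P.lead v → ∀ q, (q, .frag b p c path) ∈ A)

/-- Stage-2 votes and nullify messages: the messages `A` sent so far, and the local state. -/
structure Vote2Inv (p : P.Proc) (A : Set (P.Proc × Msg P.n D Tx)) (s : P.State) : Prop where
  sent : ∀ q b i, (q, .vote2 b i) ∈ A → i = p ∧ b.view ∈ s.voted2
  unique : ∀ q q' b b', (q, .vote2 b p) ∈ A → (q', .vote2 b' p) ∈ A → b.view = b'.view → b = b'
  voted : ∀ v ∈ s.voted2, v ≤ s.view ∧ v ∉ s.nullified ∧ ∃ b, b.view = v ∧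
    (P.Proper b ∧ ∃ a, P.InBlocks s.S a ∧ P.Parent a b) ∧ ∀ q, (q, .vote2 b p) ∈ A
  sent_nullify : ∀ q v i, (q, .nullify v i) ∈ A → i = p ∧ v ∈ s.nullified
  nullified : ∀ v ∈ s.nullified, ∀ q, (q, .nullify v p) ∈ A

/-- How the present view has been reached. -/
structure ViewInv (s : P.State) : Prop where
  tip_mem : P.InBlocks s.S s.tip
  tip_view : s.tip.view < s.view
  tip_null : ∀ u, s.tip.view < u → u < s.view → P.HasN s.S u
  passed : ∀ u, 1 ≤ u → u < s.view →
    (∃ b, P.InBlocks s.S b ∧ b.view = u ∧ (u ∈ s.voted2 ∨ u ∈ s.nullified)) ∨ P.HasN s.S u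

/-- Proposals. -/
structure ProposedInv (p : P.Proc) (A : Set (P.Proc × Msg P.n D Tx)) (s : P.State) : Prop where
  block : ∀ b C, (b, C) ∈ s.proposed → p = P.lead b.view ∧
    P.superview b.view ≤ P.superview s.view ∧ P.Proper b ∧ b.tag = P.tau C b.tag.k ∧
    (P.Initial b.view → b.tag.k = P.n - P.f - 1) ∧
    ∀ q, (q, .frag b q (P.fragment C b.tag.k q).1 (P.fragment C b.tag.k q).2) ∈ A
  parent : ∀ b C, (b, C) ∈ s.proposed → P.Initial b.view → ParentOk s.S b
  initial : ∀ y ∈ s.proposed, ∃ z ∈ s.proposed, P.superview z.1.view = P.superview y.1.view ∧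
    P.Initial z.1.view
  unique : ∀ y ∈ s.proposed, ∀ z ∈ s.proposed, P.Initial y.1.view → P.Initial z.1.view →
    P.superview y.1.view = P.superview z.1.view → y = z

/-! ### Arithmetic of superviews -/

theorem superview_mono {v v' : ℕ} (h : v ≤ v') : P.superview v ≤ P.superview v' := by
  unfold superview
  have := Nat.div_le_div_right (c := P.x) (show v - 1 ≤ v' - 1 by omega)
  omega

theorem exists_of_initial (hx : 2 ≤ P.x) {v : ℕ} (hv : 1 ≤ v) (hi : P.Initial v) :
    v = (P.superview v - 1) * P.x + 1 := by
  have h1 : P.x ∣ v - 1 := (Nat.modEq_iff_dvd' hv).1 hi.symm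
  obtain ⟨c, hc⟩ := h1
  unfold superview
  rw [hc, Nat.mul_div_cancel_left _ (by omega)]
  have : c + 1 - 1 = c := rfl
  rw [this, mul_comm c]
  omega

theorem eq_of_initial (hx : 2 ≤ P.x) {v v' : ℕ} (hv : 1 ≤ v) (hv' : 1 ≤ v') (hi : P.Initial v)
    (hi' : P.Initial v') (h : P.superview v = P.superview v') : v = v' := by
  rw [exists_of_initial hx hv hi, exists_of_initial hx hv' hi', h]

theorem le_of_initial (hx : 2 ≤ P.x) {v v' : ℕ} (hv : 1 ≤ v) (hv' : 1 ≤ v') (hi : P.Initial v)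
    (h : P.superview v = P.superview v') : v ≤ v' := by
  rw [exists_of_initial hx hv hi, h]
  unfold superview
  have := Nat.div_mul_le_self (v' - 1) P.x
  simp only [Nat.add_sub_cancel]
  omega

theorem not_initial_succ (hx : 2 ≤ P.x) {v : ℕ} (hv : 1 ≤ v)
    (h : P.superview (v + 1) = P.superview v) : ¬ P.Initial (v + 1) := by
  intro hi
  have := le_of_initial hx (by omega) hv hi h
  omega

end Setting

namespace Run

variable {D : Type u} {Tx : Type w} {P : Setting D Tx} {E : Run P}

open Setting

/-! ### The invariants hold in all states of correct processors -/

theorem IsExecution.vote1Inv (hE : E.IsExecution) (hΔ : 1 ≤ P.Δ) {p : P.Proc}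
    (hp : p ∈ E.correct) {t : ℕ} {s : P.State} (hs : E.Mid p t s) :
    Vote1Inv p (E.sent p t s) s := by
  refine hE.sent_induction hΔ hp (J := Vote1Inv p) ?_ ?_ ?_ hs
  · exact fun R => ⟨fun _ _ _ h => h.elim, fun _ _ _ _ h => h.elim, fun _ h => h.elim⟩
  · exact fun A s R h => ⟨fun q b i hm => ⟨(h.sent q b i hm).1, (h.sent q b i hm).2.1,
      (h.sent q b i hm).2.2.mono Set.subset_union_left⟩, h.unique, h.voted⟩
  · intro t s s' _ ha _ ih
    have hle := ha.le
    have hsub := sent_mono (E := E) (p := p) (t := t) hle.out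
    refine ⟨?_, ?_, ?_⟩
    · intro q b i hm
      rcases emits_of_mem_sent ha hm with hm | hm
      · obtain ⟨h1, h2, h3⟩ := ih.sent q b i hm
        exact ⟨h1, hle.voted1 h2, h3.mono hle.S⟩
      · cases hm with
        | cert _ _ h => rcases h with ⟨_, h, -⟩ | ⟨_, h, -⟩ | ⟨_, h, -⟩ <;> cases h
        | vote1 _ _ c path hv h h' =>
          refine ⟨rfl, ?_, h.parentOk.mono hle.S⟩
          rw [h', h.2.2.1]
          exact Set.mem_insert _ _
    · intro q q' b b' hm hm' hvv
      have key : ∀ q q' b b', Emits p s s' (q, .vote1 b p) →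
          (q', .vote1 b' p) ∈ E.sent p t s' → b.view = b'.view → b = b' := by
        intro q q' b b' h hm' hvv
        cases h with
        | cert _ _ h => rcases h with ⟨_, h, -⟩ | ⟨_, h, -⟩ | ⟨_, h, -⟩ <;> cases h
        | vote1 _ _ c path hv h h' hu =>
          have hn : (q', .vote1 b' p) ∉ E.sent p t s := by
            intro hm'
            have := (ih.sent _ _ _ hm').2.1
            rw [← hvv, h.2.2.1] at this
            exact hv this
          rcases hm' with hm' | hm'
          · exact ((hu q' b' hm').resolve_left fun h => hn (.inl h)).symm
          · exact absurd (.inr hm') hn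
      rcases emits_of_mem_sent ha hm with h1 | h1
      · rcases emits_of_mem_sent ha hm' with h2 | h2
        · exact ih.unique q q' b b' h1 h2 hvv
        · exact (key _ _ _ _ h2 hm hvv.symm).symm
      · exact key _ _ _ _ h1 hm' hvv
    · intro v hv
      rcases ha.voted1_cases hv with hv | ⟨rfl, b, c, path, h1, h2, h3⟩
      · obtain ⟨b, c, path, h1, h2, h3, h4⟩ := ih.voted v hv
        exact ⟨b, c, path, h1, h2, fun q => hsub (h3 q), fun hl q => hsub (h4 hl q)⟩
      · exact ⟨b, c, path, h1.2.2.1, h1.2.2.2.1, fun q => out_subset_sent (h2 q),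
          fun hl q => out_subset_sent (h3 hl q)⟩

theorem IsExecution.vote2Inv (hE : E.IsExecution) (hΔ : 1 ≤ P.Δ) {p : P.Proc}
    (hp : p ∈ E.correct) {t : ℕ} {s : P.State} (hs : E.Mid p t s) :
    Vote2Inv p (E.sent p t s) s := by
  refine hE.sent_induction hΔ hp (J := Vote2Inv p) ?_ ?_ ?_ hs
  · exact fun R => ⟨fun _ _ _ h => h.elim, fun _ _ _ _ h => h.elim, fun _ h => h.elim,
      fun _ _ _ h => h.elim, fun _ h => h.elim⟩
  · refine fun A s R h => ⟨h.sent, h.unique, fun v hv => ?_, h.sent_nullify, h.nullified⟩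
    obtain ⟨h1, h2, b, h3, ⟨h4, a, h5, h6⟩, h7⟩ := h.voted v hv
    exact ⟨h1, h2, b, h3, ⟨h4, a, h5.mono Set.subset_union_left, h6⟩, h7⟩
  · intro t s s' hms ha _ ih
    have hle := ha.le
    have hsub := sent_mono (E := E) (p := p) (t := t) hle.out
    refine ⟨?_, ?_, ?_, ?_, ?_⟩
    · intro q b i hm
      rcases emits_of_mem_sent ha hm with hm | hm
      · obtain ⟨h1, h2⟩ := ih.sent q b i hm
        exact ⟨h1, hle.voted2 h2⟩
      · cases hm with
        | cert _ _ h => rcases h with ⟨_, h, -⟩ | ⟨_, h, -⟩ | ⟨_, h, -⟩ <;> cases h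
        | vote2 _ _ hb hv h h' =>
          refine ⟨rfl, ?_⟩
          rw [h', hv]
          exact Set.mem_insert _ _
    · intro q q' b b' hm hm' hvv
      have key : ∀ q q' b b', Emits p s s' (q, .vote2 b p) →
          (q', .vote2 b' p) ∈ E.sent p t s' → b.view = b'.view → b = b' := by
        intro q q' b b' h hm' hvv
        cases h with
        | cert _ _ h => rcases h with ⟨_, h, -⟩ | ⟨_, h, -⟩ | ⟨_, h, -⟩ <;> cases h
        | vote2 _ _ hb hv h h' hu =>
          have hn : (q', .vote2 b' p) ∉ E.sent p t s := by
            intro hm'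
            have := (ih.sent _ _ _ hm').2
            rw [← hvv, hv] at this
            exact h this
          rcases hm' with hm' | hm'
          · exact ((hu q' b' hm').resolve_left fun h => hn (.inl h)).symm
          · exact absurd (.inr hm') hn
      rcases emits_of_mem_sent ha hm with h1 | h1
      · rcases emits_of_mem_sent ha hm' with h2 | h2
        · exact ih.unique q q' b b' h1 h2 hvv
        · exact (key _ _ _ _ h2 hm hvv.symm).symm
      · exact key _ _ _ _ h1 hm' hvv
    · intro v hv
      rcases ha.voted2_cases hv with hv | ⟨rfl, h1, h2, b, hb, hbv, h4⟩
      · obtain ⟨h1, h2, b, h3, ⟨h4, a, h5, h6⟩, h7⟩ := ih.voted v hv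
        refine ⟨h1.trans hle.view, fun hn => ?_, b, h3, ⟨h4, a, h5.mono hle.S, h6⟩,
          fun q => hsub (h7 q)⟩
        rcases ha.nullified_cases hn with hn | ⟨k1, -, k2, -⟩
        · exact h2 hn
        · obtain rfl : v = s.view := le_antisymm h1 k1
          exact k2.ready.not_voted2 hv
      · refine ⟨hle.view, by rwa [h2], b, hbv, ?_, fun q => out_subset_sent (h4 q)⟩
        have hb1 : 1 ≤ b.view := hbv ▸ hE.one_le_view hΔ hp hms
        rcases hb with hb | hb
        · obtain ⟨k1, -, -, a, k2, k3⟩ := hb.cases_of_view hb1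
          exact ⟨k1, a, k2.mono hle.S, k3⟩
        · obtain ⟨k1, -, a, k2, k3⟩ := hb.cases_of_view hb1
          exact ⟨k1, a, k2.mono hle.S, k3⟩
    · intro q v i hm
      rcases emits_of_mem_sent ha hm with hm | hm
      · obtain ⟨h1, h2⟩ := ih.sent_nullify q v i hm
        exact ⟨h1, hle.nullified h2⟩
      · cases hm with
        | cert _ _ h => rcases h with ⟨_, h, -⟩ | ⟨_, h, -⟩ | ⟨_, h, -⟩ <;> cases h
        | nullify _ _ h => exact ⟨rfl, h⟩
    · intro v hv q
      rcases ha.nullified_cases hv with hv | ⟨-, -, -, -, h⟩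
      · exact hsub (ih.nullified v hv q)
      · exact out_subset_sent (h q)

theorem IsExecution.viewInv (hE : E.IsExecution) (hΔ : 1 ≤ P.Δ) {p : P.Proc}
    (hp : p ∈ E.correct) {t : ℕ} {s : P.State} (hs : E.Mid p t s) : ViewInv s := by
  refine hE.mid_induction hΔ hp (I := fun _ => ViewInv) ?_ ?_ ?_ hs
  · refine ⟨.genesis, Nat.zero_lt_one, fun u h1 h2 => ?_, fun u h1 h2 => ?_⟩
    · simp only [State.receive, init, Setting.genesis] at h1 h2
      omega
    · simp only [State.receive, init] at h2
      omega
  · intro t ht h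
    have hS : (E.state p t).S ⊆ ((E.state p t).next (E.recv p (t + 1))).S :=
      Set.subset_union_left
    refine ⟨h.tip_mem.mono hS, h.tip_view, fun u h1 h2 => (h.tip_null u h1 h2).mono hS,
      fun u h1 h2 => ?_⟩
    rcases h.passed u h1 h2 with ⟨b, h3, h4⟩ | h3
    · exact .inl ⟨b, h3.mono hS, h4⟩
    · exact .inr (h3.mono hS)
  · intro t s s' _ ha _ ih
    have hle := ha.le
    have hpass : ∀ u, 1 ≤ u → u < s.view →
        (∃ b, P.InBlocks s'.S b ∧ b.view = u ∧ (u ∈ s'.voted2 ∨ u ∈ s'.nullified)) ∨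
          P.HasN s'.S u := by
      intro u h1 h2
      rcases ih.passed u h1 h2 with ⟨b, h3, h4, h5⟩ | h3
      · exact .inl ⟨b, h3.mono hle.S, h4,
          h5.imp (fun h => hle.voted2 h) fun h => hle.nullified h⟩
      · exact .inr (h3.mono hle.S)
    rcases ha.view_cases with ⟨h1, h2⟩ | ⟨h1, ⟨h2, h3, h4⟩ | ⟨h2, h3⟩⟩
    · refine ⟨h2 ▸ ih.tip_mem.mono hle.S, by rw [h1, h2]; exact ih.tip_view, ?_, ?_⟩
      · rw [h1, h2]
        exact fun u k1 k2 => (ih.tip_null u k1 k2).mono hle.S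
      · rw [h1]
        exact hpass
    · refine ⟨h2.mono hle.S, by omega, fun u k1 k2 => by omega, fun u k1 k2 => ?_⟩
      obtain k3 | rfl := Nat.lt_succ_iff_lt_or_eq.1 (h1 ▸ k2)
      · exact hpass u k1 k3
      · exact .inl ⟨_, h2.mono hle.S, h3,
          h4.imp (fun h => hle.voted2 h) fun h => hle.nullified h⟩
    · refine ⟨h3 ▸ ih.tip_mem.mono hle.S, by rw [h1, h3]; exact ih.tip_view.trans (by omega),
        ?_, ?_⟩
      · intro u k1 k2
        obtain k3 | rfl := Nat.lt_succ_iff_lt_or_eq.1 (h1 ▸ k2)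
        · exact (ih.tip_null u (h3 ▸ k1) k3).mono hle.S
        · exact h2.mono hle.S
      · intro u k1 k2
        obtain k3 | rfl := Nat.lt_succ_iff_lt_or_eq.1 (h1 ▸ k2)
        · exact hpass u k1 k3
        · exact .inr (h2.mono hle.S)

theorem IsExecution.proposedInv (hE : E.IsExecution) (hΔ : 1 ≤ P.Δ) (hx : 2 ≤ P.x) {p : P.Proc}
    (hp : p ∈ E.correct) {t : ℕ} {s : P.State} (hs : E.Mid p t s) :
    ProposedInv p (E.sent p t s) s := by
  refine hE.sent_induction hΔ hp (J := ProposedInv p) ?_ ?_ ?_ hs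
  · exact fun R => ⟨fun _ _ h => h.elim, fun _ _ h => h.elim, fun _ h => h.elim,
      fun _ h => h.elim⟩
  · exact fun A s R h => ⟨h.block, fun b C h1 h2 => (h.parent b C h1 h2).mono
      Set.subset_union_left, h.initial, h.unique⟩
  · intro t s s' hms ha _ ih
    have hle := ha.le
    have hsub := sent_mono (E := E) (p := p) (t := t) hle.out
    have hold : ∀ b C, (b, C) ∈ s.proposed → p = P.lead b.view ∧
        P.superview b.view ≤ P.superview s'.view ∧ P.Proper b ∧ b.tag = P.tau C b.tag.k ∧
        (P.Initial b.view → b.tag.k = P.n - P.f - 1) ∧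
        ∀ q, (q, .frag b q (P.fragment C b.tag.k q).1 (P.fragment C b.tag.k q).2) ∈
          E.sent p t s' := by
      intro b C hb
      obtain ⟨h1, h2, h3, h4, h5, h6⟩ := ih.block b C hb
      exact ⟨h1, h2.trans (superview_mono hle.view), h3, h4, h5, fun q => hsub (h6 q)⟩
    rcases ha.proposed_cases with h | ⟨bp, ⟨b₀, C₀⟩, h⟩
    · refine ⟨?_, ?_, ?_, ?_⟩
      · rwa [h]
      · rw [h]
        exact fun b C h1 h2 => (ih.parent b C h1 h2).mono hle.S
      · rw [h]
        exact ih.initial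
      · rw [h]
        exact ih.unique
    · have hv1 := hE.one_le_view hΔ hp hms
      have hsv : P.superview b₀.view = P.superview s.view := by
        rcases h.kind with ⟨-, h1, -⟩ | ⟨z, -, -, h1, h2, -⟩
        · rw [h1]
        · rw [h2, h1]
      have hbv : 1 ≤ b₀.view := by
        rcases h.kind with ⟨-, h1, -⟩ | ⟨z, -, -, h1, h2, -⟩ <;> simp only at * <;> omega
      have hb := h.block
      have hsends := h.sends
      simp only at hb hsends
      have htag : b₀.tag = P.tau C₀ (P.g s.S b₀.view) := by rw [hb]
      have hk : b₀.tag.k = P.g s.S b₀.view := by rw [htag]; rfl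
      refine ⟨?_, ?_, ?_, ?_⟩
      · rw [h.proposed]
        rintro b C (hbC | hbC)
        swap
        · exact hold b C hbC
        cases hbC
        refine ⟨h.lead.trans (lead_congr hsv.symm), ?_, ⟨hbv, ?_, ?_, ?_⟩, ?_, ?_, ?_⟩
        · rw [hsv]
          exact superview_mono hle.view
        · rw [hk]
          exact (P.g_mem _ _).1
        · rw [hk]
          exact (P.g_mem _ _).2
        · rw [hb]
          rfl
        · rw [hk, htag]
        · intro hi
          rw [hk, P.g_initial _ _ hi]
        · intro q
          rw [hk]
          exact out_subset_sent (hsends q)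
      · rw [h.proposed]
        rintro b C (hbC | hbC) hi
        swap
        · exact (ih.parent b C hbC hi).mono hle.S
        cases hbC
        -- A proposal for an initial view is a fresh one whose parent is the tip, and `ViewInv`
        -- supplies the N-certificates in between. A follow-up proposal stays in the superview, so
        -- its view is not initial.
        rcases h.kind with ⟨-, h1, rfl⟩ | ⟨z, hz, h0, h1, h2, -⟩
        · have hV := hE.viewInv hΔ hp hms
          simp only at h1
          refine ⟨s.tip, hV.tip_mem.mono hle.S, by rw [hb]; rfl, h1 ▸ hV.tip_view, ?_⟩
          rw [h1]
          exact fun u k1 k2 => (hV.tip_null u k1 k2).mono hle.S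
        · have hz1 := (ih.block z.1 z.2 hz).2.2.1.1
          simp only at h2
          rw [h2] at hi
          exact absurd hi (not_initial_succ hx hz1 (h1.trans h0.symm))
      · rw [h.proposed]
        rintro y (rfl | hy)
        · rcases h.kind with ⟨h1, h2, -⟩ | ⟨z, hz, h1, -, -, -⟩
          · refine ⟨_, Set.mem_insert _ _, rfl, ?_⟩
            rw [h2]
            exact h1.1
          · obtain ⟨z', h3, h4, h5⟩ := ih.initial z hz
            exact ⟨z', .inr h3, by rw [h4, h1, hsv], h5⟩
        · obtain ⟨z', h3, h4, h5⟩ := ih.initial y hy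
          exact ⟨z', .inr h3, h4, h5⟩
      · have key : ∀ z ∈ s.proposed, P.Initial b₀.view → P.Initial z.1.view →
            P.superview b₀.view = P.superview z.1.view → False := by
          intro z hz hi hiz hzz
          rcases h.kind with ⟨h1, h2, -⟩ | ⟨z', hz', h1, h2, h3, -⟩
          · exact h1.2 z hz (hzz.symm.trans hsv)
          · have hz1 := (ih.block z'.1 z'.2 hz').2.2.1.1
            simp only at h3
            rw [h3] at hi
            exact not_initial_succ hx hz1 (h2.trans h1.symm) hi
        rw [h.proposed]
        rintro y (rfl | hy) z (rfl | hz) hi hiz hzz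
        · rfl
        · exact (key z hz hi hiz hzz).elim
        · exact (key y hy hiz hi hzz.symm).elim
        · exact ih.unique y hy z hz hi hiz hzz

/-- Membership in blocks* includes successful decoding from fragments received by a correct
processor. This is where data availability comes from. -/
theorem Endorsed.recovers {t : ℕ} {b : Block D} (hb : E.Endorsed t b) :
    ∃ C, P.Recovers (E.Mc t) b C := by
  obtain ⟨h1, p, hp, h2⟩ := hb
  obtain ⟨-, -, ⟨C, h3⟩, -⟩ := h2.cases_of_view h1
  exact ⟨C, h3.mono P fun j c path hm => ⟨p, hp, some j, hm⟩⟩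

variable (E) in
/-- At least `n - f` stage-2 votes for `b` may exist at `t`. -/
def Certified (t : ℕ) (b : Block D) : Prop :=
  P.n - P.f ≤ {i | E.Available i (.vote2 b i) (t + 1)}.ncard

/-! ### Standing assumptions and quorum intersection -/

/-- Executions for parameters as required by the protocol. -/
structure Regular (E : Run P) : Prop where
  exec : E.IsExecution
  n_large : 4 * P.f + 1 ≤ P.n
  two_le_n : 2 ≤ P.n
  two_le_x : 2 ≤ P.x
  delta_pos : 1 ≤ P.Δ

namespace Regular

variable (h : E.Regular)

include h

theorem mid_state {p : P.Proc} (hp : p ∈ E.correct) {t : ℕ} (ht : E.start p ≤ t) :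
    E.Mid p t (E.state p t) := h.exec.mid_state h.delta_pos hp ht

theorem quiet {p : P.Proc} (hp : p ∈ E.correct) {t : ℕ} (ht : E.start p ≤ t) :
    Quiet p (E.state p t) := h.exec.quiet h.delta_pos hp ht

theorem mono {p : P.Proc} (hp : p ∈ E.correct) {t t' : ℕ} (ht : t ≤ t') :
    StateMono (E.state p t) (E.state p t') := h.exec.mono h.delta_pos hp ht

theorem start_le_of_has {p : P.Proc} (hp : p ∈ E.correct) {t : ℕ} {m : Msg P.n D Tx}
    (hm : P.Has (E.state p t).S m) : E.start p ≤ t := by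
  by_contra ht
  rw [h.exec.state_before p hp t (by omega)] at hm
  obtain ⟨src, hm⟩ := hm
  exact hm

theorem producible {p : P.Proc} (hp : p ∈ E.correct) {t : ℕ} {m : Msg P.n D Tx}
    (hm : P.Has (E.state p t).S m) : E.Producible (t + 1) m :=
  h.exec.producible h.delta_pos h.n_large hp (h.mid_state hp (h.start_le_of_has hp hm)) hm

theorem start_le_of_hasM {p : P.Proc} (hp : p ∈ E.correct) {t : ℕ} {b : Block D}
    (hb : P.HasM (E.state p t).S b) : E.start p ≤ t := by
  rcases hb with hb | hb
  · exact h.start_le_of_has hp hb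
  · obtain ⟨i, hi⟩ := exists_of_lt_ncard hb
    exact h.start_le_of_has hp hi

theorem endorsed_of_hasM {p : P.Proc} (hp : p ∈ E.correct) {t : ℕ} {b : Block D}
    (hb : P.HasM (E.state p t).S b) : E.Endorsed t b :=
  h.exec.endorsed_of_hasM h.delta_pos h.n_large hp (h.mid_state hp (h.start_le_of_hasM hp hb)) hb

theorem mem_sent_of_sentBefore {i : P.Proc} (hi : i ∈ E.correct) {m : Msg P.n D Tx} {t : ℕ}
    (hm : E.SentBefore i m (t + 1)) :
    E.start i ≤ t ∧ ∃ q, (q, m) ∈ E.sent i t (E.state i t) := by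
  obtain ⟨t', h1, q, h2⟩ := hm
  have := h.exec.start_le_of_out hi h2
  exact ⟨by omega, q, mem_sent_state.2 ⟨t', by omega, h2⟩⟩

theorem vote1Inv {p : P.Proc} (hp : p ∈ E.correct) {t : ℕ} (ht : E.start p ≤ t) :
    Vote1Inv p (E.sent p t (E.state p t)) (E.state p t) :=
  h.exec.vote1Inv h.delta_pos hp (h.mid_state hp ht)

theorem vote2Inv {p : P.Proc} (hp : p ∈ E.correct) {t : ℕ} (ht : E.start p ≤ t) :
    Vote2Inv p (E.sent p t (E.state p t)) (E.state p t) :=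
  h.exec.vote2Inv h.delta_pos hp (h.mid_state hp ht)

theorem proposedInv {p : P.Proc} (hp : p ∈ E.correct) {t : ℕ} (ht : E.start p ≤ t) :
    ProposedInv p (E.sent p t (E.state p t)) (E.state p t) :=
  h.exec.proposedInv h.delta_pos h.two_le_x hp (h.mid_state hp ht)

/-- The intersection has at least a + b - n > f elements, too many to be all corrupted. -/
theorem exists_correct_inter {A B : Set P.Proc} {a b : ℕ} (hA : a ≤ A.ncard) (hB : b ≤ B.ncard)
    (hab : P.n + P.f < a + b) : ∃ i ∈ E.correct, i ∈ A ∧ i ∈ B := by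
  have h1 := Set.ncard_union_add_ncard_inter A B (Set.toFinite _) (Set.toFinite _)
  have h2 : (A ∪ B).ncard ≤ P.n := by
    have := Set.ncard_le_ncard (Set.subset_univ (A ∪ B)) (Set.toFinite _)
    rwa [Set.ncard_univ, Nat.card_eq_fintype_card, Fintype.card_fin] at this
  obtain ⟨i, hi, hi'⟩ := h.exec.exists_correct (A := A ∩ B) (by omega)
  exact ⟨i, hi', hi.1, hi.2⟩

/-! Safety -/

/-- Twice n - 3f/2 is 2n - 3f, which exceeds n + f exactly because n > 4f; the common correct voter
has voted once in this view. -/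
theorem eq_of_notarised {p p' : P.Proc} (hp : p ∈ E.correct) (hp' : p' ∈ E.correct) {t : ℕ}
    {b b' : Block D} (hb : P.Notarised (E.state p t).S b) (hb' : P.Notarised (E.state p' t).S b')
    (hv : b.view = b'.view) : b = b' := by
  have hn := h.n_large
  unfold Notarised at hb hb'
  obtain ⟨i, hi, h1, h2⟩ := h.exists_correct_inter
    (A := {i : P.Proc | P.Has (E.state p t).S (.vote1 b i)})
    (B := {i : P.Proc | P.Has (E.state p' t).S (.vote1 b' i)}) le_rfl le_rfl (by omega)
  obtain ⟨hs, q, h3⟩ := h.mem_sent_of_sentBefore hi ((h.producible hp h1).2 hi)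
  obtain ⟨-, q', h4⟩ := h.mem_sent_of_sentBefore hi ((h.producible hp' h2).2 hi)
  exact (h.vote1Inv hi hs).unique q q' b b' h3 h4 hv

theorem eq_of_endorsed {t : ℕ} {b b' : Block D} (hb : E.Endorsed t b) (hb' : E.Endorsed t b')
    (hv : b.view = b'.view) : b = b' := by
  obtain ⟨h1, p, hp, h2⟩ := hb
  obtain ⟨h1', p', hp', h2'⟩ := hb'
  exact h.eq_of_notarised hp hp' (h2.cases_of_view h1).2.1 (h2'.cases_of_view h1').2.1 hv

/-- More than f voters include a correct one, and it checked the parent and the N-certificates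
before voting. -/
theorem parentOk_of_notarised {p : P.Proc} (hp : p ∈ E.correct) {t : ℕ} {b : Block D}
    (hb : P.Notarised (E.state p t).S b) : ∃ i ∈ E.correct, ParentOk (E.state i t).S b := by
  have hn := h.n_large
  unfold Notarised at hb
  obtain ⟨i, hi, hic⟩ := h.exec.exists_correct
    (A := {i | P.Has (E.state p t).S (.vote1 b i)}) (by omega)
  obtain ⟨hs, q, h3⟩ := h.mem_sent_of_sentBefore hic ((h.producible hp hi).2 hic)
  exact ⟨i, hic, ((h.vote1Inv hic hs).sent q b i h3).2.2⟩

/-- The parent of an endorsed block is the genesis block or endorsed. -/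
theorem parent_of_endorsed {t : ℕ} {b : Block D} (hb : E.Endorsed t b) :
    P.Proper b ∧ ∃ i ∈ E.correct, ∃ a, P.Parent a b ∧ a.view < b.view ∧
      (a = P.genesis ∨ E.Endorsed t a) ∧
      ∀ u, a.view < u → u < b.view → P.HasN (E.state i t).S u := by
  obtain ⟨h1, p, hp, h2⟩ := hb
  obtain ⟨h3, h4, -⟩ := h2.cases_of_view h1
  obtain ⟨i, hi, a, h5, h6, h7, h8⟩ := h.parentOk_of_notarised hp h4
  refine ⟨h3, i, hi, a, h6, h7, ?_, h8⟩
  cases h5 with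
  | genesis => exact .inl rfl
  | step a' _ _ _ h10 h11 => exact .inr (h.endorsed_of_hasM hi h11)

theorem certified_of_hasC {p : P.Proc} (hp : p ∈ E.correct) {t : ℕ} {b : Block D}
    (hb : P.HasC (E.state p t).S b) : E.Certified t b := by
  rcases hb with hb | hb
  · exact (h.producible hp hb).2
  · exact hb.trans (Set.ncard_le_ncard (fun i hi => (h.producible hp hi).2) (Set.toFinite _))

theorem endorsed_of_cert {p : P.Proc} (hp : p ∈ E.correct) {t : ℕ} {b : Block D}
    (hb : P.Has (E.state p t).S (.cert b)) : E.Endorsed t b :=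
  h.exec.endorsedMsg h.delta_pos h.n_large hp (h.mid_state hp (h.start_le_of_has hp hb)) hb

theorem nullifiers_of_hasN {p : P.Proc} (hp : p ∈ E.correct) {t v : ℕ}
    (hb : P.HasN (E.state p t).S v) :
    2 * P.f + 1 ≤ {i | E.Available i (.nullify v i) (t + 1)}.ncard := by
  rcases hb with hb | hb
  · exact h.producible hp hb
  · exact hb.trans (Set.ncard_le_ncard (fun i hi => h.producible hp hi) (Set.toFinite _))

/-- The quorums n - f and 2f + 1 add up to n + f + 1, and a correct processor does not both stage-2
vote in and nullify the same view. -/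
theorem not_hasN_of_certified {t : ℕ} {b : Block D} (hb : E.Certified t b) {p : P.Proc}
    (hp : p ∈ E.correct) : ¬ P.HasN (E.state p t).S b.view := by
  intro hN
  have hn := h.n_large
  obtain ⟨i, hi, h1, h2⟩ := h.exists_correct_inter hb (h.nullifiers_of_hasN hp hN) (by omega)
  obtain ⟨hs, q, h3⟩ := h.mem_sent_of_sentBefore hi (h1 hi)
  obtain ⟨-, q', h4⟩ := h.mem_sent_of_sentBefore hi (h2 hi)
  have hI := h.vote2Inv hi hs
  exact (hI.voted _ (hI.sent q b i h3).2).2.1 (hI.sent_nullify q' _ i h4).2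

/-- Descend from `b'` along parents. A step from above `b.view` to below it would need an
N-certificate for `b.view`, so the descent hits that view, where the endorsed block is unique. It
does not stop at genesis earlier, as genesis has view 0. -/
theorem ancestor_of_certified {t : ℕ} {b b' : Block D} (hb : E.Certified t b)
    (hbe : E.Endorsed t b) (hb' : E.Endorsed t b') (hv : b.view ≤ b'.view) :
    P.Ancestor b b' := by
  induction hw : b'.view using Nat.strong_induction_on generalizing b' with
  | _ w ih =>
  subst hw
  obtain hv | hv := hv.eq_or_lt
  · rw [h.eq_of_endorsed hbe hb' hv]
    exact .refl
  · obtain ⟨-, i, hi, a, h1, h2, h3, h4⟩ := h.parent_of_endorsed hb'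
    have h5 : b.view ≤ a.view := by
      by_contra h5
      exact h.not_hasN_of_certified hb hi (h4 _ (by omega) hv)
    have hae : E.Endorsed t a := by
      rcases h3 with rfl | h3
      · have := hbe.1
        simp only [Setting.genesis] at h5
        omega
      · exact h3
    exact (ih _ h2 hae h5 rfl).tail h1

end Regular

end Run

/-! ### Delivery of messages and certificates -/

namespace Setting

variable {D : Type u} {Tx : Type w} {P : Setting D Tx}

theorem Act.own_mem_S {p : P.Proc} {s s' : P.State} (h : Act p s s') {m : Msg P.n D Tx}
    (hm : (p, m) ∈ s'.out) : (p, m) ∈ s.out ∨ (some p, m) ∈ s'.S := by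
  have key : ∀ (A : Set (P.Proc × Msg P.n D Tx)) (s₁ : P.State), s' = s₁.send p A →
      s₁.out = s.out → (p, m) ∈ s.out ∨ (some p, m) ∈ s'.S := by
    rintro A s₁ rfl hs
    rcases hm with hm | hm
    · exact .inl (hs ▸ hm)
    · exact .inr (.inr ⟨m, rfl, hm⟩)
  have keyp : ∀ v bp, Propose p v bp s s' → (p, m) ∈ s.out ∨ (some p, m) ∈ s'.S := by
    rintro v bp ⟨l, -, -, C, k, b, -, -, -, h⟩
    exact key _ _ h rfl
  cases h with
  | cert => exact key _ _ rfl rfl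
  | proposeInitial _ hp hf h => exact keyp _ _ h
  | proposeNext _ y hp hy h1 h2 h => exact keyp _ _ h
  | vote1 => exact key _ _ rfl rfl
  | vote2 => exact key _ _ rfl rfl
  | timeout => exact key _ _ rfl rfl
  | block => exact .inl hm
  | null => exact .inl hm

end Setting

namespace Run

variable {D : Type u} {Tx : Type w} {P : Setting D Tx} {E : Run P}

open Setting

variable (E) in
/-- `S` contains what `q` receives from itself by `T`, and from others by `T + δ`. -/
def Informed (δ : ℕ) (q : P.Proc) (T : ℕ) (S : P.Rcvds) : Prop :=
  (E.state q T).S ⊆ S ∧ ∀ t ≤ T + δ, E.recv q t ⊆ S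

theorem exists_entersAt {p : P.Proc} {v t : ℕ} (hv : E.EnteredBy p v t) :
    ∃ t' ≤ t, E.EntersAt p v t' := by
  classical
  have hex : ∃ t, E.EnteredBy p v t := ⟨t, hv⟩
  exact ⟨Nat.find hex, Nat.find_min' hex hv, Nat.find_spec hex, fun t₀ ht₀ => Nat.find_min hex ht₀⟩

namespace Regular

variable (h : E.Regular)

include h

theorem informed_state {δ : ℕ} {q : P.Proc} (hq : q ∈ E.correct) {T t : ℕ} (ht : T + δ ≤ t) :
    E.Informed δ q T (E.state q t).S :=
  ⟨(h.mono hq (by omega)).S,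
    fun _ ht' => h.exec.recv_subset h.delta_pos hq (ht'.trans ht)⟩

theorem informed_mid {δ : ℕ} {q : P.Proc} (hq : q ∈ E.correct) {T t : ℕ} {s : P.State}
    (hs : E.Mid q t s) (ht : T + δ ≤ t) (ht' : T < t) : E.Informed δ q T s.S :=
  ⟨(h.exec.mono_mid h.delta_pos hq hs ht').S,
    fun _ ht' => h.exec.recv_subset_mid h.delta_pos hq hs (ht'.trans ht)⟩

theorem own_mem_S {p : P.Proc} (hp : p ∈ E.correct) {t : ℕ} {s : P.State} (hs : E.Mid p t s)
    {m : Msg P.n D Tx} (hm : (p, m) ∈ E.sent p t s) : (some p, m) ∈ s.S := by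
  revert hm
  refine h.exec.sent_induction h.delta_pos hp
    (J := fun A s => (p, m) ∈ A → (some p, m) ∈ s.S) ?_ ?_ ?_ hs
  · exact fun R h => h.elim
  · exact fun A s R h hm => .inl (h hm)
  · intro t s s' _ ha _ ih hm
    rcases hm with hm | hm
    · rcases ha.own_mem_S hm with hm | hm
      · exact ha.le.S (ih (.inl hm))
      · exact hm
    · exact ha.le.S (ih (.inr hm))

theorem delivered {δ : ℕ} (hδ : E.DelayBound δ) {p q : P.Proc} (hp : p ∈ E.correct)
    (hq : q ∈ E.correct) {T : ℕ} (hT : E.GST ≤ T) {m : Msg P.n D Tx}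
    (hm : (q, m) ∈ E.sent p T (E.state p T)) {S : P.Rcvds} (hS : E.Informed δ q T S) :
    (some p, m) ∈ S := by
  by_cases hpq : p = q
  · subst hpq
    exact hS.1 (h.own_mem_S hp (h.mid_state hp ((h.exec.start_le p hp).trans hT)) hm)
  · obtain ⟨t', h1, h2⟩ := mem_sent_state.1 hm
    obtain ⟨t₂, -, h3, h4⟩ := hδ p hp q hq hpq t' m h2
    exact hS.2 t₂ (by omega) h4

/-- A certificate held now is either new, and was sent in this timeslot, or was present at the end
of the previous one, and was sent earlier by induction. -/
theorem sent_certificates {p : P.Proc} (hp : p ∈ E.correct) {t : ℕ} (ht : E.start p ≤ t)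
    {m : Msg P.n D Tx} (hm : m ∈ P.certificates (E.state p t).S) (q : P.Proc) :
    (q, m) ∈ E.sent p t (E.state p t) := by
  induction t, ht using Nat.le_induction with
  | base =>
    refine .inl ((h.quiet hp le_rfl).cert m ⟨hm, ?_⟩ q)
    rw [(h.mid_state hp le_rfl).slotInit_le.oldCerts, slotInit_start]
    exact id
  | succ t ht ih =>
    by_cases ho : m ∈ (E.state p (t + 1)).oldCerts
    · rw [(h.mid_state hp (by omega : E.start p ≤ t + 1)).slotInit_le.oldCerts,
        slotInit_succ ht] at ho
      obtain ⟨t', h1, h2⟩ := mem_sent_state.1 (ih ho)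
      exact mem_sent_state.2 ⟨t', by omega, h2⟩
    · exact .inl ((h.quiet hp (by omega)).cert m ⟨hm, ho⟩ q)

section Delivery

variable {δ : ℕ} (hδ : E.DelayBound δ) {p q : P.Proc} (hp : p ∈ E.correct) (hq : q ∈ E.correct)
  {T : ℕ} (hT : E.GST ≤ T) {S : P.Rcvds} (hS : E.Informed δ q T S)

include hδ hp hq hT hS

theorem has_certificate {m : Msg P.n D Tx} (hm : m ∈ P.certificates (E.state p T).S) :
    P.Has S m :=
  ⟨some p, h.delivered hδ hp hq hT
    (h.sent_certificates hp ((h.exec.start_le p hp).trans hT) hm q) hS⟩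

theorem hasM_of_informed {b : Block D} (hb : P.HasM (E.state p T).S b) : P.HasM S b :=
  .inl (h.has_certificate hδ hp hq hT hS (.inl ⟨b, rfl, hb⟩))

theorem hasN_of_informed {v : ℕ} (hv : P.HasN (E.state p T).S v) : P.HasN S v :=
  .inl (h.has_certificate hδ hp hq hT hS (.inr (.inr ⟨v, rfl, hv⟩)))

/-- `blocks` depends on the received messages through M-certificates only, and these are forwarded.
-/
theorem inBlocks_of_informed {b : Block D} (hb : P.InBlocks (E.state p T).S b) :
    P.InBlocks S b :=
  hb.of_hasM fun _ => h.hasM_of_informed hδ hp hq hT hS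

theorem parentOk_of_informed {b : Block D} (hb : ParentOk (E.state p T).S b) : ParentOk S b := by
  obtain ⟨a, h1, h2, h3, h4⟩ := hb
  exact ⟨a, h.inBlocks_of_informed hδ hp hq hT hS h1, h2, h3,
    fun u hu hu' => h.hasN_of_informed hδ hp hq hT hS (h4 u hu hu')⟩

end Delivery

/-! Synchronisation of views -/

theorem one_le_view {p : P.Proc} (hp : p ∈ E.correct) {t : ℕ} (ht : E.start p ≤ t) :
    1 ≤ (E.state p t).view := h.exec.one_le_view h.delta_pos hp (h.mid_state hp ht)

theorem viewInv {p : P.Proc} (hp : p ∈ E.correct) {t : ℕ} (ht : E.start p ≤ t) :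
    ViewInv (E.state p t) := h.exec.viewInv h.delta_pos hp (h.mid_state hp ht)

theorem enteredBy_mono {p : P.Proc} (hp : p ∈ E.correct) {v t t' : ℕ} (hv : E.EnteredBy p v t)
    (ht : t ≤ t') : E.EnteredBy p v t' :=
  ⟨hv.1.trans ht, hv.2.trans (h.mono hp ht).view⟩

/-- If `q` were behind, in a view which `p` had already left, then whatever let `p` leave it has
reached `q` by `T + δ` and lets `q` leave too; but at the end of a timeslot nothing remains to be
done. -/
theorem synced {δ : ℕ} (hδ : E.DelayBound δ) {p q : P.Proc} (hp : p ∈ E.correct)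
    (hq : q ∈ E.correct) {v T : ℕ} (hT : E.GST ≤ T) (hv : E.EnteredBy p v T) :
    E.EnteredBy q v (T + δ) := by
  have hs : E.start q ≤ T + δ := by have := h.exec.start_le q hq; omega
  refine ⟨hs, ?_⟩
  by_contra! hlt
  have hQ := h.quiet hq hs
  have hS := h.informed_state (δ := δ) hq (le_refl (T + δ))
  rcases (h.viewInv hp hv.1).passed _ (h.one_le_view hq hs) (hlt.trans_le hv.2) with
    ⟨b, h1, h2, -⟩ | h1
  · exact hQ.block ⟨b, h.inBlocks_of_informed hδ hp hq hT hS h1, h2⟩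
  · exact hQ.null (h.hasN_of_informed hδ hp hq hT hS h1)

/-- Several views can be passed in one timeslot, hence the assumption that the processor is in `v`
itself at the time considered. -/
theorem timer_of_entersAt {p : P.Proc} (hp : p ∈ E.correct) {v t : ℕ} (hv : E.EntersAt p v t)
    (k : ℕ) (hk : (E.state p (t + k)).view = v) : (E.state p (t + k)).timer = k := by
  induction k with
  | zero =>
    have hle := (h.mid_state hp hv.1.1).slotInit_le
    rcases hv.1.1.eq_or_lt with rfl | hlt
    · rw [slotInit_start] at hle
      rcases hle.view.eq_or_lt with h1 | h1
      · exact hle.timer h1.symm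
      · exact hle.timer_zero h1
    · obtain ⟨t, rfl⟩ : ∃ t', t = t' + 1 := ⟨t - 1, by omega⟩
      rw [slotInit_succ (by omega)] at hle
      refine hle.timer_zero ?_
      have := hv.2 t (by omega)
      have h1 := hv.1.2
      simp only [EnteredBy, not_and, not_le] at this
      exact (this (by omega)).trans_le h1
  | succ k ih =>
    have h1 : (E.state p (t + k)).view = v := by
      have h2 := (h.mono hp (show t + k ≤ t + (k + 1) by omega)).view
      have h3 := (h.mono hp (show t ≤ t + k by omega)).view
      have h4 := hv.1.2
      omega
    have hs := hv.1.1
    have hle := (h.mid_state hp (show E.start p ≤ t + k + 1 by omega)).slotInit_le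
    rw [slotInit_succ (by omega)] at hle
    have := hle.timer (hk.trans h1.symm)
    rw [← add_assoc, this]
    simp only [State.next]
    rw [ih h1]

/-! Progress -/

theorem card_correct : P.n ≤ E.correct.card + P.f := by
  have h1 := h.exec.corrupted
  have h2 := Finset.card_add_card_compl E.correct
  rw [Fintype.card_fin] at h2
  omega

theorem le_ncard_of_correct {A : Finset P.Proc} {φ : P.Proc → Msg P.n D Tx} {δ : ℕ}
    (hδ : E.DelayBound δ) (hA : A ⊆ E.correct) {q : P.Proc} (hq : q ∈ E.correct) {T : ℕ}
    (hT : E.GST ≤ T) {S : P.Rcvds} (hS : E.Informed δ q T S)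
    (hm : ∀ i ∈ A, (q, φ i) ∈ E.sent i T (E.state i T)) :
    A.card ≤ {i | P.Has S (φ i)}.ncard := by
  rw [← Set.ncard_coe_finset]
  exact Set.ncard_le_ncard (fun i hi => ⟨some i, h.delivered hδ (hA hi) hq hT (hm i hi) hS⟩)
    (Set.toFinite _)

theorem endorsed_of_vote2 {i : P.Proc} (hi : i ∈ E.correct) {T : ℕ} (hT : E.start i ≤ T)
    {b : Block D} (hm : (i, .vote2 b i) ∈ E.sent i T (E.state i T)) : E.Endorsed T b :=
  h.exec.endorsedMsg h.delta_pos h.n_large hi (h.mid_state hi hT)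
    ⟨_, h.own_mem_S hi (h.mid_state hi hT) hm⟩ hi

theorem exists_entered_succ {v : ℕ} (hv : ∀ p ∈ E.correct, ∃ t, E.EnteredBy p v t)
    {r : P.Proc} (hr : r ∈ E.correct) : ∃ t, E.EnteredBy r (v + 1) t := by
  classical
  by_contra! hstuck
  have hδ := h.exec.delay
  -- By synchronisation, one processor that gets on would pull `r` along, so all correct processors
  -- are stuck.
  have hno : ∀ p ∈ E.correct, ∀ t, ¬ E.EnteredBy p (v + 1) t := fun p hp t ht =>
    hstuck _ (h.synced hδ hp hr (le_max_right t E.GST)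
      (h.enteredBy_mono hp ht (le_max_left t E.GST)))
  obtain ⟨t₀, ht₀⟩ := hv r hr
  set T₀ := max t₀ E.GST + P.Δ
  have hG : E.GST ≤ T₀ := (le_max_right _ _).trans (Nat.le_add_right _ _)
  have hall : ∀ p ∈ E.correct, E.EnteredBy p v T₀ := fun p hp =>
    h.synced hδ hr hp (le_max_right t₀ E.GST) (h.enteredBy_mono hr ht₀ (le_max_left _ _))
  have hview : ∀ p ∈ E.correct, ∀ t, E.EnteredBy p v t → (E.state p t).view = v := by
    intro p hp t ht
    have h1 := hno p hp t
    have h2 := ht.2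
    simp only [EnteredBy, not_and, not_le] at h1
    have := h1 ht.1
    omega
  -- The longest time-out is 3Δ, so it has expired for everyone by `T`.
  set T := T₀ + 3 * P.Δ
  have hGT : E.GST ≤ T := by omega
  have hstart : ∀ p ∈ E.correct, E.start p ≤ T := fun p hp => (h.exec.start_le p hp).trans hGT
  have hdone : ∀ p ∈ E.correct, v ∈ (E.state p T).voted2 ∨ v ∈ (E.state p T).nullified := by
    intro p hp
    obtain ⟨t₁, h1, h2⟩ := exists_entersAt (hall p hp)
    have key : ∀ k ≤ 3 * P.Δ, ((E.state p (t₁ + k)).view = v → (E.state p (t₁ + k)).timer = k →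
        TimeoutReady (E.state p (t₁ + k))) → v ∈ (E.state p T).nullified := by
      intro k hk hr
      have hen := h.enteredBy_mono hp h2.1 (show t₁ ≤ t₁ + k by omega)
      have hvw := hview p hp _ hen
      have := (h.quiet hp hen.1).timeout (hr hvw (h.timer_of_entersAt hp h2 k hvw))
      rw [hvw] at this
      exact (h.mono hp (by omega)).nullified this
    by_cases hv2 : v ∈ (E.state p T).voted2
    · exact .inl hv2
    right
    have hv2' : ∀ k ≤ 3 * P.Δ, v ∉ (E.state p (t₁ + k)).voted2 := fun k hk hh =>
      hv2 ((h.mono hp (by omega)).voted2 hh)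
    by_cases hi : P.Initial v
    · exact key (3 * P.Δ) le_rfl fun e1 e2 =>
        .inr (.inr (.inr ⟨e1.symm ▸ hi, e2, e1.symm ▸ hv2' _ le_rfl⟩))
    · exact key (2 * P.Δ) (by omega) fun e1 e2 =>
        .inr (.inl ⟨e1.symm ▸ hi, e2, e1.symm ▸ hv2' _ (by omega)⟩)
  have hS := h.informed_state (δ := P.Δ) hr (le_refl (T + P.Δ))
  have her := h.enteredBy_mono hr (hall r hr) (show T₀ ≤ T + P.Δ by omega)
  have hQ := h.quiet hr her.1
  have hvw := hview r hr _ her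
  set N := E.correct.filter fun p => v ∈ (E.state p T).nullified
  set V := E.correct.filter fun p => v ∈ (E.state p T).voted2
  have hNV : E.correct.card ≤ N.card + V.card := by
    refine (Finset.card_le_card ?_).trans (Finset.card_union_le N V)
    intro p hp
    simp only [N, V, Finset.mem_union, Finset.mem_filter]
    exact (hdone p hp).symm.imp (⟨hp, ·⟩) (⟨hp, ·⟩)
  have hc := h.card_correct
  have hn := h.n_large
  -- At least n - f ≥ 3f + 1 correct processors have nullified or voted: if at most 2f have
  -- nullified, then at least f + 1 have voted, which is enough for an M-certificate.
  by_cases hN : 2 * P.f + 1 ≤ N.card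
  · refine hQ.null (.inr (hN.trans ?_))
    rw [hvw]
    refine h.le_ncard_of_correct hδ (Finset.filter_subset _ _) hr hGT hS fun i hi => ?_
    obtain ⟨hi, hi'⟩ := Finset.mem_filter.1 hi
    exact (h.vote2Inv hi (hstart i hi)).nullified v hi' r
  · have hV : P.f + 1 ≤ V.card := by omega
    obtain ⟨i₀, hi₀⟩ : V.Nonempty := Finset.card_pos.1 (by omega)
    obtain ⟨hi₀, hi₀'⟩ := Finset.mem_filter.1 hi₀
    obtain ⟨-, -, b, hb, ⟨hpr, a, ha1, ha2⟩, hsent⟩ :=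
      (h.vote2Inv hi₀ (hstart i₀ hi₀)).voted v hi₀'
    -- Blocks voted for by correct processors are endorsed, so all these votes in view `v` are for
    -- the same block and can be counted together.
    have hbe := h.endorsed_of_vote2 hi₀ (hstart _ hi₀) (hsent i₀)
    have hM : P.HasM (E.state r (T + P.Δ)).S b := by
      refine .inr (hV.trans ?_)
      refine h.le_ncard_of_correct hδ (Finset.filter_subset _ _) hr hGT hS fun i hi => ?_
      obtain ⟨hi, hi'⟩ := Finset.mem_filter.1 hi
      obtain ⟨-, -, b', hb', -, hsent'⟩ := (h.vote2Inv hi (hstart i hi)).voted v hi'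
      have hbe' := h.endorsed_of_vote2 hi (hstart _ hi) (hsent' i)
      rw [h.eq_of_endorsed hbe hbe' (hb.trans hb'.symm)]
      exact hsent' r
    exact hQ.block ⟨b, .step a b (h.inBlocks_of_informed hδ hi₀ hr hGT hS ha1) ha2 hpr hM,
      hb.trans hvw.symm⟩

theorem exists_entered {v : ℕ} (hv : 1 ≤ v) : ∀ p ∈ E.correct, ∃ t, E.EnteredBy p v t := by
  induction v, hv using Nat.le_induction with
  | base => exact fun p hp => ⟨E.start p, le_rfl, h.one_le_view hp le_rfl⟩
  | succ v _ ih => exact fun p hp => h.exists_entered_succ ih hp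

end Regular

/-! ### Initial views with a correct leader -/

/-- After `GST`, `t` is the first timeslot at which a correct processor enters the initial view `v`,
whose leader is correct. -/
structure LeaderCase (E : Run P) (δ v t : ℕ) : Prop extends E.Regular where
  δ_le : δ ≤ P.Δ
  delay : E.DelayBound δ
  one_le : 1 ≤ v
  initial : P.Initial v
  lead_correct : P.lead v ∈ E.correct
  first : E.FirstEntry v t
  gst_le : E.GST ≤ t

variable (E) in
/-- No correct processor has nullified `v` by `t`. -/
def NotNullified (v t : ℕ) : Prop := ∀ q ∈ E.correct, v ∉ (E.state q t).nullified

namespace LeaderCase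

variable {δ v t : ℕ} (h : E.LeaderCase δ v t)

include h

theorem start_le {q : P.Proc} (hq : q ∈ E.correct) {τ : ℕ} (hτ : t ≤ τ) : E.start q ≤ τ :=
  (h.exec.start_le q hq).trans (h.gst_le.trans hτ)

theorem entered {q : P.Proc} (hq : q ∈ E.correct) {τ : ℕ} (hτ : t + δ ≤ τ) :
    E.EnteredBy q v τ := by
  obtain ⟨⟨p, hp, h1⟩, -⟩ := h.first
  exact h.enteredBy_mono hq (h.synced h.delay hp hq h.gst_le h1.1) hτ

theorem le_of_mid {q : P.Proc} (hq : q ∈ E.correct) {τ : ℕ} {s : P.State}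
    (hs : E.Mid q τ s) (hv : v ≤ s.view) : t ≤ τ := by
  by_contra hlt
  exact h.first.2 q hq τ (by omega) ⟨hs.start_le, hv.trans hs.le_state.view⟩

/-- The timer starts from 0 upon entry, and no correct processor enters `v` before `t`. So a given
timer value bounds from below the time elapsed since `t`, which is what rules out early time-outs.
-/
theorem timer_le {q : P.Proc} (hq : q ∈ E.correct) {τ : ℕ} {s : P.State}
    (hs : E.Mid q τ s) (hv : s.view = v) : s.timer + t ≤ τ := by
  revert hv
  refine h.exec.mid_induction h.delta_pos hq (I := fun τ s => s.view = v → s.timer + t ≤ τ)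
    ?_ ?_ ?_ hs
  · intro hv
    rw [← slotInit_start] at hv
    have := h.le_of_mid hq (h.exec.mid_slotInit h.delta_pos hq le_rfl) hv.ge
    simpa [State.receive, init] using this
  · intro τ hτ ih hv
    have := ih hv
    simp only [State.next]
    omega
  · intro τ s s' _ ha hs' ih hv
    have hle := ha.le
    rcases hle.view.eq_or_lt with h1 | h1
    · rw [hle.timer h1.symm]
      exact ih (h1.trans hv)
    · rw [hle.timer_zero h1, zero_add]
      exact h.le_of_mid hq hs' hv.ge

theorem not_hasN {τ : ℕ} (hN : E.NotNullified v τ) {q : P.Proc} (hq : q ∈ E.correct) :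
    ¬ P.HasN (E.state q τ).S v := by
  intro hv
  obtain ⟨i, hi, hi'⟩ := h.exec.exists_correct
    (lt_of_lt_of_le (by omega) (h.nullifiers_of_hasN hq hv))
  obtain ⟨hs, q', h1⟩ := h.mem_sent_of_sentBefore hi' (hi hi')
  exact hN i hi' ((h.vote2Inv hi' hs).sent_nullify q' v i h1).2

/-- By `t + δ` the leader has entered `v`. If it is still there, the instructions force a proposal
for the superview. If it has left, no N-certificate can be the reason, so some block of view `v` is
in `blocks`; it carries the leader's signature and hence is a proposal of the leader. -/
theorem exists_proposed (hN : E.NotNullified v (t + δ)) :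
    ∃ b C, (b, C) ∈ (E.state (P.lead v) (t + δ)).proposed ∧ b.view = v := by
  have hL := h.lead_correct
  have hs := h.start_le hL (Nat.le_add_right t δ)
  have hent := h.entered hL (le_refl (t + δ))
  rcases hent.2.eq_or_lt with hv | hv
  · have hf := (h.quiet hL hs).propose (by rw [← hv])
    have : ∃ y ∈ (E.state (P.lead v) (t + δ)).proposed,
        P.superview y.1.view = P.superview v := by
      by_contra! hno
      refine hf ⟨hv ▸ h.initial, ?_⟩
      rwa [← hv]
    obtain ⟨y, hy, hyv⟩ := this
    have hI := h.proposedInv hL hs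
    obtain ⟨z, hz, hzy, hzi⟩ := hI.initial y hy
    exact ⟨z.1, z.2, hz, eq_of_initial h.two_le_x (hI.block z.1 z.2 hz).2.2.1.1 h.one_le hzi
      h.initial (hzy.trans hyv)⟩
  · rcases (h.viewInv hL hs).passed v h.one_le hv with ⟨b, hb, rfl, -⟩ | hn
    · have hb' := (hb.cases_of_view h.one_le).2.1
      have hsig : E.BlockSigned b (t + δ + 1) := by
        rcases hb' with hb' | hb'
        · exact (h.producible hL hb').1
        · obtain ⟨i, hi⟩ := exists_of_lt_ncard hb'
          exact (h.producible hL hi).1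
      obtain ⟨t₀, h1, C, h2⟩ := hsig h.one_le hL
      exact ⟨b, C, (h.mono hL (by omega)).proposed h2, rfl⟩
    · exact absurd hn (h.not_hasN hN hL)

section Proposed

variable {b : Block D} {C : List Bool}
  (hb : (b, C) ∈ (E.state (P.lead v) (t + δ)).proposed) (hbv : b.view = v)

include hb hbv

/-- A correct leader signs only one block for the initial view of its superview, so every signed
block of view `v` is `b`. -/
theorem eq_of_signed {b' : Block D} {τ : ℕ} (hs : E.BlockSigned b' τ) (hv : b'.view = v) :
    b' = b := by
  have hL := h.lead_correct
  subst hv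
  obtain ⟨t₀, -, C', h2⟩ := hs h.one_le hL
  have h3 := (h.mono hL (le_max_left t₀ (t + δ))).proposed h2
  have h4 := (h.mono hL (le_max_right t₀ (t + δ))).proposed hb
  have hI := h.proposedInv hL (h.start_le hL
    ((Nat.le_add_right t δ).trans (le_max_right t₀ (t + δ))))
  have := hI.unique _ h3 _ h4 h.initial (by rw [hbv]; exact h.initial) (by rw [hbv])
  exact congrArg Prod.fst this

theorem eq_of_inBlocks {q : P.Proc} (hq : q ∈ E.correct) {τ : ℕ} {b' : Block D}
    (hb' : P.InBlocks (E.state q τ).S b') (hv : b'.view = v) : b' = b := by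
  obtain ⟨-, hM, -⟩ := hb'.cases_of_view (hv ▸ h.one_le)
  refine h.eq_of_signed hb hbv (τ := τ + 1) ?_ hv
  rcases hM with hM | hM
  · exact (h.producible hq hM).1
  · obtain ⟨i, hi⟩ := exists_of_lt_ncard hM
    exact (h.producible hq hi).1

theorem proposed_spec : P.Proper b ∧ b.tag = P.tau C b.tag.k ∧ 1 ≤ b.tag.k ∧ b.tag.k ≤ P.n ∧
    b.tag.k = P.n - P.f - 1 := by
  have hL := h.lead_correct
  obtain ⟨-, -, h1, h2, h3, -⟩ := (h.proposedInv hL (h.start_le hL (Nat.le_add_right t δ))).block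
    b C hb
  have h4 := h3 (hbv ▸ h.initial)
  have := h.n_large
  have := h.two_le_n
  exact ⟨h1, h2, by omega, by omega, h4⟩

/-- Together with the fragment, the certificates that justify the parent arrive, since the leader
held them when it proposed and forwards all its certificates. -/
theorem votable {q : P.Proc} (hq : q ∈ E.correct) {S : P.Rcvds}
    (hS : E.Informed δ q (t + δ) S) : ∃ c path, P.Votable q S v b c path := by
  have hL := h.lead_correct
  have hG : E.GST ≤ t + δ := h.gst_le.trans (Nat.le_add_right t δ)
  have hI := h.proposedInv hL (h.start_le hL (Nat.le_add_right t δ))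
  obtain ⟨h1, h2, h3, h4, -⟩ := h.proposed_spec hb hbv
  have hsend := (hI.block b C hb).2.2.2.2.2 q
  obtain ⟨a, ha1, ha2, ha3, ha4⟩ := h.parentOk_of_informed h.delay hL hq hG hS
    (hI.parent b C hb (hbv ▸ h.initial))
  refine ⟨_, _, ⟨_, h.delivered h.delay hL hq hG hsend hS⟩, h1, hbv, ?_, a, ha1, ha2,
    hbv ▸ ha3, hbv ▸ ha4⟩
  rw [h2]
  exact P.certified_fragment C h3 h4 q

theorem voted1_or_inBlocks (hN : E.NotNullified v (t + 2 * δ)) {q : P.Proc}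
    (hq : q ∈ E.correct) : v ∈ (E.state q (t + 2 * δ)).voted1 ∨
      P.InBlocks (E.state q (t + 2 * δ)).S b := by
  have hent := h.entered hq (show t + δ ≤ t + 2 * δ by omega)
  rcases hent.2.eq_or_lt with hv | hv
  · left
    obtain ⟨c, path, hvot⟩ := h.votable hb hbv hq
      (h.informed_state hq (show t + δ + δ ≤ t + 2 * δ by omega))
    have := (h.quiet hq hent.1).vote1 ⟨b, c, path, hv ▸ hvot⟩
    rwa [← hv] at this
  · right
    rcases (h.viewInv hq hent.1).passed v h.one_le hv with ⟨b', h1, h2, -⟩ | hn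
    · exact h.eq_of_inBlocks hb hbv hq h1 h2 ▸ h1
    · exact absurd hn (h.not_hasN hN hq)

/-- If some correct processor has `b` in `blocks` at `t + 2δ`, its M-certificates spread. Otherwise
all correct processors have stage-1 voted for `b`, and their votes and fragments arrive. -/
theorem star_or_inBlocks (hN : E.NotNullified v (t + 2 * δ)) {q : P.Proc}
    (hq : q ∈ E.correct) {S : P.Rcvds} (hS : E.Informed δ q (t + 2 * δ) S) :
    P.InBlocksStar S b ∨ P.InBlocks S b := by
  classical
  have hG : E.GST ≤ t + 2 * δ := h.gst_le.trans (Nat.le_add_right t _)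
  have hL := h.lead_correct
  by_cases hex : ∃ i ∈ E.correct, P.InBlocks (E.state i (t + 2 * δ)).S b
  · obtain ⟨i, hi, hi'⟩ := hex
    exact .inr (h.inBlocks_of_informed h.delay hi hq hG hS hi')
  left
  have hst : ∀ i ∈ E.correct, E.start i ≤ t + 2 * δ :=
    fun i hi => h.start_le hi (Nat.le_add_right t _)
  have hvotes : ∀ i ∈ E.correct, (q, .vote1 b i) ∈ E.sent i (t + 2 * δ) (E.state i (t + 2 * δ)) ∧
      ∃ c path, P.Certified b.tag i c path ∧
        (i ≠ P.lead v → (q, .frag b i c path) ∈ E.sent i (t + 2 * δ) (E.state i (t + 2 * δ))) := by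
    intro i hi
    have hvoted := (h.voted1_or_inBlocks hb hbv hN hi).resolve_right fun hh => hex ⟨i, hi, hh⟩
    obtain ⟨b', c, path, h1, h2, h3, h4⟩ := (h.vote1Inv hi (hst i hi)).voted v hvoted
    have hsig : E.BlockSigned b' (t + 2 * δ + 1) :=
      (h.producible hi ⟨_, h.own_mem_S hi (h.mid_state hi (hst i hi)) (h3 i)⟩).1
    obtain rfl := h.eq_of_signed hb hbv hsig h1
    exact ⟨h3 q, c, path, h2, fun hne => h4 hne q⟩
  obtain ⟨h1, h2, h3, h4, h5⟩ := h.proposed_spec hb hbv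
  have hc := h.card_correct
  have hn := h.n_large
  refine .inr ⟨h1, ?_, ⟨C, ?_⟩, ?_⟩
  · have := h.le_ncard_of_correct h.delay subset_rfl hq hG hS (φ := fun i => .vote1 b i)
      fun i hi => (hvotes i hi).1
    unfold Notarised
    omega
  -- The leader does not disseminate its own fragment. The other correct processors number at least
  -- n - f - 1, which is the value of `k` prescribed for initial views.
  · refine P.decodesFrom_of_certified h2 h3 h4 (E.correct.erase (P.lead v)) ?_ ?_
    · rw [Finset.card_erase_of_mem hL]
      omega
    · intro j hj
      obtain ⟨hj1, hj2⟩ := Finset.mem_erase.1 hj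
      obtain ⟨c, path, hc1, hc2⟩ := (hvotes j hj2).2
      exact ⟨c, path, h.delivered h.delay hj2 hq hG (hc2 hj1) hS, hc1⟩
  · obtain ⟨a, ha1, ha2, -⟩ := (h.vote1Inv hL (hst _ hL)).sent _ _ _ (hvotes _ hL).1 |>.2.2
    exact ⟨a, h.inBlocks_of_informed h.delay hL hq hG hS ha1, ha2⟩

end Proposed

/-- With timer 2Δ the proposal is already votable, and with timer 3Δ the block is in blocks* or
`blocks`; either contradicts the circumstances of a time-out. Only timeslots before `τ` are assumed
free of nullification, so that induction on time applies. -/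
theorem not_timesOut {q : P.Proc} (hq : q ∈ E.correct) {τ : ℕ} {s : P.State}
    (hs : E.Mid q τ s) (hv : s.view = v) (hN : ∀ τ' < τ, E.NotNullified v τ') :
    ¬ TimesOut q s := by
  intro ht
  have htimer := h.timer_le hq hs hv
  have hΔ := h.delta_pos
  have hδ := h.δ_le
  have hi : P.Initial s.view := hv ▸ h.initial
  -- Time-outs of initial views need a timer of at least 2Δ. As Δ ≥ 1, the timeslots `t + δ` and,
  -- for timer 3Δ, `t + 2δ` lie strictly before `τ`, even if δ = Δ.
  have hτ : t + 2 * P.Δ ≤ τ := by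
    rcases ht.ready with h1 | h1 | h1 | h1
    · exact absurd hi h1.1
    · exact absurd hi h1.1
    · have := h1.2.1
      omega
    · have := h1.2.1
      omega
  obtain ⟨b, C, hb, hbv⟩ := h.exists_proposed (hN (t + δ) (by omega))
  rcases ht.ready with h1 | h1 | h1 | h1
  · exact h1.1 hi
  · exact h1.1 hi
  · refine ht.not_votable.elim h1.2.2.1 fun hno => hno ?_
    obtain ⟨c, path, hvot⟩ := h.votable hb hbv hq
      (h.informed_mid hq hs (show t + δ + δ ≤ τ by omega) (by omega))
    exact ⟨b, c, path, hv.symm ▸ hvot⟩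
  · have := h1.2.1
    rcases h.star_or_inBlocks hb hbv (hN _ (by omega)) hq
      (h.informed_mid hq hs (show t + 2 * δ + δ ≤ τ by omega) (by omega)) with h2 | h2
    · exact ht.not_star ⟨b, h2, hbv.trans hv.symm⟩
    · exact ht.not_blocks ⟨b, h2, hbv.trans hv.symm⟩

theorem notNullified (τ : ℕ) : E.NotNullified v τ := by
  induction τ using Nat.strong_induction_on with
  | _ τ ih =>
  intro q hq
  by_cases hs : E.start q ≤ τ
  swap
  · rw [h.exec.state_before q hq τ (by omega)]
    exact id
  refine (h.mid_state hq hs).slot_induction (I := fun s => v ∉ s.nullified) ?_ ?_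
  · unfold slotInit
    split_ifs with h1
    · exact id
    · exact ih (τ - 1) (by omega) q hq
  · intro s s' hms ha _ hv hv'
    rcases ha.nullified_cases hv' with h1 | ⟨h1, h2, h3, -⟩
    · exact hv h1
    -- A time-out in an earlier view of the same superview would also nullify `v`, but `v` is the
    -- first view there.
    · have := le_of_initial h.two_le_x h.one_le
        (h.exec.one_le_view h.delta_pos hq hms) h.initial h2
      exact h.not_timesOut hq hms (le_antisymm h1 this) ih h3

theorem not_sends_nullify {q : P.Proc} (hq : q ∈ E.correct) (τ : ℕ) (r : P.Proc) :
    (r, Msg.nullify v q) ∉ (E.state q τ).out := by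
  intro hm
  have hs := h.exec.start_le_of_out hq hm
  exact h.notNullified τ q hq ((h.vote2Inv hq hs).sent_nullify r v q (out_subset_sent hm)).2

/-- A processor still in `v` finds `b` in blocks* or `blocks`. One that has left did so through a
block, after voting or nullifying. As nullification is excluded, both have voted, and only `b` is
signed for this view. -/
theorem vote2_sent {b : Block D} {C : List Bool}
    (hb : (b, C) ∈ (E.state (P.lead v) (t + δ)).proposed) (hbv : b.view = v) {q : P.Proc}
    (hq : q ∈ E.correct) (r : P.Proc) :
    (r, .vote2 b q) ∈ E.sent q (t + 3 * δ) (E.state q (t + 3 * δ)) := by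
  have hent := h.entered hq (show t + δ ≤ t + 3 * δ by omega)
  have hnull := h.notNullified (t + 3 * δ) q hq
  have hvoted : v ∈ (E.state q (t + 3 * δ)).voted2 := by
    rcases hent.2.eq_or_lt with hv | hv
    · have hQ := h.quiet hq hent.1
      rcases h.star_or_inBlocks hb hbv (h.notNullified _) hq
        (h.informed_state hq (show t + 2 * δ + δ ≤ t + 3 * δ by omega)) with h2 | h2
      · have := hQ.vote2 ⟨b, h2, hbv.trans hv⟩
        rw [← hv] at this
        exact this.resolve_left hnull
      · exact absurd ⟨b, h2, hbv.trans hv⟩ hQ.block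
    · rcases (h.viewInv hq hent.1).passed v h.one_le hv with ⟨b', -, -, h3⟩ | hn
      · exact h3.resolve_right hnull
      · exact absurd hn (h.not_hasN (h.notNullified _) hq)
  obtain ⟨-, -, b', h1, -, h2⟩ := (h.vote2Inv hq hent.1).voted v hvoted
  have hsig : E.BlockSigned b' (t + 3 * δ + 1) :=
    (h.producible hq ⟨_, h.own_mem_S hq (h.mid_state hq hent.1) (h2 q)⟩).1
  obtain rfl := h.eq_of_signed hb hbv hsig h1
  exact h2 r

/-- The n - f correct votes give the stage-2 certificate, and also the M-certificate which puts `b`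
into `blocks` and ends the view, its parent having come from the leader. -/
theorem finalised {b : Block D} {C : List Bool}
    (hb : (b, C) ∈ (E.state (P.lead v) (t + δ)).proposed) (hbv : b.view = v) {q : P.Proc}
    (hq : q ∈ E.correct) :
    P.HasC (E.state q (t + 4 * δ)).S b ∧ E.EnteredBy q (v + 1) (t + 4 * δ) := by
  have hL := h.lead_correct
  have hG : E.GST ≤ t + 3 * δ := h.gst_le.trans (Nat.le_add_right t _)
  have hS := h.informed_state (δ := δ) hq (show t + 3 * δ + δ ≤ t + 4 * δ by omega)
  have hcount := h.le_ncard_of_correct h.delay subset_rfl hq hG hS (φ := fun i => .vote2 b i)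
    fun i hi => h.vote2_sent hb hbv hi q
  have hc := h.card_correct
  have hn := h.n_large
  refine ⟨.inr (by omega), ?_⟩
  have hent := h.entered hq (show t + δ ≤ t + 4 * δ by omega)
  refine ⟨hent.1, ?_⟩
  by_contra hlt
  have hv : v = (E.state q (t + 4 * δ)).view := le_antisymm hent.2 (by omega)
  refine (h.quiet hq hent.1).block ⟨b, ?_, hbv.trans hv⟩
  have hstL := h.start_le hL (Nat.le_add_right t δ)
  obtain ⟨a, ha1, ha2, -⟩ := (h.proposedInv hL hstL).parent b C hb (hbv ▸ h.initial)
  exact .step a b (h.inBlocks_of_informed h.delay hL hq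
    (h.gst_le.trans (Nat.le_add_right t δ))
    (h.informed_state hq (show t + δ + δ ≤ t + 4 * δ by omega)) ha1) ha2
    (h.proposed_spec hb hbv).1 (.inr (by omega))

end LeaderCase

end Run

namespace Setting

variable {D : Type u} {Tx : Type w} {P : Setting D Tx}

/-! Chains of blocks and the function `F` -/

/-- `l` consists of `b`, its parent, and so on, without the genesis block in which this ends. -/
inductive ChainTo (P : Setting D Tx) : List (Block D) → Block D → Prop where
  | genesis : ChainTo P [] P.genesis
  | cons (l a b) (h : ChainTo P l a) (hab : P.Parent a b) : ChainTo P (b :: l) b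

theorem ChainTo.suffix_of_ancestor {a b : Block D} {l : List (Block D)} (hab : P.Ancestor a b)
    (hl : ChainTo P l b) : ∃ l', ChainTo P l' a ∧ l' <:+ l := by
  induction hab generalizing l with
  | refl => exact ⟨l, hl, List.suffix_rfl⟩
  | tail _ h ih =>
    cases hl with
    | genesis => exact absurd h (not_parent_genesis _)
    | cons l a' _ h1 h2 =>
      obtain rfl := h.eq h2
      obtain ⟨l', h3, h4⟩ := ih h1
      exact ⟨l', h3, h4.trans (List.suffix_cons _ _)⟩

theorem ChainTo.mem_of_ancestor {a b : Block D} {l : List (Block D)} (hl : ChainTo P l b)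
    (hab : P.Ancestor a b) (ha : a ≠ P.genesis) : a ∈ l := by
  obtain ⟨l', h1, h2⟩ := hl.suffix_of_ancestor hab
  cases h1 with
  | genesis => exact absurd rfl ha
  | cons => exact h2.subset List.mem_cons_self

theorem ChainTo.isChain {b : Block D} {l : List (Block D)} (hl : ChainTo P l b) :
    (l ++ [P.genesis]).IsChain (fun x y => P.Parent y x) ∧
      (l ++ [P.genesis]).head? = some b := by
  induction hl with
  | genesis => exact ⟨.singleton _, rfl⟩
  | cons l a b _ h ih =>
    refine ⟨?_, rfl⟩
    rw [List.cons_append, List.isChain_cons]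
    refine ⟨fun y hy => ?_, ih.1⟩
    rw [ih.2] at hy
    cases hy
    exact h

/-- Parents are unique because the hash is injective, so a descending chain from `b` has no choice;
it may only stop early or include genesis. -/
theorem ChainTo.prefix {b : Block D} {l r : List (Block D)} (hl : ChainTo P l b)
    (hr : r.IsChain (fun x y => P.Parent y x)) (hb : r.head? = some b) :
    r <+: l ++ [P.genesis] := by
  induction hl generalizing r with
  | genesis =>
    cases r with
    | nil => exact List.nil_prefix
    | cons x r =>
      cases hb
      cases r with
      | nil => exact List.prefix_rfl
      | cons y r => exact absurd (List.isChain_cons_cons.1 hr).1 (not_parent_genesis _)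
  | cons l a b _ h ih =>
    cases r with
    | nil => exact List.nil_prefix
    | cons x r =>
      cases hb
      rw [List.cons_append]
      refine (List.prefix_cons_inj _).2 ?_
      cases r with
      | nil => exact List.nil_prefix
      | cons y r =>
        obtain ⟨h1, h2⟩ := List.isChain_cons_cons.1 hr
        exact ih h2 (by rw [h1.eq h]; rfl)

/-- Read from the newest block downwards, the demand for a certificate at or above every position
reduces to one for the head. -/
theorem extractable_reverse_iff {M : P.Msgs} {r : List (Block D)} :
    P.Extractable M r.reverse ↔ (∀ b ∈ r, b = P.genesis ∨ P.Proper b) ∧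
      r.IsChain (fun x y => P.Parent y x) ∧ (∀ b ∈ r, ∃ C, P.Recovers M b C) ∧
      ∀ b ∈ r.head?, Msg.cert b ∈ M := by
  unfold Extractable
  simp only [List.mem_reverse, List.isChain_reverse]
  refine and_congr_right fun _ => and_congr_right fun _ => ?_
  constructor
  · intro h
    constructor
    · intro b hb
      obtain ⟨i, hi⟩ := List.get_of_mem (List.mem_reverse.2 hb)
      rw [← hi]
      exact (h i).2
    · intro b hb
      cases r with
      | nil => cases hb
      | cons x r =>
        cases hb
        obtain ⟨⟨j, h1, h2⟩, -⟩ := h ⟨r.length, by simp⟩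
        have hj : j = ⟨r.length, by simp⟩ := by
          refine le_antisymm ?_ h1
          have := j.2
          simp only [List.length_reverse, List.length_cons] at this
          exact Fin.mk_le_mk.2 (by omega)
        subst hj
        simpa using h2
  · rintro ⟨h1, h2⟩ i
    refine ⟨?_, h1 _ (List.mem_reverse.1 (List.get_mem _ _))⟩
    cases r with
    | nil => exact i.elim0
    | cons x r =>
      refine ⟨⟨r.length, by simp⟩, ?_, ?_⟩
      · have := i.2
        simp only [List.length_reverse, List.length_cons] at this
        exact Fin.mk_le_mk.2 (by omega)
      · simpa using h2 x rfl

theorem F_eq_of_unique {M : P.Msgs} {l : List (Block D)} (hl : P.Longest M l)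
    (hu : ∀ l', P.Longest M l' → l' = l) : P.F M = l.flatMap (P.payload M) := by
  have h : ∃! l, P.Longest M l := ⟨l, hl, hu⟩
  rw [F, dif_pos h, hu _ h.choose_spec.1]

/-- `payload` uses an arbitrarily chosen recovered string; injectivity of tags makes the choice
irrelevant. -/
theorem mem_payload {M : P.Msgs} {a : Block D} {C : List Bool} {tr : Tx} (hk : 1 ≤ a.tag.k)
    (hkn : a.tag.k ≤ P.n) (hr : ∃ C, P.Recovers M a C) (hC : P.tau C a.tag.k = a.tag)
    (htr : tr ∈ P.parse C) : tr ∈ P.payload M a := by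
  rw [payload, dif_pos hr]
  rwa [P.tau_injective hk hkn (hr.choose_spec.tau_eq.trans hC.symm)]

theorem Known.mono {s s' : P.State} (hS : s.S ⊆ s'.S) (hp : s.proposed ⊆ s'.proposed)
    {b : Block D} {tr : Tx} (h : Known s b tr) : Known s' b tr := by
  obtain ⟨a, C, h1, h2, h3⟩ := h
  exact ⟨a, C, h1, h2.imp (fun h => h.mono fun m hm => hm.mono hS) fun h => hp h, h3⟩

end Setting

/-! ### The longest sequence of blocks and liveness -/

namespace Run

variable {D : Type u} {Tx : Type w} {P : Setting D Tx} {E : Run P}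

open Setting

namespace Regular

variable (h : E.Regular)

include h

theorem exists_chainTo {t : ℕ} {b : Block D} (hb : E.Endorsed t b) :
    ∃ l, ChainTo P l b ∧ ∀ c ∈ l, E.Endorsed t c := by
  induction hw : b.view using Nat.strong_induction_on generalizing b with
  | _ w ih =>
  subst hw
  obtain ⟨-, i, hi, a, h1, h2, h3, -⟩ := h.parent_of_endorsed hb
  rcases h3 with rfl | h3
  · exact ⟨[b], .cons _ _ _ .genesis h1, by simpa using hb⟩
  · obtain ⟨l, h4, h5⟩ := ih _ h2 h3 rfl
    exact ⟨b :: l, .cons _ _ _ h4 h1, by simpa using ⟨hb, h5⟩⟩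

theorem cert_mem_Mc {t : ℕ} {b : Block D} (hb : Msg.cert b ∈ E.Mc t) :
    E.Endorsed t b ∧ E.Certified t b := by
  obtain ⟨p, hp, hb⟩ := hb
  exact ⟨h.endorsed_of_cert hp hb, h.certified_of_hasC hp (.inl hb)⟩

/-- This bounds the views of certified blocks, so that one of greatest view exists: a correct
processor votes only in views that it has reached. -/
theorem view_le_of_certified {t : ℕ} {b : Block D} (hb : E.Certified t b) :
    ∃ i, b.view ≤ (E.state i t).view := by
  have hn := h.n_large
  obtain ⟨i, hi, hi'⟩ := h.exec.exists_correct (lt_of_lt_of_le (by omega) hb)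
  obtain ⟨hs, q, h1⟩ := h.mem_sent_of_sentBefore hi' (hi hi')
  have hI := h.vote2Inv hi' hs
  exact ⟨i, (hI.voted _ (hI.sent q b i h1).2).1⟩

/-- If some block is certified, then the longest sequence of blocks is unique and contains all
ancestors, other than the genesis block, of all certified blocks. -/
theorem exists_longest {t : ℕ} {b : Block D} (hb : Msg.cert b ∈ E.Mc t) :
    ∃ l : List (Block D), P.F (E.Mc t) = l.flatMap (P.payload (E.Mc t)) ∧
      ∀ a, P.Ancestor a b → a ≠ P.genesis → a ∈ l := by
  classical
  set M := E.Mc t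
  obtain ⟨c, hc, hcmax⟩ : ∃ c, Msg.cert c ∈ M ∧ ∀ c', Msg.cert c' ∈ M → c'.view ≤ c.view := by
    have hbdd : BddAbove {n | ∃ c, Msg.cert c ∈ M ∧ c.view = n} := by
      refine ⟨Finset.univ.sup fun i => (E.state i t).view, ?_⟩
      rintro _ ⟨c, hc, rfl⟩
      obtain ⟨i, hi⟩ := h.view_le_of_certified (h.cert_mem_Mc hc).2
      exact hi.trans (Finset.le_sup (f := fun i => (E.state i t).view) (Finset.mem_univ i))
    obtain ⟨c, hc, hcv⟩ := Nat.sSup_mem (s := {n | ∃ c, Msg.cert c ∈ M ∧ c.view = n})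
      ⟨_, b, hb, rfl⟩ hbdd
    exact ⟨c, hc, fun c' hc' => hcv ▸ le_csSup hbdd ⟨c', hc', rfl⟩⟩
  have hanc : ∀ c', Msg.cert c' ∈ M → P.Ancestor c' c := fun c' hc' =>
    h.ancestor_of_certified (h.cert_mem_Mc hc').2 (h.cert_mem_Mc hc').1 (h.cert_mem_Mc hc).1
      (hcmax c' hc')
  obtain ⟨L, hL, hLe⟩ := h.exists_chainTo (h.cert_mem_Mc hc).1
  -- Nothing decides whether fragments of the genesis block circulate. The maximal sequence begins
  -- with it precisely when it can be recovered.
  set G : List (Block D) := if ∃ C, P.Recovers M P.genesis C then [P.genesis] else []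
  have hGpre : ∀ l : List (Block D), l ++ G <+: l ++ [P.genesis] := by
    intro l
    simp only [G]
    split_ifs
    · exact List.prefix_rfl
    · simp
  have hLne : L ≠ [] := by
    rintro rfl
    cases hL
    have := (h.cert_mem_Mc hc).1.1
    simp [Setting.genesis] at this
  have hext : P.Extractable M (L ++ G).reverse := by
    refine extractable_reverse_iff.2 ⟨?_, hL.isChain.1.prefix (hGpre L), ?_, ?_⟩
    · intro x hx
      rcases List.mem_append.1 ((hGpre L).subset hx) with hx | hx
      · exact .inr (h.parent_of_endorsed (hLe x hx)).1
      · exact .inl (by simpa using hx)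
    · intro x hx
      rcases List.mem_append.1 hx with hx | hx
      · exact (hLe x hx).recovers
      · simp only [G] at hx
        split_ifs at hx with hg
        · obtain rfl : x = P.genesis := by simpa using hx
          exact hg
        · cases hx
    · intro x hx
      have : (L ++ G).head? = some c := by
        have := hL.isChain.2
        rw [List.head?_append_of_ne_nil _ hLne] at this ⊢
        exact this
      rw [this] at hx
      cases hx
      exact hc
  -- The head of a competing sequence is certified, hence an ancestor of `c`, so the whole sequence
  -- runs along the chain of `c`. A competitor of full length must then start at `c` and coincide
  -- with `L ++ G`.
  have hcmp : ∀ r : List (Block D), r ≠ [] → P.Extractable M r.reverse →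
      ∃ L', L' <:+ L ∧ r <+: L' ++ G := by
    intro r hr hrE
    obtain ⟨h1, h2, h3, h4⟩ := extractable_reverse_iff.1 hrE
    obtain ⟨x, r, rfl⟩ := List.exists_cons_of_ne_nil hr
    obtain ⟨L', h5, h6⟩ := hL.suffix_of_ancestor (hanc x (h4 x rfl))
    refine ⟨L', h6, ?_⟩
    have hpre := h5.prefix h2 rfl
    simp only [G]
    split_ifs with hg
    · exact hpre
    · rw [List.append_nil]
      refine (List.prefix_concat_iff.1 hpre).resolve_left fun he => hg (h3 _ ?_)
      rw [he]
      simp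
  have hlen : ∀ r : List (Block D), P.Extractable M r.reverse →
      r.length ≤ (L ++ G).length := by
    intro r hrE
    by_cases hr : r = []
    · simp [hr]
    · obtain ⟨L', h1, h2⟩ := hcmp r hr hrE
      have h3 := h1.length_le
      have h4 := h2.length_le
      simp only [List.length_append] at h4 ⊢
      omega
  have hlong : P.Longest M (L ++ G).reverse := by
    refine ⟨hext, fun l hl => ?_⟩
    have := hlen l.reverse (by rwa [List.reverse_reverse])
    rwa [List.length_reverse] at this ⊢
  refine ⟨(L ++ G).reverse, F_eq_of_unique hlong fun l hl => ?_, fun a ha hag => ?_⟩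
  · have hl1 := hl.2 _ hext
    have hpos := List.length_pos_iff.2 hLne
    have hl0 : l.reverse ≠ [] := by
      intro h0
      have := congrArg List.length h0
      simp only [List.length_reverse, List.length_append, List.length_nil] at *
      omega
    obtain ⟨L', h1, h2⟩ := hcmp l.reverse hl0 (by rw [List.reverse_reverse]; exact hl.1)
    have h3 := h1.length_le
    have h4 := h2.length_le
    simp only [List.length_reverse, List.length_append] at hl1 h4
    obtain rfl := h1.eq_of_length (by omega)
    rw [← h2.eq_of_length (by simp only [List.length_reverse, List.length_append]; omega),
      List.reverse_reverse]
  · exact List.mem_reverse.2 (List.mem_append_left _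
      (hL.mem_of_ancestor (ha.trans (hanc b hb)) hag))

theorem cert_mem_of_hasC {p : P.Proc} (hp : p ∈ E.correct) {t : ℕ} (ht : E.start p ≤ t)
    {b : Block D} (hb : P.HasC (E.state p t).S b) : Msg.cert b ∈ E.Mc t :=
  ⟨p, hp, _, h.own_mem_S hp (h.mid_state hp ht)
    (h.sent_certificates hp ht (.inr (.inl ⟨b, rfl, hb⟩)) p)⟩

/-- A transaction received in an earlier superview is known to be in the payload of each block
proposed, or in that of an ancestor. -/
theorem known_of_proposed {p : P.Proc} (hp : p ∈ E.correct) {t₀ : ℕ} {src : Option P.Proc}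
    {tr : Tx} (htr : (src, Msg.tx tr) ∈ E.recv p t₀) {t : ℕ} {s : P.State} (hs : E.Mid p t s) :
    ∀ b C, (b, C) ∈ s.proposed → P.superview (E.state p t₀).view < P.superview b.view →
      Known s b tr := by
  refine h.exec.mid_induction h.delta_pos hp (I := fun t s => ∀ b C, (b, C) ∈ s.proposed →
    P.superview (E.state p t₀).view < P.superview b.view → Known s b tr) ?_ ?_ ?_ hs
  · exact fun _ _ h => h.elim
  · exact fun t _ ih b C hb hv => Known.mono (s' := (E.state p t).next (E.recv p (t + 1)))
      Set.subset_union_left subset_rfl (ih b C hb hv)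
  · intro t s s' hms ha hms' ih
    have hle := ha.le
    rcases ha.proposed_cases with h1 | ⟨bp, ⟨b₀, C₀⟩, h1⟩
    · rw [h1]
      exact fun b C hb hv => (ih b C hb hv).mono hle.S hle.proposed
    · rw [h1.proposed]
      rintro b C (hb | hb) hv
      swap
      · exact (ih b C hb hv).mono hle.S hle.proposed
      cases hb
      have hsv : P.superview b₀.view = P.superview s.view := by
        rcases h1.kind with ⟨-, h2, -⟩ | ⟨z, -, -, h2, h3, -⟩
        · rw [h2]
        · rw [h3, h2]
      -- In the timeslots up to `t₀` the superview has not yet exceeded its value at `t₀`; so the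
      -- transaction was received before the proposal.
      have ht : t₀ < t := by
        by_contra hlt
        have h2 := hms.le_state.view.trans (h.mono hp (not_lt.1 hlt)).view
        have := superview_mono (P := P) h2
        omega
      have hhas : P.Has s.S (.tx tr) :=
        ⟨src, h.exec.recv_subset_mid h.delta_pos hp hms ht.le htr⟩
      obtain ⟨l, rfl, hl⟩ := h1.payload
      -- Either the transaction is known to lie in the parent or below, or the payload rule puts it
      -- into the new block.
      by_cases hk : Known s bp tr
      · obtain ⟨a, C, h2, h3⟩ := hk.mono hle.S hle.proposed
        refine ⟨a, C, h2.tail ?_, h3⟩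
        exact congrArg Block.par h1.block
      · refine ⟨b₀, P.ser l, .refl, .inr ?_, ?_⟩
        · rw [h1.proposed]
          exact Set.mem_insert _ _
        · rw [P.parse_ser]
          exact hl tr hhas hk

theorem exists_firstEntry {v : ℕ} (hv : 1 ≤ v) (hne : E.correct.Nonempty) :
    ∃ t, E.FirstEntry v t := by
  classical
  obtain ⟨p, hp⟩ := hne
  obtain ⟨t, ht⟩ := h.exists_entered hv p hp
  have hex : ∃ t, ∃ q ∈ E.correct, E.EnteredBy q v t := ⟨t, p, hp, ht⟩
  obtain ⟨q, hq, hqv⟩ := Nat.find_spec hex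
  have hmin : ∀ q ∈ E.correct, ∀ t₀ < Nat.find hex, ¬ E.EnteredBy q v t₀ :=
    fun q hq t₀ ht₀ hh => Nat.find_min hex ht₀ ⟨q, hq, hh⟩
  exact ⟨Nat.find hex, ⟨q, hq, hqv, hmin q hq⟩, hmin⟩

theorem liveness : E.Liveness := by
  intro p hp t₀ src tr htr
  have hn := h.n_large
  have hn2 := h.two_le_n
  have hx := h.two_le_x
  set T := max t₀ E.GST
  set V := Finset.univ.sup fun q => (E.state q T).view
  have hV : ∀ q, (E.state q T).view ≤ V := fun q =>
    Finset.le_sup (f := fun q => (E.state q T).view) (Finset.mem_univ q)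
  -- A superview led by `p`, as `k` is congruent to `p` modulo n, and later than every view reached
  -- by `T`; `v` below is its initial view.
  set k := (p : ℕ) + P.n * (V + 1) with hk
  have hkV : V < k := by nlinarith
  obtain ⟨v, hv⟩ : ∃ v, v = (k - 1) * P.x + 1 := ⟨_, rfl⟩
  have hv1 : 1 ≤ v := by omega
  have hvV : V < v := by
    have : (k - 1) * 1 ≤ (k - 1) * P.x := Nat.mul_le_mul_left _ (by omega)
    omega
  have hsv : P.superview v = k := by
    rw [superview, hv, Nat.add_sub_cancel, Nat.mul_div_cancel _ (by omega)]
    omega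
  have hinit : P.Initial v := by
    rw [Initial, hv]
    simp [Nat.ModEq]
  have hlead : P.lead v = p := by
    refine Fin.ext ?_
    simp only [lead, hsv, hk]
    rw [Nat.add_mul_mod_self_left, Nat.mod_eq_of_lt p.2]
  obtain ⟨t, ht⟩ := h.exists_firstEntry hv1 ⟨p, hp⟩
  have hTt : T ≤ t := by
    obtain ⟨⟨q, hq, h1⟩, -⟩ := ht
    by_contra hlt
    have h2 := (h.enteredBy_mono hq h1.1 (show t ≤ T by omega)).2
    have := hV q
    omega
  have hcase : E.LeaderCase P.Δ v t :=
    { h with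
      δ_le := le_rfl
      delay := h.exec.delay
      one_le := hv1
      initial := hinit
      lead_correct := hlead ▸ hp
      first := ht
      gst_le := (le_max_right _ _).trans hTt }
  obtain ⟨b, C, hb, hbv⟩ := hcase.exists_proposed (hcase.notNullified _)
  have hst : E.start p ≤ t + P.Δ := hcase.start_le hp (Nat.le_add_right _ _)
  have hst' : E.start p ≤ t + 4 * P.Δ := hcase.start_le hp (Nat.le_add_right _ _)
  have hcert := h.cert_mem_of_hasC hp hst' (hcase.finalised hb hbv hp).1
  have hb' := hb
  rw [hlead] at hb'
  have hs₀ : P.superview (E.state p t₀).view < P.superview b.view := by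
    rw [hbv, hsv]
    have h1 : (E.state p t₀).view ≤ V := ((h.mono hp (le_max_left _ _)).view).trans (hV p)
    have h2 : P.superview (E.state p t₀).view ≤ (E.state p t₀).view := by
      have h3 := h.one_le_view hp (h.exec.start_le_of_recv hp htr)
      have h4 := Nat.div_le_self ((E.state p t₀).view - 1) P.x
      unfold superview
      omega
    omega
  obtain ⟨a, C', h1, h2, h3⟩ := h.known_of_proposed hp htr (h.mid_state hp hst) b C hb' hs₀
  have htau : P.tau C' a.tag.k = a.tag := by
    rcases h2 with h2 | h2
    · exact h2.tau_eq
    · exact ((h.proposedInv hp hst).block a C' h2).2.2.2.1.symm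
  -- The sequence `F` need not contain genesis, but the payload of genesis is empty and cannot hold
  -- the transaction.
  have hag : a ≠ P.genesis := by
    rintro rfl
    have : C' = P.ser [] := P.tau_injective (k := P.n) (by omega) le_rfl htau
    rw [this, P.parse_ser] at h3
    cases h3
  obtain ⟨l, hF, hl⟩ := h.exists_longest hcert
  obtain ⟨L, hL, hLe⟩ := h.exists_chainTo (h.cert_mem_Mc hcert).1
  have hae := hLe a (hL.mem_of_ancestor h1 hag)
  have hpr := (h.parent_of_endorsed hae).1
  refine ⟨t + 4 * P.Δ, ?_⟩
  rw [hF]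
  exact List.mem_flatMap.2 ⟨a, hl a h1 hag, mem_payload (by have := hpr.2.1; omega)
    (by have := hpr.2.2.1; omega) hae.recovers htau h3⟩

end Regular

end Run

end Carnot

/-! ### The main theorem -/

theorem mainTheorem3 {D Tx : Type*} (P : Carnot.Setting D Tx)
    (hnf : 4 * P.f + 1 ≤ P.n) (hn : 2 ≤ P.n) (hx : 2 ≤ P.x) (hΔ : 1 ≤ P.Δ)
    (E : Carnot.Run P) (hE : E.IsExecution) :
    -- liveness
    E.Liveness ∧
    -- every correct processor enters every view
    (∀ p ∈ E.correct, ∀ v, 1 ≤ v → ∃ t, E.EntersAt p v t) ∧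
    ∀ δ, δ ≤ P.Δ → E.DelayBound δ →
      -- views are synchronised
      (∀ p ∈ E.correct, ∀ v t, 1 ≤ v → E.EntersAt p v t →
        ∀ q ∈ E.correct, E.EnteredBy q v (max t E.GST + δ)) ∧
      -- correct leaders of initial views finalise blocks
      (∀ v t, 1 ≤ v → P.Initial v → P.lead v ∈ E.correct → E.FirstEntry v t → E.GST ≤ t →
        (∃ b : Carnot.Block D, b.view = v ∧
          (∃ C, (b, C) ∈ (E.state (P.lead v) (t + 4 * δ)).proposed) ∧
          (∀ q ∈ E.correct, P.HasC (E.state q (t + 4 * δ)).S b) ∧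
          (∃ s, ∀ a, P.Ancestor a b → a ≠ P.genesis → ∃ C, P.Recovers (E.Mc s) a C)) ∧
        (∀ q ∈ E.correct, E.EnteredBy q (v + 1) (t + 4 * δ)) ∧
        (∀ q ∈ E.correct, ∀ s r, (r, Carnot.Msg.nullify v q) ∉ (E.state q s).out)) := by
  have h : E.Regular := ⟨hE, hnf, hn, hx, hΔ⟩
  refine ⟨h.liveness, fun p hp v hv => ?_, fun δ hδ hd => ⟨?_, ?_⟩⟩
  · obtain ⟨t, ht⟩ := h.exists_entered hv p hp
    obtain ⟨t', -, h1⟩ := Carnot.Run.exists_entersAt ht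
    exact ⟨t', h1⟩
  · exact fun p hp v t _ hv q hq =>
      h.synced hd hp hq (le_max_right _ _) (h.enteredBy_mono hp hv.1 (le_max_left _ _))
  · intro v t hv hi hL hF ht
    have hc : E.LeaderCase δ v t := ⟨h, hδ, hd, hv, hi, hL, hF, ht⟩
    obtain ⟨b, C, hb, hbv⟩ := hc.exists_proposed (hc.notNullified _)
    refine ⟨⟨b, hbv, ⟨C, (h.mono hL (by omega)).proposed hb⟩,
      fun q hq => (hc.finalised hb hbv hq).1, t + 4 * δ, fun a ha hag => ?_⟩,
      fun q hq => (hc.finalised hb hbv hq).2, fun q hq s r => hc.not_sends_nullify hq s r⟩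
    have hcert := h.cert_mem_of_hasC hL (hc.start_le hL (Nat.le_add_right _ _))
      (hc.finalised hb hbv hL).1
    obtain ⟨l, h1, h2⟩ := h.exists_chainTo (h.cert_mem_Mc hcert).1
    exact (h2 a (h1.mem_of_ancestor ha hag)).recovers
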